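/- A \emph{planar map} is a 2-cell decomposition of the oriented sphere into vertices, edges and faces (loops and multiple edges are allowed), considered up to orientation-preserving homeomorphisms preserving cells and incidences. The degree of a face is the number of incidences of edges to it. A map is \emph{rooted} if one of its edges is distinguished and oriented; the face lying to the right of the root edge is called the infinite face, its degree is the outer-degree, and all other faces are called finite. By convention, the map reduced to a single vertex (no edge, one infinite face, of degree $0$) is counted as a rooted planar map. Let $m\ge 1$. Let $$F(t,u;z_1,\ldots,z_m)=\sum_{M} t^{e(M)}\,u^{d(M)}\prod_{i=1}^m z_i^{f_i(M)},$$ where the sum runs over all rooted planar maps $M$ in which no finite face has degree larger than $m$, and where $e(M)$ is the number of edges of $M$, $d(M)$ its outer-degree, and $f_i(M)$ the number of finite faces of degree $i$. Let $$G(t;z_1,\ldots,z_m)=\sum_{M} t^{e(M)}\prod_{i=1}^m z_i^{g_i(M)},$$ where the sum runs over all rooted planar maps $M$ in which no face, finite or infinite, has degree larger than $m$, and where $g_i(M)$ is the number of all faces of degree $i$, including the infinite one. Then the formal power series $F$ is algebraic over $\mathbb{Q}(t,u,z_1,\ldots,z_m)$ and the formal power series $G$ is algebraic over $\mathbb{Q}(t,z_1,\ldots,z_m)$;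 that is, each satisfies a non-trivial polynomial equation whose coefficients are polynomials in its variables with rational coefficients. -/

import Mathlib

/-- A rooted planar map with at least one edge, given by its rotation system on the set `D` of
darts (oriented edges, i.e. each edge together with one of its two orientations).
`σ d` is the dart that follows `d` in counterclockwise order around the starting point of `d`,
`α d` is the dart opposite to `d`, and `root` is the oriented root edge. The vertices, edges and
faces are the cycles (fixed points included) of `σ`, of `α` and of `σ * α`. The map is
connected and, by Euler's relation, drawn on the sphere. Loops and multiple edges are allowed. -/
structure DartMap (D : Type*) where
  σ : Equiv.Perm D
  α : Equiv.Perm D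
  root : D
  α_invol : ∀ d, α (α d) = d
  α_ne : ∀ d, α d ≠ d
  connected : MulAction.IsPretransitive (Subgroup.closure {σ, α}) D
  euler : Nat.card (Quotient (Equiv.Perm.SameCycle.setoid σ))
      + Nat.card (Quotient (Equiv.Perm.SameCycle.setoid (σ * α)))
      = Nat.card (Quotient (Equiv.Perm.SameCycle.setoid α)) + 2

namespace DartMap

variable {D E : Type*}

/-- Faces: the cycle of `d` under `d ↦ σ (α d)` is the face lying to the right of `d`. -/
def Face (M : DartMap D) : Type _ := Quotient (Equiv.Perm.SameCycle.setoid (M.σ * M.α))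

/-- The face lying to the right of the dart `d`. -/
def faceOf (M : DartMap D) (d : D) : M.Face := Quotient.mk _ d

/-- The infinite face is the one to the right of the root edge. -/
def rootFace (M : DartMap D) : M.Face := M.faceOf M.root

/-- The degree of a face: the number of incidences of edges to it. -/
noncomputable def faceDegree (M : DartMap D) (f : M.Face) : ℕ :=
  Nat.card {d : D // M.faceOf d = f}

noncomputable def outerDegree (M : DartMap D) : ℕ := M.faceDegree M.rootFace

/-- The number of faces of degree `i`, the infinite face included. -/
noncomputable def faceCount (M : DartMap D) (i : ℕ) : ℕ :=
  Nat.card {f : M.Face // M.faceDegree f = i}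

/-- The number of finite faces of degree `i`. -/
noncomputable def finiteFaceCount (M : DartMap D) (i : ℕ) : ℕ :=
  Nat.card {f : M.Face // f ≠ M.rootFace ∧ M.faceDegree f = i}

/-- Isomorphism of rooted maps: a relabelling of the darts that respects the root, the
orientation and the incidences. -/
def Iso (M : DartMap D) (N : DartMap E) : Prop :=
  ∃ e : D ≃ E, (∀ d, e (M.σ d) = N.σ (e d)) ∧ (∀ d, e (M.α d) = N.α (e d)) ∧ e M.root = N.root

theorem Iso.refl (M : DartMap D) : M.Iso M := ⟨Equiv.refl D, by simp⟩

theorem Iso.symm {M : DartMap D} {N : DartMap E} : M.Iso N → N.Iso M := by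
  rintro ⟨e, h1, h2, h3⟩
  refine ⟨e.symm, fun d => ?_, fun d => ?_, ?_⟩
  · rw [Equiv.symm_apply_eq, h1, Equiv.apply_symm_apply]
  · rw [Equiv.symm_apply_eq, h2, Equiv.apply_symm_apply]
  · rw [Equiv.symm_apply_eq, h3]

theorem Iso.trans {F : Type*} {M : DartMap D} {N : DartMap E} {P : DartMap F} :
    M.Iso N → N.Iso P → M.Iso P := by
  rintro ⟨e, h1, h2, h3⟩ ⟨f, k1, k2, k3⟩
  exact ⟨e.trans f, by simp [h1, k1], by simp [h2, k2], by simp [h3, k3]⟩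

theorem Iso.exists_face_equiv {M : DartMap D} {N : DartMap E} (h : M.Iso N) :
    ∃ g : M.Face ≃ N.Face, g M.rootFace = N.rootFace ∧
      ∀ f, N.faceDegree (g f) = M.faceDegree f := by
  obtain ⟨e, h1, h2, h3⟩ := h
  have hφ : e.permCongrHom (M.σ * M.α) = N.σ * N.α := by
    ext x
    simp [Equiv.permCongrHom, Equiv.permCongr_apply, h1, h2]
  have hs : ∀ a b, (M.σ * M.α).SameCycle a b ↔ (N.σ * N.α).SameCycle (e a) (e b) := by
    intro a b
    rw [← hφ]
    unfold Equiv.Perm.SameCycle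
    refine exists_congr fun k => ?_
    rw [← map_zpow]
    simp [Equiv.permCongrHom, Equiv.permCongr_apply]
  let g : M.Face ≃ N.Face := Quotient.congr e hs
  have hg : ∀ d, g (M.faceOf d) = N.faceOf (e d) := fun d => rfl
  refine ⟨g, ?_, fun f => ?_⟩
  · rw [rootFace, hg, h3, rootFace]
  · refine (Nat.card_congr (Equiv.subtypeEquiv e fun d => ?_)).symm
    rw [← hg, g.apply_eq_iff_eq]

theorem Iso.outerDegree_eq {M : DartMap D} {N : DartMap E} (h : M.Iso N) :
    M.outerDegree = N.outerDegree := by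
  obtain ⟨g, h1, h2⟩ := h.exists_face_equiv
  rw [outerDegree, outerDegree, ← h1, h2]

theorem Iso.faceCount_eq {M : DartMap D} {N : DartMap E} (h : M.Iso N) :
    M.faceCount = N.faceCount := by
  obtain ⟨g, h1, h2⟩ := h.exists_face_equiv
  funext i
  exact Nat.card_congr (Equiv.subtypeEquiv g fun f => by rw [h2])

theorem Iso.finiteFaceCount_eq {M : DartMap D} {N : DartMap E} (h : M.Iso N) :
    M.finiteFaceCount = N.finiteFaceCount := by
  obtain ⟨g, h1, h2⟩ := h.exists_face_equiv
  funext i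
  exact Nat.card_congr (Equiv.subtypeEquiv g fun f => by
    rw [h2, ← h1, ne_eq, ne_eq, g.apply_eq_iff_eq])

/-- Isomorphism of rooted maps with `n` edges, the darts being labelled by `Fin (2 * n)`. -/
def isoSetoid (n : ℕ) : Setoid (DartMap (Fin (2 * n))) where
  r M N := M.Iso N
  iseqv := ⟨Iso.refl, Iso.symm, Iso.trans⟩

end DartMap

/-- Rooted planar maps up to isomorphism: the map reduced to a single vertex, which has no edge
and a single (infinite) face of degree `0`, and the maps with `n` edges, `n ≥ 1` (there is no
`DartMap` on the empty type). -/
inductive RootedPlanarMap : Type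
  | vertex : RootedPlanarMap
  | ofEdges (n : ℕ) (M : Quotient (DartMap.isoSetoid n)) : RootedPlanarMap

namespace RootedPlanarMap

/-- The number of edges. -/
def edges : RootedPlanarMap → ℕ
  | vertex => 0
  | ofEdges n _ => n

/-- The degree of the infinite face. -/
noncomputable def outerDegree : RootedPlanarMap → ℕ
  | vertex => 0
  | ofEdges _ M => Quotient.lift (fun M => DartMap.outerDegree M)
      (fun _ _ h => DartMap.Iso.outerDegree_eq h) M

/-- The number of faces of degree `i`, the infinite face included. -/
noncomputable def faceCount : RootedPlanarMap → ℕ → ℕ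
  | vertex => fun i => if i = 0 then 1 else 0
  | ofEdges _ M => Quotient.lift (fun M => DartMap.faceCount M)
      (fun _ _ h => DartMap.Iso.faceCount_eq h) M

/-- The number of finite faces of degree `i`. -/
noncomputable def finiteFaceCount : RootedPlanarMap → ℕ → ℕ
  | vertex => fun _ => 0
  | ofEdges _ M => Quotient.lift (fun M => DartMap.finiteFaceCount M)
      (fun _ _ h => DartMap.Iso.finiteFaceCount_eq h) M

/-- There are finitely many rooted planar maps with a given number of edges, so that the
cardinalities below are those of finite sets. -/
theorem finite_edges_eq (n : ℕ) : {M : RootedPlanarMap | M.edges = n}.Finite := by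
  have h1 : Finite (DartMap (Fin (2 * n))) :=
    Finite.of_injective
      (fun M : DartMap (Fin (2 * n)) => (M.σ, M.α, M.root)) (by
        rintro ⟨⟩ ⟨⟩ h
        simp only [Prod.mk.injEq] at h
        obtain ⟨rfl, rfl, rfl⟩ := h
        rfl)
  refine ((Set.finite_range fun M => ofEdges n M).insert vertex).subset ?_
  rintro (_ | ⟨k, M⟩) h
  · exact Set.mem_insert _ _
  · obtain rfl : k = n := h
    exact Set.mem_insert_of_mem _ ⟨M, rfl⟩

end RootedPlanarMap

/-- The variables `t, u, z₁, …, z_m`; `z i` with `i : Fin m` stands for `z_{i+1}`. -/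
inductive FVar (m : ℕ) : Type
  | t : FVar m
  | u : FVar m
  | z (i : Fin m) : FVar m

/-- The variables `t, z₁, …, z_m`; `z i` with `i : Fin m` stands for `z_{i+1}`. -/
inductive GVar (m : ℕ) : Type
  | t : GVar m
  | z (i : Fin m) : GVar m

/-- The exponent of `t^{edges} u^{outer degree} ∏ z_i^{number of finite faces of degree i}`. -/
noncomputable def RootedPlanarMap.fWeight (m : ℕ) (M : RootedPlanarMap) : FVar m →₀ ℕ :=
  Finsupp.single FVar.t M.edges + Finsupp.single FVar.u M.outerDegree
    + ∑ i : Fin m, Finsupp.single (FVar.z i) (M.finiteFaceCount (i + 1))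

/-- The exponent of `t^{edges} ∏ z_i^{number of faces of degree i}`. -/
noncomputable def RootedPlanarMap.gWeight (m : ℕ) (M : RootedPlanarMap) : GVar m →₀ ℕ :=
  Finsupp.single GVar.t M.edges
    + ∑ i : Fin m, Finsupp.single (GVar.z i) (M.faceCount (i + 1))

/-- `F(t, u; z₁, …, z_m)`: the generating function of the rooted planar maps in which no finite
face has degree larger than `m`. -/
noncomputable def finiteFaceGF (m : ℕ) : MvPowerSeries (FVar m) ℚ := fun e =>
  (Nat.card {M : RootedPlanarMap //
    (∀ i, m < i → M.finiteFaceCount i = 0) ∧ M.fWeight m = e} : ℚ)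

/-- `G(t; z₁, …, z_m)`: the face-distribution generating function of the rooted planar maps in
which no face has degree larger than `m`. -/
noncomputable def allFaceGF (m : ℕ) : MvPowerSeries (GVar m) ℚ := fun e =>
  (Nat.card {M : RootedPlanarMap //
    (∀ i, m < i → M.faceCount i = 0) ∧ M.gWeight m = e} : ℚ)

/-! Deleting the root edge gives Tutte's equation. If the root edge is a bridge, the map splits into
two arbitrary rooted maps. Otherwise the deletion merges a finite face, of degree k + 1 say, into
the infinite face, and the map is recovered from what remains and k. With Δ f = (f - f(0)) / u this
reads F = 1 + t u² F² + t u ∑_{k<m} z_{k+1} Δ^k F (`tutte_finiteFaceGF`). The right-hand side is a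
t-adic contraction, so the solution is unique (`eq_of_tutte_eq`).

The bijection behind this, `compose_bijective`, is proved with permutations. Multiplying by a
transposition merges two cycles or splits one; Euler's inequality `euler_le` follows by cutting
edges one at a time, and it forces the pieces of a cut planar map to be planar again. A map with its
root corner marked by an unpaired dart is a `Stub`. The vertex map then has one dart, so that it
needs no separate treatment in the two constructions `Stub.bridge` and `Stub.addEdge`.

Tutte's equation is then solved explicitly. Put V(x) = ∑ z_{k+1} x^k, and let R, S be the series in
t, z with S = t [w^0] V(w + S + R/w) and R = t + t [w^{-1}] V(w + S + R/w) (`exists_RS`). For x = w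
+ S + R/w, the difference x - t V(x) splits as w L(w) + (R/w) L(R/w) with a polynomial L. Define y
by 1/u = 1/y + S + R y, and p by u p = R y L(R y). Then p (1 - t u V(1/u) - u² p) = R L(1/y) L(R y).
This is symmetric in 1/y and R y, whose product is R, hence a polynomial in 1/u without other
occurrences of u. Enough divided differences kill that polynomial, and what is left says that p / t
solves Tutte's equation; thus p = t F (`parametrized_eq`).

It remains to see that R and S are algebraic. They generate over ℚ[t, z] a domain in which both are
multiples of t. Its module of differentials Ω satisfies Ω = t Ω, so by Nakayama some 1 + c t ≠ 0
annihilates it, and the fraction field is unramified, hence algebraic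
(`Algebra.isAlgebraic_of_adjoin_eq_top_of_dvd`). Next, y is quadratic over R, S, u, and t F is a
polynomial expression in algebraic series. Finally G = 1 + ∑ z_{k+1} [u^{k+1}] F, and extracting
coefficients in u preserves algebraicity (`isAlgebraic_ε`, `isAlgebraic_Δ_pow`). -/

section Maps

open Equiv Equiv.Perm

/-! ### Partitions: class sizes, merging two classes, disjoint unions. -/

namespace Setoid

variable {D E : Type*}

/-- The size of the class of `a`. -/
noncomputable def classSize (s : Setoid D) (a : D) : ℕ := Nat.card {d // s d a}

open Classical in
/-- The multiset of the sizes of the classes of a setoid. -/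
noncomputable def classSizes [Finite D] (s : Setoid D) : Multiset ℕ :=
  letI := Fintype.ofFinite (Quotient s)
  Finset.univ.val.map fun q : Quotient s => Nat.card {d // Quotient.mk s d = q}

theorem natCard_mk_eq (s : Setoid D) (a : D) :
    Nat.card {d // Quotient.mk s d = Quotient.mk s a} = s.classSize a :=
  Nat.card_congr (Equiv.subtypeEquivRight fun _ => Quotient.eq)

theorem classSize_congr (s : Setoid D) {a b : D} (h : s a b) : s.classSize a = s.classSize b :=
  Nat.card_congr (Equiv.subtypeEquivRight fun _ =>
    ⟨fun k => s.trans' k h, fun k => s.trans' k (s.symm' h)⟩)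

theorem classSize_pos [Finite D] (s : Setoid D) (a : D) : 0 < s.classSize a :=
  haveI : Nonempty {d // s d a} := ⟨⟨a, s.refl' a⟩⟩
  Nat.card_pos

theorem card_classSizes [Finite D] (s : Setoid D) :
    Multiset.card s.classSizes = Nat.card (Quotient s) := by
  classical
  let _ := Fintype.ofFinite (Quotient s)
  simp [classSizes, Nat.card_eq_fintype_card]

theorem classSizes_eq_of_equiv [Finite D] [Finite E] {s : Setoid D} {t : Setoid E} (e : D ≃ E)
    (h : ∀ x y, s x y ↔ t (e x) (e y)) : s.classSizes = t.classSizes := by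
  classical
  let _ := Fintype.ofFinite (Quotient s)
  let _ := Fintype.ofFinite (Quotient t)
  let g : Quotient s ≃ Quotient t := Quotient.congr e h
  have hg : ∀ d, g (Quotient.mk s d) = Quotient.mk t (e d) := fun d => rfl
  unfold classSizes
  have : (Finset.univ : Finset (Quotient t)) = Finset.univ.map g.toEmbedding := by simp
  rw [this, Finset.map_val, Multiset.map_map]
  refine Multiset.map_congr rfl fun q _ => ?_
  refine Nat.card_congr (Equiv.subtypeEquiv e fun d => ?_)
  change _ ↔ _ = g q
  rw [← hg, g.apply_eq_iff_eq]

theorem classSize_eq_of_equiv {s : Setoid D} {t : Setoid E} (e : D ≃ E)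
    (h : ∀ x y, s x y ↔ t (e x) (e y)) (a : D) : s.classSize a = t.classSize (e a) :=
  Nat.card_congr (Equiv.subtypeEquiv e fun d => h d a)

theorem classSize_mem_classSizes [Finite D] (s : Setoid D) (a : D) :
    s.classSize a ∈ s.classSizes := by
  classical
  let _ := Fintype.ofFinite (Quotient s)
  exact Multiset.mem_map.2 ⟨Quotient.mk s a, by simp, s.natCard_mk_eq a⟩

/-- The sizes of the classes other than the class of `a`. -/
noncomputable def otherClassSizes [Finite D] (s : Setoid D) (a : D) : Multiset ℕ :=
  s.classSizes.erase (s.classSize a)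

theorem classSizes_eq_cons [Finite D] (s : Setoid D) (a : D) :
    s.classSizes = s.classSize a ::ₘ s.otherClassSizes a :=
  (Multiset.cons_erase (s.classSize_mem_classSizes a)).symm

/-- Merge the classes of `a` and `b`. -/
def merge (s : Setoid D) (a b : D) : Setoid D where
  r x y := s x y ∨ (s x a ∨ s x b) ∧ (s y a ∨ s y b)
  iseqv := by
    refine ⟨fun x => Or.inl (s.refl' x), fun {x y} h => ?_, fun {x y z} h k => ?_⟩
    · exact h.imp s.symm' And.symm
    · rcases h with h | ⟨h1, h2⟩ <;> rcases k with k | ⟨k1, k2⟩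
      · exact Or.inl (s.trans' h k)
      · exact Or.inr ⟨k1.imp (s.trans' h) (s.trans' h), k2⟩
      · have k' := s.symm' k
        exact Or.inr ⟨h1, h2.imp (s.trans' k') (s.trans' k')⟩
      · exact Or.inr ⟨h1, k2⟩

theorem merge_apply (s : Setoid D) (a b x y : D) :
    s.merge a b x y ↔ s x y ∨ (s x a ∨ s x b) ∧ (s y a ∨ s y b) := Iff.rfl

theorem le_merge (s : Setoid D) (a b : D) : s ≤ s.merge a b := fun _ _ h => Or.inl h

theorem merge_left_right (s : Setoid D) (a b : D) : s.merge a b a b :=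
  Or.inr ⟨Or.inl (s.refl' a), Or.inr (s.refl' b)⟩

theorem merge_le {s t : Setoid D} {a b : D} (h : s ≤ t) (hab : t a b) : s.merge a b ≤ t := by
  intro x y hxy
  rcases hxy with hxy | ⟨h1, h2⟩
  · exact h hxy
  · have h1' : t x a := h1.elim (fun k => h k) fun k => t.trans' (h k) (t.symm' hab)
    have h2' : t y a := h2.elim (fun k => h k) fun k => t.trans' (h k) (t.symm' hab)
    exact t.trans' h1' (t.symm' h2')

theorem merge_eq_self {s : Setoid D} {a b : D} (h : s a b) : s.merge a b = s :=
  le_antisymm (merge_le le_rfl h) (s.le_merge a b)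

theorem classSize_merge [Finite D] {s : Setoid D} {a b : D} (h : ¬ s a b) :
    (s.merge a b).classSize a = s.classSize a + s.classSize b := by
  classical
  have : ∀ d, s.merge a b d a ↔ s d a ∨ s d b := by
    intro d
    rw [merge_apply]
    have := s.refl' a
    tauto
  rw [classSize, classSize, classSize, ← Nat.card_sum]
  refine Nat.card_congr ((Equiv.subtypeEquivRight this).trans (subtypeOrEquiv _ _ ?_))
  rw [Pi.disjoint_iff]
  intro d
  rw [Prop.disjoint_iff]
  rintro ⟨h1, h2⟩
  exact h (s.trans' (s.symm' h1) h2)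

/-- The projection from old to new classes is injective off the classes of `a` and `b`, and maps the
remaining ones onto everything but the merged class. One common `rest` therefore serves both sides.
-/
theorem exists_classSizes_merge [Finite D] {s : Setoid D} {a b : D} (h : ¬ s a b) :
    ∃ rest, s.classSizes = s.classSize a ::ₘ s.classSize b ::ₘ rest ∧
      (s.merge a b).classSizes = (s.classSize a + s.classSize b) ::ₘ rest := by
  classical
  let _ := Fintype.ofFinite (Quotient s)
  let _ := Fintype.ofFinite (Quotient (s.merge a b))
  let p : Quotient s → Quotient (s.merge a b) := Setoid.map_of_le (s.le_merge a b)
  have hp : ∀ d, p (Quotient.mk s d) = Quotient.mk (s.merge a b) d := fun d => rfl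
  let R : Finset (Quotient s) := (Finset.univ.erase (Quotient.mk s b)).erase (Quotient.mk s a)
  have hab : Quotient.mk s a ≠ Quotient.mk s b := fun k => h (Quotient.exact k)
  have hR : ∀ d, Quotient.mk s d ∈ R ↔ ¬ s d a ∧ ¬ s d b := by
    intro d
    simp only [R, Finset.mem_erase, Finset.mem_univ, and_true, ne_eq]
    rw [Quotient.eq, Quotient.eq]
  have hinj : Set.InjOn p R := by
    intro q hq q' hq' hqq
    induction q using Quotient.inductionOn with | _ x => ?_
    induction q' using Quotient.inductionOn with | _ y => ?_
    rw [Finset.mem_coe, hR] at hq hq'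
    have : s.merge a b x y := Quotient.exact hqq
    rw [merge_apply] at this
    exact Quotient.sound (by change s x y; tauto)
  have himg : R.image p = Finset.univ.erase (Quotient.mk _ a) := by
    ext q
    induction q using Quotient.inductionOn with | _ x => ?_
    simp only [Finset.mem_image, Finset.mem_erase, Finset.mem_univ, and_true]
    constructor
    · rintro ⟨q, hq, hqx⟩ hxa
      induction q using Quotient.inductionOn with | _ y => ?_
      rw [hR] at hq
      rw [hxa] at hqx
      have : s.merge a b y a := Quotient.exact hqx
      rw [merge_apply] at this
      tauto
    · intro hx
      refine ⟨Quotient.mk s x, (hR x).2 ?_, rfl⟩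
      have : ¬ s.merge a b x a := fun k => hx (Quotient.sound k)
      rw [merge_apply] at this
      have := s.refl' a
      tauto
  refine ⟨R.val.map fun q => Nat.card {d // Quotient.mk s d = q}, ?_, ?_⟩
  · unfold classSizes
    have h1 : (Finset.univ : Finset (Quotient s)) =
        (R.cons (Quotient.mk s b) (by simp [hR])).cons (Quotient.mk s a)
          (by simp [R, hab]) := by
      ext q
      by_cases h1 : q = Quotient.mk s a <;> by_cases h2 : q = Quotient.mk s b <;>
        simp [R, h1, h2]
    rw [h1, Finset.cons_val, Finset.cons_val, Multiset.map_cons, Multiset.map_cons, natCard_mk_eq,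
      natCard_mk_eq]
  · unfold classSizes
    have h1 : (Finset.univ : Finset (Quotient (s.merge a b))) =
        (R.image p).cons (Quotient.mk _ a) (by simp [himg]) := by
      ext q
      by_cases h1 : q = Quotient.mk _ a <;> simp [himg, h1]
    rw [h1, Finset.cons_val, Multiset.map_cons, natCard_mk_eq, classSize_merge h,
      Finset.image_val_of_injOn hinj, Multiset.map_map]
    congr 1
    refine Multiset.map_congr rfl fun q hq => ?_
    induction q using Quotient.inductionOn with | _ x => ?_
    have hx : Quotient.mk s x ∈ R := hq
    rw [hR] at hx
    rw [Function.comp_apply, hp, natCard_mk_eq, natCard_mk_eq]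
    refine Nat.card_congr (Equiv.subtypeEquivRight fun d => ?_)
    rw [merge_apply]
    tauto

theorem card_quotient_merge [Finite D] {s : Setoid D} {a b : D} (h : ¬ s a b) :
    Nat.card (Quotient (s.merge a b)) + 1 = Nat.card (Quotient s) := by
  obtain ⟨rest, h1, h2⟩ := exists_classSizes_merge h
  rw [← card_classSizes, ← card_classSizes, h1, h2]
  simp

theorem card_quotient_merge_le [Finite D] (s : Setoid D) (a b : D) :
    Nat.card (Quotient (s.merge a b)) ≤ Nat.card (Quotient s) ∧
      Nat.card (Quotient s) ≤ Nat.card (Quotient (s.merge a b)) + 1 := by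
  by_cases h : s a b
  · rw [merge_eq_self h]; omega
  · have := card_quotient_merge h; omega

/-- The disjoint union of two setoids. -/
def sum (s : Setoid D) (t : Setoid E) : Setoid (D ⊕ E) where
  r := Sum.LiftRel s t
  iseqv := by
    refine ⟨?_, ?_, ?_⟩
    · rintro (x | x)
      · exact .inl (s.refl' x)
      · exact .inr (t.refl' x)
    · rintro _ _ (h | h)
      · exact .inl (s.symm' h)
      · exact .inr (t.symm' h)
    · rintro _ _ _ (h | h) (k | k)
      · exact .inl (s.trans' h k)
      · exact .inr (t.trans' h k)

@[simp] theorem sum_inl_inl (s : Setoid D) (t : Setoid E) (x y : D) :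
    s.sum t (.inl x) (.inl y) ↔ s x y := Sum.liftRel_inl_inl
@[simp] theorem sum_inr_inr (s : Setoid D) (t : Setoid E) (x y : E) :
    s.sum t (.inr x) (.inr y) ↔ t x y := Sum.liftRel_inr_inr
@[simp] theorem sum_inl_inr (s : Setoid D) (t : Setoid E) (x : D) (y : E) :
    ¬ s.sum t (.inl x) (.inr y) := Sum.not_liftRel_inl_inr
@[simp] theorem sum_inr_inl (s : Setoid D) (t : Setoid E) (x : E) (y : D) :
    ¬ s.sum t (.inr x) (.inl y) := Sum.not_liftRel_inr_inl

theorem classSize_sum_inl (s : Setoid D) (t : Setoid E) (a : D) :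
    (s.sum t).classSize (.inl a) = s.classSize a := by
  refine (Nat.card_congr (Equiv.ofBijective (fun d => ⟨.inl d.1, (sum_inl_inl s t _ _).2 d.2⟩)
    ⟨fun x y h => ?_, ?_⟩)).symm
  · simpa [Subtype.ext_iff] using h
  · rintro ⟨x | x, hx⟩
    · exact ⟨⟨x, (sum_inl_inl s t _ _).1 hx⟩, rfl⟩
    · exact absurd hx (sum_inr_inl s t _ _)

theorem classSize_sum_inr (s : Setoid D) (t : Setoid E) (a : E) :
    (s.sum t).classSize (.inr a) = t.classSize a := by
  refine (Nat.card_congr (Equiv.ofBijective (fun d => ⟨.inr d.1, (sum_inr_inr s t _ _).2 d.2⟩)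
    ⟨fun x y h => ?_, ?_⟩)).symm
  · simpa [Subtype.ext_iff] using h
  · rintro ⟨x | x, hx⟩
    · exact absurd hx (sum_inl_inr s t _ _)
    · exact ⟨⟨x, (sum_inr_inr s t _ _).1 hx⟩, rfl⟩

theorem classSizes_sum [Finite D] [Finite E] (s : Setoid D) (t : Setoid E) :
    (s.sum t).classSizes = s.classSizes + t.classSizes := by
  classical
  let _ := Fintype.ofFinite (Quotient s)
  let _ := Fintype.ofFinite (Quotient t)
  let _ := Fintype.ofFinite (Quotient (s.sum t))
  let g : Quotient s ⊕ Quotient t → Quotient (s.sum t) :=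
    Sum.elim (Quotient.map' Sum.inl fun _ _ => (sum_inl_inl s t _ _).2)
      (Quotient.map' Sum.inr fun _ _ => (sum_inr_inr s t _ _).2)
  have hg : Function.Bijective g := by
    constructor
    · rintro (q | q) (q' | q') h <;> induction q using Quotient.inductionOn with | _ x => ?_ <;>
        induction q' using Quotient.inductionOn with | _ y => ?_
      · exact congrArg _ (Quotient.sound ((sum_inl_inl s t _ _).1 (Quotient.exact h)))
      · exact absurd (Quotient.exact h) (sum_inl_inr s t _ _)
      · exact absurd (Quotient.exact h) (sum_inr_inl s t _ _)
      · exact congrArg _ (Quotient.sound ((sum_inr_inr s t _ _).1 (Quotient.exact h)))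
    · intro q
      induction q using Quotient.inductionOn with | _ x => ?_
      rcases x with x | x
      · exact ⟨.inl (Quotient.mk _ x), rfl⟩
      · exact ⟨.inr (Quotient.mk _ x), rfl⟩
  unfold classSizes
  have : (Finset.univ : Finset (Quotient (s.sum t))) =
      Finset.univ.map (Equiv.ofBijective g hg).toEmbedding := by simp
  rw [this, Finset.map_val, Multiset.map_map, ← Finset.univ_disjSum_univ]
  simp only [Finset.disjSum, Multiset.disjSum, Multiset.map_add, Multiset.map_map]
  congr 1
  · refine Multiset.map_congr rfl fun q _ => ?_
    induction q using Quotient.inductionOn with | _ x => ?_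
    exact ((s.sum t).natCard_mk_eq (.inl x)).trans
      ((classSize_sum_inl s t x).trans (s.natCard_mk_eq x).symm)
  · refine Multiset.map_congr rfl fun q _ => ?_
    induction q using Quotient.inductionOn with | _ x => ?_
    exact ((s.sum t).natCard_mk_eq (.inr x)).trans
      ((classSize_sum_inr s t x).trans (t.natCard_mk_eq x).symm)

end Setoid

/-! ### Cycles, transpositions and Euler's inequality. -/

namespace Equiv.Perm

variable {D E : Type*}

/-- The partition into cycles. -/
abbrev cycles (π : Perm D) : Setoid D := SameCycle.setoid π

/-- The number of cycles, fixed points included. -/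
noncomputable abbrev cyc (π : Perm D) : ℕ := Nat.card (Quotient (cycles π))

theorem cycles_apply (π : Perm D) (x y : D) : cycles π x y ↔ SameCycle π x y := Iff.rfl

/-- Reduces inclusions of cycle partitions to a single application of `π`; negative powers come from
symmetry of `s`, so no finiteness is needed. -/
theorem cycles_le_iff {π : Perm D} {s : Setoid D} : cycles π ≤ s ↔ ∀ x, s x (π x) := by
  refine ⟨fun h x => h ⟨1, by simp⟩, fun h x y hxy => ?_⟩
  have hn : ∀ (n : ℕ) x, s x ((π ^ n) x) := by
    intro n
    induction n with
    | zero => intro x; exact s.refl' x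
    | succ n ih => intro x; rw [pow_succ', mul_apply]; exact s.trans' (ih x) (h _)
  obtain ⟨k, rfl⟩ := hxy
  obtain ⟨n, rfl | rfl⟩ := k.eq_nat_or_neg
  · simpa using hn n x
  · have := hn n ((π ^ (-(n : ℤ))) x)
    rw [zpow_neg, zpow_natCast, ← mul_apply, mul_inv_cancel, one_apply] at this
    rw [zpow_neg, zpow_natCast]
    exact s.symm' this

theorem cycles_apply_self (π : Perm D) (x : D) : cycles π x (π x) := cycles_le_iff.1 le_rfl x

theorem cycles_mul_swap_le_merge [DecidableEq D] (π : Perm D) (a b : D) :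
    cycles (π * swap a b) ≤ (cycles π).merge a b := by
  rw [cycles_le_iff]
  intro x
  rw [mul_apply]
  set s := (cycles π).merge a b
  have hs : ∀ x, s x (π x) := fun x => (cycles π).le_merge a b (cycles_apply_self π x)
  have hab : s a b := (cycles π).merge_left_right a b
  by_cases hxa : x = a
  · subst hxa; rw [swap_apply_left]; exact s.trans' hab (hs b)
  by_cases hxb : x = b
  · subst hxb; rw [swap_apply_right]; exact s.trans' (s.symm' hab) (hs a)
  · rw [swap_apply_of_ne_of_ne hxa hxb]; exact hs x

/-- The inclusion `cycles_mul_swap_le_merge` can be applied again to `π * swap a b`, because the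
transposition is its own inverse. As a consequence, the two numbers of cycles differ by at most one.
-/
theorem merge_cycles_mul_swap [DecidableEq D] (π : Perm D) (a b : D) :
    (cycles (π * swap a b)).merge a b = (cycles π).merge a b := by
  refine le_antisymm (Setoid.merge_le (cycles_mul_swap_le_merge π a b)
    ((cycles π).merge_left_right a b)) (Setoid.merge_le ?_ (Setoid.merge_left_right _ a b))
  simpa [mul_assoc] using cycles_mul_swap_le_merge (π * swap a b) a b

/-- From `a` the new permutation jumps to `π b` and then follows the old cycle of `b`, which avoids
`a`, until it comes back to `b`. -/
theorem SameCycle.mul_swap_of_not [DecidableEq D] [Finite D] {π : Perm D} {a b : D}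
    (h : ¬ SameCycle π a b) : SameCycle (π * swap a b) a b := by
  by_contra hb
  have key : ∀ n : ℕ, SameCycle (π * swap a b) a ((π ^ (n + 1)) b) := by
    intro n
    induction n with
    | zero => exact ⟨1, by simp⟩
    | succ n ih =>
      have h1 : (π ^ (n + 1)) b ≠ a := fun k =>
        h (SameCycle.symm ⟨(n + 1 : ℕ), by rwa [zpow_natCast]⟩)
      have h2 : (π ^ (n + 1)) b ≠ b := fun k => hb (by rwa [k] at ih)
      have h3 := cycles_apply_self (π * swap a b) ((π ^ (n + 1)) b)
      rw [mul_apply, swap_apply_of_ne_of_ne h1 h2] at h3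
      rw [pow_succ' _ (n + 1), mul_apply]
      exact ih.trans h3
  have := key (orderOf π - 1)
  rw [Nat.sub_add_cancel (orderOf_pos π), pow_orderOf_eq_one] at this
  exact hb this

theorem cycles_mul_swap [DecidableEq D] [Finite D] {π : Perm D} {a b : D}
    (h : ¬ SameCycle π a b) : cycles (π * swap a b) = (cycles π).merge a b := by
  rw [← merge_cycles_mul_swap]
  exact (Setoid.merge_eq_self (SameCycle.mul_swap_of_not h)).symm

theorem cyc_mul_swap [DecidableEq D] [Finite D] {π : Perm D} {a b : D}
    (h : ¬ SameCycle π a b) : cyc (π * swap a b) + 1 = cyc π := by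
  rw [cyc, cycles_mul_swap h]
  exact Setoid.card_quotient_merge h

theorem cyc_le_cyc_mul_swap [DecidableEq D] [Finite D] (π : Perm D) (a b : D) :
    cyc π ≤ cyc (π * swap a b) + 1 := by
  have h1 := (cycles π).card_quotient_merge_le a b
  have h2 := (cycles (π * swap a b)).card_quotient_merge_le a b
  rw [merge_cycles_mul_swap] at h2
  unfold cyc
  omega

/-- The partition into orbits of the group generated by two permutations. -/
abbrev orbits (σ α : Perm D) : Setoid D := cycles σ ⊔ cycles α

theorem orbits_le_iff {σ α : Perm D} {s : Setoid D} :
    orbits σ α ≤ s ↔ (∀ x, s x (σ x)) ∧ ∀ x, s x (α x) := by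
  rw [sup_le_iff, cycles_le_iff, cycles_le_iff]

theorem cycles_mul_le_orbits (σ α : Perm D) : cycles (σ * α) ≤ orbits σ α := by
  rw [cycles_le_iff]
  intro x
  have h := orbits_le_iff.1 (le_refl (orbits σ α))
  exact Setoid.trans' _ (h.2 x) (h.1 _)

theorem orbits_mul_swap_le_merge [DecidableEq D] (σ α : Perm D) (a b : D) :
    orbits σ (α * swap a b) ≤ (orbits σ α).merge a b :=
  sup_le (le_sup_left.trans (Setoid.le_merge _ a b))
    ((cycles_mul_swap_le_merge α a b).trans (Setoid.merge_le
      (le_sup_right.trans (Setoid.le_merge _ a b)) (Setoid.merge_left_right _ a b)))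

theorem merge_orbits_mul_swap [DecidableEq D] (σ α : Perm D) (a b : D) :
    (orbits σ (α * swap a b)).merge a b = (orbits σ α).merge a b := by
  refine le_antisymm (Setoid.merge_le (orbits_mul_swap_le_merge σ α a b)
    (Setoid.merge_left_right _ a b)) (Setoid.merge_le ?_ (Setoid.merge_left_right _ a b))
  simpa [mul_assoc] using orbits_mul_swap_le_merge σ (α * swap a b) a b

theorem SameCycle.eq_of_fixed {π : Perm D} {a b : D} (h : π a = a) (hab : SameCycle π a b) :
    a = b := by
  obtain ⟨k, rfl⟩ := hab
  exact (zpow_apply_eq_self_of_apply_eq_self h k).symm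

/-- Euler's inequality: the genus of each orbit is nonnegative. -/
theorem euler_le [Finite D] (σ α : Perm D) (hα : ∀ d, α (α d) = d) :
    cyc σ + cyc α + cyc (σ * α) ≤ Nat.card D + 2 * Nat.card (Quotient (orbits σ α)) := by
  classical
  -- Induction on the number of points moved by `α`: one 2-cycle is cut into two fixed points.
  induction hn : Nat.card {d // α d ≠ d} using Nat.strong_induction_on generalizing α with
  | _ n ih => ?_
  by_cases h1 : α = 1
  · subst h1
    have h2 : cycles (1 : Perm D) = ⊥ := by
      ext x y
      rw [cycles_apply]; simp
    have h3 : cyc (1 : Perm D) = Nat.card D := by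
      rw [cyc, h2]; exact Nat.card_congr Setoid.quotientBotEquiv
    have h4 : orbits σ 1 = cycles σ := by rw [orbits, h2, sup_bot_eq]
    rw [h3, h4, mul_one]
    unfold cyc
    omega
  obtain ⟨a, ha⟩ : ∃ a, α a ≠ a := by
    by_contra h
    push Not at h
    exact h1 (Equiv.ext h)
  set b := α a with hb
  set β := α * swap a b with hβ
  have hβα : β * swap a b = α := by rw [hβ, mul_assoc, swap_mul_self, mul_one]
  have hba : α b = a := hα a
  have hβa : β a = a := by rw [hβ, mul_apply, swap_apply_left, hba]
  have hβb : β b = b := by rw [hβ, mul_apply, swap_apply_right]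
  have hβd : ∀ d, d ≠ a → d ≠ b → β d = α d := fun d h h' => by
    rw [hβ, mul_apply, swap_apply_of_ne_of_ne h h']
  have hβ2 : ∀ d, β (β d) = d := by
    intro d
    by_cases hda : d = a
    · rw [hda, hβa, hβa]
    by_cases hdb : d = b
    · rw [hdb, hβb, hβb]
    rw [hβd d hda hdb, hβd, hα]
    · intro h; exact hdb (by rw [hb, ← h, hα])
    · intro h; exact hda (α.injective h)
  have hlt : Nat.card {d // β d ≠ d} < n := by
    rw [← hn]
    have : {d | β d ≠ d} ⊂ {d | α d ≠ d} := by
      refine ⟨fun d hd => ?_, fun h => h (show α a ≠ a from ha) hβa⟩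
      have hda : d ≠ a := fun h => hd (h ▸ hβa)
      have hdb : d ≠ b := fun h => hd (h ▸ hβb)
      change α d ≠ d
      rw [← hβd d hda hdb]; exact hd
    exact Set.ncard_lt_ncard this (Set.toFinite _)
  have hind := ih _ hlt β hβ2 rfl
  have hab : ¬ SameCycle β a b := fun h => ha (h.eq_of_fixed hβa).symm
  have hcα : cyc α + 1 = cyc β := by rw [← hβα]; exact cyc_mul_swap hab
  have hσ : σ * β * swap a b = σ * α := by rw [mul_assoc, hβα]
  have horb : orbits σ α = (orbits σ β).merge a b := by
    rw [hβ, merge_orbits_mul_swap, Setoid.merge_eq_self]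
    exact (orbits_le_iff.1 le_rfl).2 a
  -- Regluing the 2-cycle costs one cycle of `α`. Within one orbit, `σ * α` gains at most one cycle,
  -- so the left side does not grow. Between two orbits, `σ * α` also loses one cycle and one orbit
  -- disappears, so both sides drop by two.
  by_cases hc : orbits σ β a b
  · rw [horb, Setoid.merge_eq_self hc]
    have := cyc_le_cyc_mul_swap (σ * α) a b
    rw [mul_assoc, ← hβ] at this
    omega
  · have h5 := Setoid.card_quotient_merge hc
    have h6 : cyc (σ * α) + 1 = cyc (σ * β) := by
      rw [← hσ]; exact cyc_mul_swap fun h => hc (cycles_mul_le_orbits σ β h)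
    rw [horb]
    omega

/-- Two permutations that generate a transitive group of genus zero. -/
structure Planar (σ α : Perm D) : Prop where
  orbits_eq : orbits σ α = ⊤
  euler : cyc σ + cyc α + cyc (σ * α) = Nat.card D + 2

theorem card_quotient_top [Nonempty D] : Nat.card (Quotient (⊤ : Setoid D)) = 1 := by
  have : Subsingleton (Quotient (⊤ : Setoid D)) :=
    ⟨fun x y => Quotient.inductionOn₂ x y fun _ _ => Quotient.sound trivial⟩
  obtain ⟨a⟩ := ‹Nonempty D›
  have : Nonempty (Quotient (⊤ : Setoid D)) := ⟨Quotient.mk _ a⟩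
  exact Nat.card_eq_one_iff_unique.2 ⟨inferInstance, inferInstance⟩

theorem euler_le_of_orbits_eq_top [Finite D] [Nonempty D] (σ α : Perm D)
    (hα : ∀ d, α (α d) = d) (h : orbits σ α = ⊤) :
    cyc σ + cyc α + cyc (σ * α) ≤ Nat.card D + 2 := by
  have := euler_le σ α hα
  rwa [h, card_quotient_top] at this

section transport

variable {σ α : Perm D} {σ' α' : Perm E} (e : D ≃ E)

theorem sameCycle_iff_of_conj {π : Perm D} {π' : Perm E} (h : ∀ d, e (π d) = π' (e d)) (x y : D) :
    SameCycle π x y ↔ SameCycle π' (e x) (e y) := by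
  have h1 : cycles π ≤ (cycles π').comap e := cycles_le_iff.2 fun x => by
    rw [Setoid.comap_rel, h]; exact cycles_apply_self π' _
  have h2 : cycles π' ≤ (cycles π).comap e.symm := cycles_le_iff.2 fun x => by
    rw [Setoid.comap_rel, show π' x = e (π (e.symm x)) by rw [h, apply_symm_apply],
      symm_apply_apply]
    exact cycles_apply_self π _
  refine ⟨fun k => h1 k, fun k => ?_⟩
  have := h2 k
  rw [Setoid.comap_rel, symm_apply_apply, symm_apply_apply] at this
  exact this

theorem classSizes_eq_of_conj [Finite D] [Finite E] {π : Perm D} {π' : Perm E}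
    (h : ∀ d, e (π d) = π' (e d)) : (cycles π).classSizes = (cycles π').classSizes :=
  Setoid.classSizes_eq_of_equiv e (sameCycle_iff_of_conj e h)

theorem classSize_eq_of_conj {π : Perm D} {π' : Perm E}
    (h : ∀ d, e (π d) = π' (e d)) (a : D) :
    (cycles π).classSize a = (cycles π').classSize (e a) :=
  Setoid.classSize_eq_of_equiv e (sameCycle_iff_of_conj e h) a

theorem cyc_eq_of_conj [Finite D] [Finite E] {π : Perm D} {π' : Perm E}
    (h : ∀ d, e (π d) = π' (e d)) : cyc π = cyc π' := by
  unfold cyc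
  rw [← Setoid.card_classSizes, ← Setoid.card_classSizes, classSizes_eq_of_conj e h]

theorem orbits_le_comap (hσ : ∀ d, e (σ d) = σ' (e d)) (hα : ∀ d, e (α d) = α' (e d)) :
    orbits σ α ≤ (orbits σ' α').comap e := by
  have h := orbits_le_iff.1 (le_refl (orbits σ' α'))
  rw [orbits_le_iff]
  refine ⟨fun x => ?_, fun x => ?_⟩
  · rw [Setoid.comap_rel, hσ]; exact h.1 _
  · rw [Setoid.comap_rel, hα]; exact h.2 _

theorem Planar.of_conj [Finite D] [Finite E] (h : Planar σ α) (hσ : ∀ d, e (σ d) = σ' (e d))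
    (hα : ∀ d, e (α d) = α' (e d)) : Planar σ' α' := by
  refine ⟨Setoid.eq_top_iff.2 fun x y => ?_, ?_⟩
  · have h1 : orbits σ α (e.symm x) (e.symm y) := by rw [h.orbits_eq]; trivial
    have := orbits_le_comap e hσ hα h1
    rwa [Setoid.comap_rel, apply_symm_apply, apply_symm_apply] at this
  · rw [← cyc_eq_of_conj e hσ, ← cyc_eq_of_conj e hα, ← Nat.card_congr e,
      ← cyc_eq_of_conj (π := σ * α) e (fun d => by simp [hσ, hα]), h.euler]

end transport

section sum

theorem cycles_sumCongr (π : Perm D) (π' : Perm E) :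
    cycles (sumCongr π π') = (cycles π).sum (cycles π') := by
  refine le_antisymm (cycles_le_iff.2 ?_) ?_
  · rintro (x | x)
    · simpa using cycles_apply_self π x
    · simpa using cycles_apply_self π' x
  · have h1 : cycles π ≤ (cycles (sumCongr π π')).comap Sum.inl := cycles_le_iff.2 fun x => by
      simpa [Setoid.comap_rel] using cycles_apply_self (sumCongr π π') (Sum.inl x)
    have h2 : cycles π' ≤ (cycles (sumCongr π π')).comap Sum.inr := cycles_le_iff.2 fun x => by
      simpa [Setoid.comap_rel] using cycles_apply_self (sumCongr π π') (Sum.inr x)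
    rintro _ _ (h | h)
    · exact h1 h
    · exact h2 h

theorem cyc_sumCongr [Finite D] [Finite E] (π : Perm D) (π' : Perm E) :
    cyc (sumCongr π π') = cyc π + cyc π' := by
  unfold cyc
  rw [← Setoid.card_classSizes, cycles_sumCongr, Setoid.classSizes_sum, Multiset.card_add,
    Setoid.card_classSizes, Setoid.card_classSizes]

theorem orbits_sumCongr (σ α : Perm D) (σ' α' : Perm E) :
    orbits (sumCongr σ σ') (sumCongr α α') = (orbits σ α).sum (orbits σ' α') := by
  have h := orbits_le_iff.1 (le_refl (orbits σ α))
  have h' := orbits_le_iff.1 (le_refl (orbits σ' α'))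
  have k := orbits_le_iff.1 (le_refl (orbits (sumCongr σ σ') (sumCongr α α')))
  refine le_antisymm (orbits_le_iff.2 ⟨?_, ?_⟩) ?_
  · rintro (x | x)
    · simpa using h.1 x
    · simpa using h'.1 x
  · rintro (x | x)
    · simpa using h.2 x
    · simpa using h'.2 x
  · have h1 : orbits σ α ≤ (orbits (sumCongr σ σ') (sumCongr α α')).comap Sum.inl :=
      orbits_le_iff.2 ⟨fun x => k.1 (Sum.inl x), fun x => k.2 (Sum.inl x)⟩
    have h2 : orbits σ' α' ≤ (orbits (sumCongr σ σ') (sumCongr α α')).comap Sum.inr :=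
      orbits_le_iff.2 ⟨fun x => k.1 (Sum.inr x), fun x => k.2 (Sum.inr x)⟩
    rintro _ _ (h | h)
    · exact h1 h
    · exact h2 h

end sum

/-! ### Inserting a dart into a cycle and removing it again. -/

section insert

open Classical in
/-- Insert the point `none` just before `x`. -/
noncomputable def insertBefore (π : Perm D) (x : D) : Perm (Option D) :=
  swap none (some x) * optionCongr π

theorem insertBefore_def [DecidableEq (Option D)] (π : Perm D) (x : D) :
    insertBefore π x = swap none (some x) * optionCongr π := by
  unfold insertBefore
  congr!

theorem insertBefore_none (π : Perm D) (x : D) : insertBefore π x none = some x := by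
  simp [insertBefore]

theorem insertBefore_some_of_eq {π : Perm D} {x d : D} (h : π d = x) :
    insertBefore π x (some d) = none := by
  simp [insertBefore, h]

theorem insertBefore_some_of_ne {π : Perm D} {x d : D} (h : π d ≠ x) :
    insertBefore π x (some d) = some (π d) := by
  simp [insertBefore, swap_apply_of_ne_of_ne, h]

theorem optionCongr_mul (σ α : Perm D) :
    optionCongr (σ * α) = optionCongr σ * optionCongr α := by
  ext (_ | d) <;> simp

/-- As `none` is fixed by `optionCongr α`, an insertion at a vertex is at the same time an insertion
into a face: the new half-edge sits in the corner before `x`. -/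
theorem insertBefore_mul_optionCongr (σ α : Perm D) (x : D) :
    insertBefore σ x * optionCongr α = insertBefore (σ * α) x := by
  rw [insertBefore, insertBefore, mul_assoc, optionCongr_mul]

/-- Moves the transposition to the right, where the lemmas on merging cycles apply. -/
theorem insertBefore_eq_mul_swap [DecidableEq D] (π : Perm D) (x : D) :
    insertBefore π x = optionCongr π * swap none (some (π⁻¹ x)) := by
  ext1 d
  rcases d with _ | d
  · rw [insertBefore_none]; simp
  · by_cases h : π d = x
    · rw [insertBefore_some_of_eq h]
      simp [← h]
    · rw [insertBefore_some_of_ne h]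
      have : d ≠ π⁻¹ x := fun k => h (by rw [k, ← mul_apply, mul_inv_cancel, one_apply])
      rw [mul_apply, swap_apply_of_ne_of_ne (by simp) (by simpa using this)]
      simp

theorem not_sameCycle_optionCongr (π : Perm D) (x : D) :
    ¬ SameCycle (optionCongr π) none (some x) := fun h => by
  simpa using h.eq_of_fixed (by simp)

theorem optionEquivSum_conj (π : Perm D) (d : Option D) :
    optionEquivSumPUnit.{0} D (optionCongr π d) =
      sumCongr π (1 : Perm PUnit.{1}) (optionEquivSumPUnit.{0} D d) := by
  rcases d with _ | d <;> simp

theorem classSizes_optionCongr [Finite D] (π : Perm D) :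
    (cycles (optionCongr π)).classSizes = (cycles π).classSizes + {1} := by
  rw [classSizes_eq_of_conj _ (optionEquivSum_conj π), cycles_sumCongr, Setoid.classSizes_sum]
  congr 1
  rw [Setoid.classSizes_eq_cons _ PUnit.unit]
  have h1 : (cycles (1 : Perm PUnit.{1})).classSize PUnit.unit = 1 := by
    rw [Setoid.classSize]
    exact Nat.card_eq_one_iff_unique.2 ⟨inferInstance, ⟨⟨PUnit.unit, Setoid.refl' _ _⟩⟩⟩
  have h2 : Multiset.card (cycles (1 : Perm PUnit.{1})).classSizes = 1 := by
    rw [Setoid.card_classSizes]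
    exact Nat.card_eq_one_iff_unique.2 ⟨inferInstance, ⟨Quotient.mk _ PUnit.unit⟩⟩
  rw [Setoid.classSizes_eq_cons _ PUnit.unit, Multiset.card_cons] at h2
  rw [h1, Multiset.card_eq_zero.1 (by omega : Multiset.card
    ((cycles (1 : Perm PUnit.{1})).otherClassSizes PUnit.unit) = 0)]
  rfl

theorem classSize_optionCongr_some [Finite D] (π : Perm D) (x : D) :
    (cycles (optionCongr π)).classSize (some x) = (cycles π).classSize x := by
  rw [classSize_eq_of_conj _ (optionEquivSum_conj π), cycles_sumCongr]
  exact Setoid.classSize_sum_inl _ _ _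

theorem classSize_optionCongr_none [Finite D] (π : Perm D) :
    (cycles (optionCongr π)).classSize none = 1 := by
  refine Nat.card_eq_one_iff_unique.2 ⟨⟨?_⟩, ⟨⟨none, Setoid.refl' _ _⟩⟩⟩
  rintro ⟨x, hx⟩ ⟨y, hy⟩
  have hx' := (SameCycle.symm hx).eq_of_fixed (by simp)
  have hy' := (SameCycle.symm hy).eq_of_fixed (by simp)
  simp [← hx', ← hy']

theorem cycles_insertBefore [Finite D] (π : Perm D) (x : D) :
    cycles (insertBefore π x) = (cycles (optionCongr π)).merge none (some (π⁻¹ x)) := by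
  classical
  rw [insertBefore_eq_mul_swap, cycles_mul_swap (not_sameCycle_optionCongr _ _)]

theorem classSize_inv_apply (π : Perm D) (x : D) :
    (cycles π).classSize (π⁻¹ x) = (cycles π).classSize x :=
  Setoid.classSize_congr _ (by
    have := cycles_apply_self π (π⁻¹ x)
    rwa [← mul_apply, mul_inv_cancel, one_apply] at this)

theorem exists_classSizes_insertBefore [Finite D] (π : Perm D) (x : D) :
    ∃ rest, (cycles π).classSizes = (cycles π).classSize x ::ₘ rest ∧
      (cycles (insertBefore π x)).classSizes = ((cycles π).classSize x + 1) ::ₘ rest := by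
  obtain ⟨rest, h1, h2⟩ :=
    Setoid.exists_classSizes_merge (s := cycles (optionCongr π))
      (not_sameCycle_optionCongr π (π⁻¹ x))
  refine ⟨rest, ?_, ?_⟩
  · rw [classSizes_optionCongr, classSize_optionCongr_none, classSize_optionCongr_some,
      classSize_inv_apply, add_comm, Multiset.singleton_add, Multiset.cons_inj_right] at h1
    exact h1
  · rw [cycles_insertBefore, h2, classSize_optionCongr_none, classSize_optionCongr_some,
      classSize_inv_apply, add_comm]

theorem sameCycle_insertBefore_none (π : Perm D) (x : D) :
    SameCycle (insertBefore π x) none (some x) := by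
  have := cycles_apply_self (insertBefore π x) none
  rwa [insertBefore_none] at this

theorem sameCycle_insertBefore_some [Finite D] (π : Perm D) (x a b : D) :
    SameCycle (insertBefore π x) (some a) (some b) ↔ SameCycle π a b := by
  have h1 : ∀ a b, SameCycle (optionCongr π) (some a) (some b) ↔ SameCycle π a b := by
    intro a b
    rw [sameCycle_iff_of_conj _ (optionEquivSum_conj π), ← cycles_apply, cycles_sumCongr]
    exact Setoid.sum_inl_inl _ _ _ _
  rw [← cycles_apply, cycles_insertBefore, Setoid.merge_apply, cycles_apply, cycles_apply,
    cycles_apply, cycles_apply, cycles_apply, h1, h1, h1]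
  have h2 : ∀ a, ¬ SameCycle (optionCongr π) (some a) none :=
    fun a h => not_sameCycle_optionCongr π a h.symm
  constructor
  · rintro (h | ⟨h | h, k | k⟩)
    · exact h
    · exact absurd h (h2 _)
    · exact absurd h (h2 _)
    · exact absurd k (h2 _)
    · exact h.trans k.symm
  · exact Or.inl

theorem classSize_insertBefore_none [Finite D] (π : Perm D) (x : D) :
    (cycles (insertBefore π x)).classSize none = (cycles π).classSize x + 1 := by
  rw [cycles_insertBefore, Setoid.classSize_merge (not_sameCycle_optionCongr _ _),
    classSize_optionCongr_none, classSize_optionCongr_some, classSize_inv_apply, add_comm]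

theorem cyc_insertBefore [Finite D] (π : Perm D) (x : D) : cyc (insertBefore π x) = cyc π := by
  obtain ⟨rest, h1, h2⟩ := exists_classSizes_insertBefore π x
  unfold cyc
  rw [← Setoid.card_classSizes, ← Setoid.card_classSizes, h1, h2]
  simp

theorem cyc_optionCongr [Finite D] (π : Perm D) : cyc (optionCongr π) = cyc π + 1 := by
  unfold cyc
  rw [← Setoid.card_classSizes, ← Setoid.card_classSizes, classSizes_optionCongr]
  simp

/-- One direction retracts `none` onto `x`; the other embeds the old orbits and notes that `none` is
in the cycle of `some x`. -/
theorem orbits_insertBefore_eq_top [Finite D] {σ α : Perm D} {x : D} :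
    orbits (insertBefore σ x) (optionCongr α) = ⊤ ↔ orbits σ α = ⊤ := by
  constructor
  · intro h
    let f : Option D → D := fun o => o.getD x
    have h1 : orbits (insertBefore σ x) (optionCongr α) ≤ (orbits σ α).comap f := by
      have h := orbits_le_iff.1 (le_refl (orbits σ α))
      refine orbits_le_iff.2 ⟨?_, ?_⟩
      · rintro (_ | d)
        · rw [insertBefore_none]; exact (orbits σ α).refl' x
        · by_cases hd : σ d = x
          · rw [insertBefore_some_of_eq hd]
            have := h.1 d
            rwa [hd] at this
          · rw [insertBefore_some_of_ne hd]
            exact h.1 d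
      · rintro (_ | d)
        · exact (orbits σ α).refl' x
        · exact h.2 d
    rw [h] at h1
    exact Setoid.eq_top_iff.2 fun a b => h1 (x := some a) (y := some b) trivial
  · intro h
    have h1 : orbits σ α ≤ (orbits (insertBefore σ x) (optionCongr α)).comap some := by
      refine sup_le (fun a b hab => ?_) (cycles_le_iff.2 fun a => ?_)
      · exact (le_sup_left : cycles (insertBefore σ x) ≤ _)
          ((sameCycle_insertBefore_some σ x a b).2 hab)
      · exact (orbits_le_iff.1 (le_refl (orbits (insertBefore σ x) (optionCongr α)))).2 (some a)
    rw [h] at h1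
    have h2 : ∀ o, orbits (insertBefore σ x) (optionCongr α) o (some x) := by
      rintro (_ | a)
      · exact (le_sup_left : cycles (insertBefore σ x) ≤ _) (sameCycle_insertBefore_none σ x)
      · exact h1 (x := a) (y := x) trivial
    exact Setoid.eq_top_iff.2 fun a b => Setoid.trans' _ (h2 a) (Setoid.symm' _ (h2 b))

/-- The insertion adds one dart and one cycle of `α`, namely the fixed point `none`, and changes
neither the number of vertices nor that of faces. -/
theorem planar_insertBefore_iff [Finite D] {σ α : Perm D} {x : D} :
    Planar (insertBefore σ x) (optionCongr α) ↔ Planar σ α := by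
  have h1 : Nat.card (Option D) = Nat.card D + 1 := Finite.card_option
  refine ⟨fun h => ⟨orbits_insertBefore_eq_top.1 h.1, ?_⟩,
    fun h => ⟨orbits_insertBefore_eq_top.2 h.1, ?_⟩⟩
  · have := h.2
    rw [insertBefore_mul_optionCongr, cyc_insertBefore, cyc_insertBefore, cyc_optionCongr,
      h1] at this
    omega
  · rw [insertBefore_mul_optionCongr, cyc_insertBefore, cyc_insertBefore, cyc_optionCongr, h1]
    have := h.2
    omega

/-- A point that is fixed by `α` and not by `σ` arises from an insertion. -/
theorem exists_insertBefore [Finite D] (σ α : Perm D) (c : D) (hα : α c = c) (hσ : σ c ≠ c) :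
    ∃ (e : Option {d // d ≠ c} ≃ D) (σ' α' : Perm {d // d ≠ c}) (x : {d // d ≠ c}),
      e none = c ∧ (∀ d, e (insertBefore σ' x d) = σ (e d)) ∧
      ∀ d, e (optionCongr α' d) = α (e d) := by
  classical
  let e := optionSubtypeNe c
  have he : e none = c := optionSubtypeNe_none c
  obtain ⟨σ₁, hσ₁⟩ : ∃ σ₁ : Perm (Option {d // d ≠ c}), ∀ d, e (σ₁ d) = σ (e d) :=
    ⟨e.symm.permCongr σ, fun d => by simp [permCongr_apply]⟩
  obtain ⟨α₁, hα₁⟩ : ∃ α₁ : Perm (Option {d // d ≠ c}), ∀ d, e (α₁ d) = α (e d) :=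
    ⟨e.symm.permCongr α, fun d => by simp [permCongr_apply]⟩
  have h1 : α₁ none = none := e.injective (by rw [hα₁, he, hα])
  obtain ⟨x, hx⟩ : ∃ x, σ₁ none = some x := by
    rw [← Option.ne_none_iff_exists']
    intro h
    have := hσ₁ none
    rw [h, he] at this
    exact hσ this.symm
  -- `removeNone` bypasses `none` in its cycle; the transposition with the image of `none` restores
  -- the detour.
  refine ⟨e, removeNone σ₁, removeNone α₁, x, he, fun d => ?_, fun d => ?_⟩
  · rw [← hσ₁, insertBefore_def, map_equiv_removeNone, hx, ← mul_assoc, swap_mul_self, one_mul]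
  · rw [← hα₁, map_equiv_removeNone, h1, swap_self]
    rfl

end insert

theorem classSize_eq_minimalPeriod (π : Perm D) (a : D) [Finite D] :
    (cycles π).classSize a = Function.minimalPeriod π a := by
  classical
  let _ := Fintype.ofFinite D
  have := MulAction.minimalPeriod_eq_card (a := π) (b := a)
  rw [show (fun x : D => π • x) = π from rfl] at this
  rw [this, ← Nat.card_eq_fintype_card, Setoid.classSize]
  refine Nat.card_congr (Equiv.subtypeEquivRight fun d => ?_)
  rw [cycles_apply, MulAction.mem_orbit_iff]
  constructor
  · rintro h
    obtain ⟨k, hk⟩ := h.symm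
    exact ⟨⟨π ^ k, k, rfl⟩, hk⟩
  · rintro ⟨⟨_, k, rfl⟩, hk⟩
    exact SameCycle.symm ⟨k, hk⟩

end Equiv.Perm

namespace Equiv.Perm

variable {D E : Type*}

/-- All cycles have size two. This translates between Euler's relation in terms of darts, as in
`Planar`, and in terms of edges, as in `DartMap`. -/
theorem two_mul_cyc_of_involution [Finite D] {α : Perm D} (h : ∀ d, α (α d) = d)
    (hne : ∀ d, α d ≠ d) : Nat.card D = 2 * cyc α := by
  classical
  let _ := Fintype.ofFinite (Quotient (cycles α))
  have h1 : ∀ q : Quotient (cycles α), Nat.card {d // Quotient.mk (cycles α) d = q} = 2 := by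
    intro q
    induction q using Quotient.inductionOn with | _ a => ?_
    rw [Setoid.natCard_mk_eq, classSize_eq_minimalPeriod]
    refine (Nat.le_antisymm ?_ ?_)
    · exact Function.IsPeriodicPt.minimalPeriod_le (by norm_num) (h a)
    · have h0 : 0 < Function.minimalPeriod α a := by
        rw [← classSize_eq_minimalPeriod]; exact Setoid.classSize_pos _ _
      have h1 : Function.minimalPeriod α a ≠ 1 := fun k =>
        hne a (Function.minimalPeriod_eq_one_iff_isFixedPt.1 k)
      omega
  rw [← Nat.card_congr (Equiv.sigmaFiberEquiv fun d => Quotient.mk (cycles α) d), Nat.card_sigma]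
  simp only [h1]
  simp [cyc, Nat.card_eq_fintype_card, mul_comm]

theorem isPretransitive_closure_iff {σ α : Perm D} :
    MulAction.IsPretransitive (Subgroup.closure {σ, α}) D ↔ orbits σ α = ⊤ := by
  constructor
  · intro h
    have hs := orbits_le_iff.1 (le_refl (orbits σ α))
    have key : ∀ g ∈ Subgroup.closure {σ, α}, ∀ x, orbits σ α x (g x) := by
      intro g hg
      induction hg using Subgroup.closure_induction with
      | mem g hg =>
        rcases hg with rfl | rfl
        · exact hs.1
        · exact hs.2
      | one => exact fun x => Setoid.refl' _ x
      | mul g g' _ _ ih ih' => exact fun x => Setoid.trans' _ (ih' x) (ih _)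
      | inv g _ ih =>
        intro x
        have := ih (g⁻¹ x)
        rw [← mul_apply, mul_inv_cancel, one_apply] at this
        exact Setoid.symm' _ this
    refine Setoid.eq_top_iff.2 fun x y => ?_
    obtain ⟨g, rfl⟩ := h.exists_smul_eq x y
    exact key g.1 g.2 x
  · intro h
    have h1 : orbits σ α ≤ MulAction.orbitRel (Subgroup.closure {σ, α}) D := by
      refine orbits_le_iff.2 ⟨fun x => Setoid.symm' _ ?_, fun x => Setoid.symm' _ ?_⟩
      · exact ⟨⟨σ, Subgroup.subset_closure (by simp)⟩, rfl⟩
      · exact ⟨⟨α, Subgroup.subset_closure (by simp)⟩, rfl⟩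
    rw [h] at h1
    refine ⟨fun x y => ?_⟩
    exact h1 (x := y) (y := x) trivial

/-! ### Cutting and gluing edges; splitting a face cycle. -/

section cutglue

variable [DecidableEq D]

/-- Cutting an edge of an involution into two fixed points. -/
theorem mul_swap_apply_involution {α : Perm D} (h : ∀ d, α (α d) = d) (hne : ∀ d, α d ≠ d) (r : D) :
    (∀ d, (α * swap r (α r)) ((α * swap r (α r)) d) = d) ∧
      ∀ d, (α * swap r (α r)) d = d ↔ d = r ∨ d = α r := by
  have h1 : ∀ d, d = r ∨ d = α r → (α * swap r (α r)) d = d := by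
    rintro d (rfl | rfl) <;> simp [h]
  have h2 : ∀ d, ¬ (d = r ∨ d = α r) → (α * swap r (α r)) d = α d := by
    intro d hd
    push Not at hd
    rw [mul_apply, swap_apply_of_ne_of_ne hd.1 hd.2]
  refine ⟨fun d => ?_, fun d => ⟨fun hd => ?_, h1 d⟩⟩
  · by_cases hd : d = r ∨ d = α r
    · rw [h1 d hd, h1 d hd]
    · rw [h2 d hd, h2, h]
      rintro (k | k)
      · exact hd (Or.inr (by rw [← k, h]))
      · exact hd (Or.inl (α.injective k))
  · by_contra k
    rw [h2 d k] at hd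
    exact hne d hd

/-- Gluing two fixed points of an involution to an edge. -/
theorem mul_swap_apply_of_fixed {β : Perm D} {r r' : D} (h : ∀ d, β (β d) = d)
    (hfix : ∀ d, β d = d ↔ d = r ∨ d = r') (hrr : r ≠ r') :
    (β * swap r r') r = r' ∧ (∀ d, (β * swap r r') ((β * swap r r') d) = d) ∧
      ∀ d, (β * swap r r') d ≠ d := by
  have hr : β r = r := (hfix r).2 (Or.inl rfl)
  have hr' : β r' = r' := (hfix r').2 (Or.inr rfl)
  have h1 : (β * swap r r') r = r' := by simp [hr']
  have h1' : (β * swap r r') r' = r := by simp [hr]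
  have h2 : ∀ d, d ≠ r → d ≠ r' → (β * swap r r') d = β d := by
    intro d hd hd'
    rw [mul_apply, swap_apply_of_ne_of_ne hd hd']
  refine ⟨h1, fun d => ?_, fun d => ?_⟩
  · by_cases hd : d = r
    · rw [hd, h1, h1']
    by_cases hd' : d = r'
    · rw [hd', h1', h1]
    rw [h2 d hd hd', h2, h]
    · intro k; exact hd (β.injective (k.trans hr.symm))
    · intro k; exact hd' (β.injective (k.trans hr'.symm))
  · by_cases hd : d = r
    · rw [hd, h1]; exact hrr.symm
    by_cases hd' : d = r'
    · rw [hd', h1']; exact hrr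
    rw [h2 d hd hd']
    intro k
    exact ((hfix d).1 k).elim hd hd'

end cutglue

section split

variable (π : Perm D) (a : D) (k : ℕ)

open Classical in
/-- Insert a point at distance `k + 1` from `a` in the cycle of `a`, and cut the cycle at these
two points. -/
noncomputable def insertCut : Perm (Option D) :=
  insertBefore π ((π ^ (k + 1)) a) * swap (some a) none

variable {π a k} [Finite D]

theorem pow_apply_ne_of_lt_classSize (hk : k < (cycles π).classSize a) {i j : ℕ} (hi : i < j)
    (hj : j ≤ k) :
    (π ^ i) a ≠ (π ^ j) a := by
  rw [classSize_eq_minimalPeriod] at hk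
  intro h
  have h1 : ∀ n, (π ^ n) a = π^[n] a := fun n => by rw [iterate_eq_pow]
  rw [h1, h1] at h
  have h2 := Function.iterate_injOn_Iio_minimalPeriod (f := π) (x := a)
    (show i ∈ Set.Iio _ from lt_of_lt_of_le hi (hj.trans hk.le))
    (show j ∈ Set.Iio _ from lt_of_le_of_lt hj hk) h
  omega

/-- The cut redirects `none` to the successor of `a`. From there the old cycle is followed up to `(π
^ k) a`, whose successor is `none`. So the piece of `none` has `k + 1` elements and misses `a`,
since `k` is less than the length of the cycle. -/
theorem pow_insertCut_none (hk : k < (cycles π).classSize a) {i : ℕ} (hi : i < k) :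
    (insertCut π a k ^ (i + 1)) none = some ((π ^ (i + 1)) a) := by
  classical
  induction i with
  | zero =>
    rw [zero_add, pow_one, pow_one, insertCut, mul_apply, swap_apply_right,
      insertBefore_some_of_ne]
    intro h
    have h' : (π ^ 0) a = (π ^ k) a := π.injective (by
      rw [pow_zero, one_apply, h, pow_succ', mul_apply])
    exact pow_apply_ne_of_lt_classSize hk hi le_rfl h'
  | succ i ih =>
    rw [pow_succ', mul_apply, ih (by omega), insertCut, mul_apply,
      swap_apply_of_ne_of_ne _ (by simp), insertBefore_some_of_ne, pow_succ' π (i + 1), mul_apply]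
    · intro h
      have h' : (π ^ (i + 1)) a = (π ^ k) a := π.injective (by
        rw [h, pow_succ' π k, mul_apply])
      exact pow_apply_ne_of_lt_classSize hk hi le_rfl h'
    · intro h
      have := pow_apply_ne_of_lt_classSize hk (i := 0) (j := i + 1) (by omega) (by omega)
      rw [pow_zero, one_apply] at this
      exact this (Option.some.inj h).symm

theorem pow_insertCut_none_self (hk : k < (cycles π).classSize a) :
    (insertCut π a k ^ (k + 1)) none = none := by
  classical
  rcases k with _ | k
  · rw [zero_add, pow_one, insertCut, mul_apply, swap_apply_right, insertBefore_some_of_eq]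
    simp
  · rw [pow_succ', mul_apply, pow_insertCut_none hk (by omega), insertCut, mul_apply,
      swap_apply_of_ne_of_ne _ (by simp), insertBefore_some_of_eq]
    · rw [pow_succ' π (k + 1), mul_apply]
    · intro h
      have := pow_apply_ne_of_lt_classSize hk (i := 0) (j := k + 1) (by omega) (by omega)
      rw [pow_zero, one_apply] at this
      exact this (Option.some.inj h).symm

theorem classSize_insertCut_none (hk : k < (cycles π).classSize a) :
    (cycles (insertCut π a k)).classSize none = k + 1 := by
  classical
  rw [classSize_eq_minimalPeriod]
  have h1 : Function.IsPeriodicPt (insertCut π a k) (k + 1) none := by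
    rw [Function.IsPeriodicPt, Function.IsFixedPt, iterate_eq_pow]
    exact pow_insertCut_none_self hk
  refine le_antisymm (h1.minimalPeriod_le (by omega)) ?_
  by_contra h
  have hpos := h1.minimalPeriod_pos (by omega)
  obtain ⟨i, hi⟩ : ∃ i, Function.minimalPeriod (insertCut π a k) none = i + 1 :=
    ⟨_, (Nat.sub_add_cancel hpos).symm⟩
  have h2 := Function.iterate_minimalPeriod (f := insertCut π a k) (x := none)
  rw [hi, iterate_eq_pow, pow_insertCut_none hk (by omega)] at h2
  simp at h2

theorem not_sameCycle_insertCut (hk : k < (cycles π).classSize a) :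
    ¬ SameCycle (insertCut π a k) (some a) none := by
  classical
  intro h
  obtain ⟨n, -, hn⟩ := h.symm.exists_pow_eq'
  have hper : Function.IsPeriodicPt (insertCut π a k) (k + 1) none := by
    rw [Function.IsPeriodicPt, Function.IsFixedPt, iterate_eq_pow]
    exact pow_insertCut_none_self hk
  rw [← iterate_eq_pow, ← hper.iterate_mod_apply, iterate_eq_pow] at hn
  have hlt : n % (k + 1) < k + 1 := Nat.mod_lt _ (by omega)
  generalize n % (k + 1) = i at hn hlt
  rcases i with _ | i
  · simp at hn
  · rw [pow_insertCut_none hk (by omega)] at hn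
    have := pow_apply_ne_of_lt_classSize hk (i := 0) (j := i + 1) (by omega) (by omega)
    rw [pow_zero, one_apply] at this
    exact this (Option.some.inj hn).symm

end split

end Equiv.Perm

namespace DartMap

variable {D E : Type*}

/-- The permutation whose cycles are the faces. -/
abbrev φ (M : DartMap D) : Perm D := M.σ * M.α

theorem card_eq [Finite D] (M : DartMap D) : Nat.card D = 2 * cyc M.α :=
  two_mul_cyc_of_involution M.α_invol M.α_ne

theorem planar [Finite D] (M : DartMap D) : Planar M.σ M.α := by
  refine ⟨isPretransitive_closure_iff.1 M.connected, ?_⟩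
  have h1 := M.card_eq
  have h2 : cyc M.σ + cyc (M.σ * M.α) = cyc M.α + 2 := M.euler
  omega

/-- A map from two permutations that generate a transitive group of genus zero. -/
def ofPlanar [Finite D] (σ α : Perm D) (root : D) (h : ∀ d, α (α d) = d) (hne : ∀ d, α d ≠ d)
    (hP : Planar σ α) : DartMap D where
  σ := σ
  α := α
  root := root
  α_invol := h
  α_ne := hne
  connected := isPretransitive_closure_iff.2 hP.orbits_eq
  euler := by
    have h1 := two_mul_cyc_of_involution h hne
    have h2 := hP.euler
    change cyc σ + cyc (σ * α) = cyc α + 2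
    omega

theorem Iso.φ_conj {M : DartMap D} {N : DartMap E} {e : D ≃ E} (h1 : ∀ d, e (M.σ d) = N.σ (e d))
    (h2 : ∀ d, e (M.α d) = N.α (e d)) (d : D) : e (M.φ d) = N.φ (e d) := by
  rw [mul_apply, mul_apply, h1, h2]

end DartMap

/-! ### Stubs and the two ways to complete them to maps. -/

/-- A planar map in which one dart, the tip, is not paired with another one: it marks the root
corner. -/
structure Stub (D : Type*) where
  σ : Perm D
  α : Perm D
  tip : D
  α_invol : ∀ d, α (α d) = d
  α_eq_iff : ∀ d, α d = d ↔ d = tip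
  planar : Planar σ α

namespace Stub

variable {D E : Type*} {D' E' : Type*}

/-- The permutation whose cycles are the faces. -/
abbrev φ (X : Stub D) : Perm D := X.σ * X.α

/-- Isomorphism of stubs. -/
def Iso (X : Stub D) (Y : Stub E) : Prop :=
  ∃ e : D ≃ E, (∀ d, e (X.σ d) = Y.σ (e d)) ∧ (∀ d, e (X.α d) = Y.α (e d)) ∧ e X.tip = Y.tip

theorem Iso.symm {X : Stub D} {Y : Stub E} : X.Iso Y → Y.Iso X := by
  rintro ⟨e, h1, h2, h3⟩
  refine ⟨e.symm, fun d => ?_, fun d => ?_, ?_⟩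
  · rw [Equiv.symm_apply_eq, h1, Equiv.apply_symm_apply]
  · rw [Equiv.symm_apply_eq, h2, Equiv.apply_symm_apply]
  · rw [Equiv.symm_apply_eq, h3]

theorem Iso.trans {F : Type*} {M : Stub D} {N : Stub E} {P : Stub F} :
    M.Iso N → N.Iso P → M.Iso P := by
  rintro ⟨e, h1, h2, h3⟩ ⟨f, k1, k2, k3⟩
  exact ⟨e.trans f, by simp [h1, k1], by simp [h2, k2], by simp [h3, k3]⟩

theorem α_tip (X : Stub D) : X.α X.tip = X.tip := (X.α_eq_iff _).2 rfl

/-- The degree of the root face, the tip included. -/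
noncomputable def tipSize (X : Stub D) : ℕ := (cycles X.φ).classSize X.tip

/-- The degrees of the other faces. -/
noncomputable def innerSizes [Finite D] (X : Stub D) : Multiset ℕ :=
  (cycles X.φ).otherClassSizes X.tip

theorem classSizes_eq [Finite D] (X : Stub D) :
    (cycles X.φ).classSizes = X.tipSize ::ₘ X.innerSizes :=
  Setoid.classSizes_eq_cons _ _

theorem Iso.sizes [Finite D] [Finite E] {X : Stub D} {Y : Stub E} (h : X.Iso Y) :
    X.tipSize = Y.tipSize ∧ X.innerSizes = Y.innerSizes ∧ Nat.card D = Nat.card E := by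
  obtain ⟨e, h1, h2, h3⟩ := h
  have hφ : ∀ d, e (X.φ d) = Y.φ (e d) := fun d => by rw [mul_apply, mul_apply, h1, h2]
  have h4 : X.tipSize = Y.tipSize := by
    rw [tipSize, classSize_eq_of_conj e hφ, h3, tipSize]
  refine ⟨h4, ?_, Nat.card_congr e⟩
  have := classSizes_eq_of_conj e hφ
  rw [X.classSizes_eq, Y.classSizes_eq, h4, Multiset.cons_inj_right] at this
  exact this

/-- The stub of the map reduced to a vertex. -/
def unit : Stub Unit where
  σ := 1
  α := 1
  tip := ()
  α_invol _ := rfl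
  α_eq_iff _ := by simp
  planar := by
    have h : ∀ s : Setoid Unit, Nat.card (Quotient s) = 1 := fun s =>
      Nat.card_eq_one_iff_unique.2 ⟨inferInstance, ⟨Quotient.mk _ ()⟩⟩
    refine ⟨Setoid.eq_top_iff.2 fun x y => ?_, ?_⟩
    · exact Setoid.refl' _ _
    · rw [cyc, cyc, h, h]; simp

/-- Mark the root corner of a map by a tip. -/
noncomputable def ofDartMap [Finite D] (M : DartMap D) : Stub (Option D) where
  σ := insertBefore M.σ M.root
  α := optionCongr M.α
  tip := none
  α_invol := by rintro (_ | d) <;> simp [M.α_invol]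
  α_eq_iff := by rintro (_ | d) <;> simp [M.α_ne]
  planar := planar_insertBefore_iff.2 M.planar

section bridge

theorem orbits_sum (X : Stub D) (Y : Stub E) :
    orbits (Perm.sumCongr X.σ Y.σ) (Perm.sumCongr X.α Y.α) = (⊤ : Setoid D).sum ⊤ := by
  rw [orbits_sumCongr, X.planar.orbits_eq, Y.planar.orbits_eq]

theorem not_orbits_sum (X : Stub D) (Y : Stub E) : ¬ orbits (Perm.sumCongr X.σ Y.σ)
    (Perm.sumCongr X.α Y.α) (Sum.inl X.tip) (Sum.inr Y.tip) := by
  rw [orbits_sum]; simp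

theorem not_sameCycle_sum (X : Stub D) (Y : Stub E) :
    ¬ SameCycle (Perm.sumCongr X.φ Y.φ) (Sum.inl X.tip) (Sum.inr Y.tip) := fun h =>
  not_orbits_sum X Y (cycles_mul_le_orbits _ _ (by rw [sumCongr_mul]; exact h))

theorem bridge_involution [DecidableEq (D ⊕ E)] (X : Stub D) (Y : Stub E) :
    (Perm.sumCongr X.α Y.α * swap (Sum.inl X.tip) (Sum.inr Y.tip)) (Sum.inl X.tip) =
      Sum.inr Y.tip ∧
    (∀ d, (Perm.sumCongr X.α Y.α * swap (Sum.inl X.tip) (Sum.inr Y.tip))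
      ((Perm.sumCongr X.α Y.α * swap (Sum.inl X.tip) (Sum.inr Y.tip)) d) = d) ∧
    ∀ d, (Perm.sumCongr X.α Y.α * swap (Sum.inl X.tip) (Sum.inr Y.tip)) d ≠ d :=
  mul_swap_apply_of_fixed (β := Perm.sumCongr X.α Y.α) (r := Sum.inl X.tip)
    (r' := Sum.inr Y.tip) (by rintro (d | d) <;> simp [X.α_invol, Y.α_invol])
    (by rintro (d | d) <;> simp [X.α_eq_iff, Y.α_eq_iff]) (by simp)

variable [Finite D] [Finite E]

/-- The two Euler relations add up to a right side with + 4. The transposition joins the components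
and costs one cycle of `α` and one face, which brings it back to + 2. -/
theorem planar_bridge [DecidableEq (D ⊕ E)] (X : Stub D) (Y : Stub E) : Planar (Perm.sumCongr X.σ Y.σ)
    (Perm.sumCongr X.α Y.α * swap (Sum.inl X.tip) (Sum.inr Y.tip)) := by
  have ho := orbits_sum X Y
  have hn := not_orbits_sum X Y
  have h1 := merge_orbits_mul_swap (Perm.sumCongr X.σ Y.σ) (Perm.sumCongr X.α Y.α)
    (Sum.inl X.tip) (Sum.inr Y.tip)
  constructor
  · rw [Setoid.merge_eq_self, ho] at h1
    · rw [h1]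
      refine Setoid.eq_top_iff.2 ?_
      rintro (x | x) (y | y)
      · exact Or.inl ((Setoid.sum_inl_inl _ _ _ _).2 trivial)
      · exact Or.inr ⟨Or.inl ((Setoid.sum_inl_inl _ _ _ _).2 trivial),
          Or.inr ((Setoid.sum_inr_inr _ _ _ _).2 trivial)⟩
      · exact Or.inr ⟨Or.inr ((Setoid.sum_inr_inr _ _ _ _).2 trivial),
          Or.inl ((Setoid.sum_inl_inl _ _ _ _).2 trivial)⟩
      · exact Or.inl ((Setoid.sum_inr_inr _ _ _ _).2 trivial)
    · have := (orbits_le_iff.1 (le_refl (orbits (Perm.sumCongr X.σ Y.σ)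
        (Perm.sumCongr X.α Y.α * swap (Sum.inl X.tip) (Sum.inr Y.tip))))).2 (Sum.inl X.tip)
      rwa [(bridge_involution X Y).1] at this
  · have h2 := cyc_mul_swap (π := Perm.sumCongr X.α Y.α) (a := Sum.inl X.tip)
      (b := Sum.inr Y.tip) fun h => hn ((le_sup_right : cycles (Perm.sumCongr X.α Y.α) ≤ _) h)
    have h3 := cyc_mul_swap (not_sameCycle_sum X Y)
    rw [cyc_sumCongr] at h2 h3
    rw [← mul_assoc, sumCongr_mul, cyc_sumCongr, Nat.card_sum]
    have h4 : _ + _ + cyc X.φ = _ := X.planar.euler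
    have h5 : _ + _ + cyc Y.φ = _ := Y.planar.euler
    change cyc (Perm.sumCongr X.φ Y.φ * _) + 1 = _ at h3
    change _ + cyc (Perm.sumCongr X.φ Y.φ * _) = _
    omega

open Classical in
/-- Join the tips of two stubs to an edge. -/
noncomputable def bridge (X : Stub D) (Y : Stub E) : DartMap (D ⊕ E) :=
  DartMap.ofPlanar (Perm.sumCongr X.σ Y.σ)
    (Perm.sumCongr X.α Y.α * swap (Sum.inl X.tip) (Sum.inr Y.tip)) (Sum.inl X.tip)
    (bridge_involution X Y).2.1 (bridge_involution X Y).2.2 (planar_bridge X Y)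

end bridge

section addEdge

variable (X : Stub D) {k : ℕ} (hk : k < X.tipSize)

theorem addEdge_involution [DecidableEq (Option D)] :
    (optionCongr X.α * swap (some X.tip) none) (some X.tip) = none ∧
    (∀ d, (optionCongr X.α * swap (some X.tip) none)
      ((optionCongr X.α * swap (some X.tip) none) d) = d) ∧
    ∀ d, (optionCongr X.α * swap (some X.tip) none) d ≠ d :=
  mul_swap_apply_of_fixed (β := optionCongr X.α) (r := some X.tip)
    (r' := none) (by rintro (_ | d) <;> simp [X.α_invol])
    (by rintro (_ | d) <;> simp [X.α_eq_iff]) (by simp)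

theorem insertBefore_mul_addEdge [DecidableEq (Option D)] (k : ℕ) :
    insertBefore X.σ ((X.φ ^ (k + 1)) X.tip) * (optionCongr X.α * swap (some X.tip) none) =
      insertCut X.φ X.tip k := by
  rw [← mul_assoc, insertBefore_mul_optionCongr, insertCut]
  congr!

variable [Finite D]

/-- After the insertion of the second half-edge, gluing it to the tip loses one cycle of `α` and
splits one face in two; the sum in Euler's relation is unchanged. -/
theorem planar_addEdge (hk : k < X.tipSize) [DecidableEq (Option D)] :
    Planar (insertBefore X.σ ((X.φ ^ (k + 1)) X.tip))
      (optionCongr X.α * swap (some X.tip) none) := by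
  set x := (X.φ ^ (k + 1)) X.tip with hx
  have hP : Planar (insertBefore X.σ x) (optionCongr X.α) := planar_insertBefore_iff.2 X.planar
  have h1 := merge_orbits_mul_swap (insertBefore X.σ x) (optionCongr X.α) (some X.tip) none
  constructor
  · rw [Setoid.merge_eq_self, hP.orbits_eq] at h1
    · rw [h1]
      exact top_le_iff.1 (Setoid.le_merge _ _ _)
    · have := (orbits_le_iff.1 (le_refl (orbits (insertBefore X.σ x)
        (optionCongr X.α * swap (some X.tip) none)))).2 (some X.tip)
      rwa [(addEdge_involution X).1] at this
  · have h2 := cyc_mul_swap (π := optionCongr X.α) (a := some X.tip) (b := none)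
      fun h => not_sameCycle_optionCongr _ _ h.symm
    have h3 := cyc_mul_swap (not_sameCycle_insertCut hk)
    have h4 : insertCut X.φ X.tip k * swap (some X.tip) none =
        insertBefore X.σ x * optionCongr X.α := by
      rw [← insertBefore_mul_addEdge, mul_assoc, mul_assoc, swap_mul_self, mul_one]
    rw [h4] at h3
    rw [insertBefore_mul_addEdge]
    have := hP.euler
    omega

open Classical in
/-- Join the tip of a stub by an edge to the corner at distance `k + 1` in the root face. -/
noncomputable def addEdge : DartMap (Option D) :=
  DartMap.ofPlanar (insertBefore X.σ ((X.φ ^ (k + 1)) X.tip))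
    (optionCongr X.α * swap (some X.tip) none) (some X.tip)
    (addEdge_involution X).2.1 (addEdge_involution X).2.2 (X.planar_addEdge hk)

theorem addEdge_φ : (X.addEdge hk).φ = insertCut X.φ X.tip k := by
  classical
  exact insertBefore_mul_addEdge X k

theorem addEdge_α_root : (X.addEdge hk).α (X.addEdge hk).root = none := by
  classical
  exact (addEdge_involution X).1

end addEdge

section bridge

variable [Finite D] [Finite E] (X : Stub D) (Y : Stub E)

theorem bridge_φ [DecidableEq (D ⊕ E)] : (X.bridge Y).φ =
    Perm.sumCongr X.φ Y.φ * swap (Sum.inl X.tip) (Sum.inr Y.tip) := by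
  rw [← sumCongr_mul, mul_assoc]
  change _ * (_ * _) = _
  congr!

theorem bridge_α_root : (X.bridge Y).α (X.bridge Y).root = Sum.inr Y.tip := by
  classical
  exact (bridge_involution X Y).1

theorem cycles_bridge_φ : cycles (X.bridge Y).φ =
    ((cycles X.φ).sum (cycles Y.φ)).merge (Sum.inl X.tip) (Sum.inr Y.tip) := by
  classical
  rw [bridge_φ, cycles_mul_swap (not_sameCycle_sum X Y), cycles_sumCongr]

theorem bridge_sizes :
    (cycles (X.bridge Y).φ).classSize (X.bridge Y).root = X.tipSize + Y.tipSize ∧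
    (cycles (X.bridge Y).φ).otherClassSizes (X.bridge Y).root = X.innerSizes + Y.innerSizes := by
  have hn : ¬ ((cycles X.φ).sum (cycles Y.φ)) (Sum.inl X.tip) (Sum.inr Y.tip) := by simp
  obtain ⟨rest, h1, h2⟩ := Setoid.exists_classSizes_merge hn
  have h3 := Setoid.classSize_merge hn
  rw [Setoid.classSize_sum_inl, Setoid.classSize_sum_inr] at h1 h2 h3
  have h4 : (cycles (X.bridge Y).φ).classSize (X.bridge Y).root = X.tipSize + Y.tipSize := by
    rw [cycles_bridge_φ]; exact h3
  refine ⟨h4, ?_⟩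
  have h5 := Setoid.classSizes_eq_cons (cycles (X.bridge Y).φ) (X.bridge Y).root
  rw [h4, cycles_bridge_φ, h2, ← tipSize, ← tipSize, Multiset.cons_inj_right] at h5
  rw [cycles_bridge_φ, ← h5]
  rw [Setoid.classSizes_sum, X.classSizes_eq, Y.classSizes_eq, ← tipSize, ← tipSize,
    Multiset.cons_add, Multiset.add_cons, Multiset.cons_inj_right, Multiset.cons_inj_right] at h1
  exact h1.symm

theorem sameCycle_bridge_root : SameCycle (X.bridge Y).φ (X.bridge Y).root
    ((X.bridge Y).α (X.bridge Y).root) := by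
  rw [← cycles_apply, cycles_bridge_φ, bridge_α_root]
  exact Setoid.merge_left_right _ _ _

end bridge

section addEdge

variable [Finite D] (X : Stub D) {k : ℕ} (hk : k < X.tipSize)

theorem not_sameCycle_addEdge_root : ¬ SameCycle (X.addEdge hk).φ (X.addEdge hk).root
    ((X.addEdge hk).α (X.addEdge hk).root) := by
  rw [addEdge_φ, addEdge_α_root]
  exact not_sameCycle_insertCut hk

theorem classSize_addEdge_α_root :
    (cycles (X.addEdge hk).φ).classSize ((X.addEdge hk).α (X.addEdge hk).root) = k + 1 := by
  rw [addEdge_φ, addEdge_α_root]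
  exact classSize_insertCut_none hk

/-- Merging the two faces along the new edge gives the old root face with one inserted dart, of size
`tipSize + 1`. The piece of `none` takes `k + 1` of these, and the root keeps the rest. -/
theorem addEdge_sizes :
    (cycles (X.addEdge hk).φ).classSize (X.addEdge hk).root + k = X.tipSize ∧
    (cycles (X.addEdge hk).φ).otherClassSizes (X.addEdge hk).root = (k + 1) ::ₘ X.innerSizes := by
  classical
  set x := (X.φ ^ (k + 1)) X.tip with hx
  have hn := not_sameCycle_insertCut hk
  have hm : (cycles (insertCut X.φ X.tip k)).merge (some X.tip) none =
      cycles (insertBefore X.φ x) := by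
    rw [← cycles_mul_swap hn, insertCut, mul_assoc, swap_mul_self, mul_one]
  have hxs : SameCycle X.φ x X.tip := ⟨-(k + 1 : ℕ), by
    rw [hx, zpow_neg, zpow_natCast, ← mul_apply, inv_mul_cancel, one_apply]⟩
  obtain ⟨rest, h1, h2⟩ := Setoid.exists_classSizes_merge
    (s := cycles (insertCut X.φ X.tip k)) (a := some X.tip) (b := none) hn
  have h3 := Setoid.classSize_merge (s := cycles (insertCut X.φ X.tip k)) (a := some X.tip)
    (b := none) hn
  rw [hm, classSize_insertCut_none hk, Setoid.classSize_congr (cycles (insertBefore X.φ x))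
    (b := none), classSize_insertBefore_none, Setoid.classSize_congr (cycles X.φ) hxs] at h3
  swap
  · exact (((sameCycle_insertBefore_some X.φ x _ _).2 hxs).symm.trans
      (sameCycle_insertBefore_none X.φ x).symm)
  rw [← tipSize] at h3
  have h4 : (cycles (X.addEdge hk).φ).classSize (X.addEdge hk).root + k = X.tipSize := by
    rw [addEdge_φ]
    change (cycles (insertCut X.φ X.tip k)).classSize (some X.tip) + k = X.tipSize
    omega
  refine ⟨h4, ?_⟩
  obtain ⟨rest', h5, h6⟩ := exists_classSizes_insertBefore X.φ x
  rw [hm, h6, classSize_insertCut_none hk, Setoid.classSize_congr (cycles X.φ) hxs, ← tipSize,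
    h3, ← add_assoc, Multiset.cons_inj_right] at h2
  rw [X.classSizes_eq, Setoid.classSize_congr (cycles X.φ) hxs, ← tipSize,
    Multiset.cons_inj_right] at h5
  have h7 := Setoid.classSizes_eq_cons (cycles (X.addEdge hk).φ) (X.addEdge hk).root
  rw [addEdge_φ, h1] at h7
  rw [addEdge_φ]
  have h8 := (Multiset.cons_inj_right _).1 h7
  rw [classSize_insertCut_none hk, ← h2, ← h5] at h8
  exact h8.symm

end addEdge

end Stub

/-! ### Conjugations compatible with insertions and disjoint unions. -/

namespace Equiv.Perm

variable {D E D' E' : Type*}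

theorem conj_mul_swap [DecidableEq D] [DecidableEq E] (e : D ≃ E) {π : Perm D} {π' : Perm E}
    (h : ∀ d, e (π d) = π' (e d)) (a b d : D) :
    e ((π * swap a b) d) = (π' * swap (e a) (e b)) (e d) := by
  rw [mul_apply, mul_apply, h, e.injective.map_swap]

/-- The position of the insertion is not lost, because it is the image of `none`. -/
theorem conj_insertBefore_iff (e : D ≃ E) {π : Perm D} {π' : Perm E} {x : D} {x' : E} :
    (∀ o, optionCongr e (insertBefore π x o) = insertBefore π' x' (optionCongr e o)) ↔
      (∀ d, e (π d) = π' (e d)) ∧ e x = x' := by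
  constructor
  · intro h
    have hx : e x = x' := by
      have := h none
      rw [insertBefore_none, optionCongr_apply, optionCongr_apply, Option.map_none,
        insertBefore_none] at this
      exact Option.some.inj this
    refine ⟨fun d => ?_, hx⟩
    have := h (some d)
    simp only [optionCongr_apply, Option.map_some] at this
    by_cases hd : π d = x <;> by_cases hd' : π' (e d) = x'
    · rw [hd, hx, hd']
    · rw [insertBefore_some_of_eq hd, insertBefore_some_of_ne hd'] at this
      simp at this
    · rw [insertBefore_some_of_ne hd, insertBefore_some_of_eq hd'] at this
      simp at this
    · rw [insertBefore_some_of_ne hd, insertBefore_some_of_ne hd'] at this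
      simpa using this
  · rintro ⟨h, rfl⟩ (_ | d)
    · simp [insertBefore_none]
    · by_cases hd : π d = x
      · rw [insertBefore_some_of_eq hd, optionCongr_apply, optionCongr_apply, Option.map_some,
          insertBefore_some_of_eq (by rw [← h, hd])]
        rfl
      · rw [insertBefore_some_of_ne hd, optionCongr_apply, optionCongr_apply, Option.map_some,
          Option.map_some, insertBefore_some_of_ne, h]
        rw [← h]
        exact fun k => hd (e.injective k)

theorem conj_optionCongr_iff (e : D ≃ E) {π : Perm D} {π' : Perm E} :
    (∀ o, optionCongr e (optionCongr π o) = optionCongr π' (optionCongr e o)) ↔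
      ∀ d, e (π d) = π' (e d) := by
  constructor
  · intro h d
    simpa using h (some d)
  · rintro h (_ | d) <;> simp [h]

theorem exists_optionCongr_eq {e : Option D ≃ Option E} (h : e none = none) :
    ∃ e' : D ≃ E, e = optionCongr e' := by
  refine ⟨removeNone e, Equiv.ext ?_⟩
  rintro (_ | d)
  · simp [h]
  · rw [optionCongr_apply, Option.map_some]
    have : e (some d) ≠ none := fun k => by simpa using e.injective (k.trans h.symm)
    exact (removeNone_some e (Option.ne_none_iff_exists'.1 this)).symm

theorem exists_sumCongr_eq {e : D ⊕ E ≃ D' ⊕ E'} (h1 : ∀ a, ∃ a', e (.inl a) = .inl a')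
    (h2 : ∀ b, ∃ b', e (.inr b) = .inr b') :
    ∃ (e₁ : D ≃ D') (e₂ : E ≃ E'), e = Equiv.sumCongr e₁ e₂ := by
  choose f hf using h1
  choose g hg using h2
  have hfb : Function.Bijective f := by
    refine ⟨fun a b hab => ?_, fun a' => ?_⟩
    · have : e (.inl a) = e (.inl b) := by rw [hf, hf, hab]
      exact Sum.inl_injective (e.injective this)
    · obtain ⟨x | x, hx⟩ := e.surjective (.inl a')
      · exact ⟨x, Sum.inl_injective ((hf x).symm.trans hx)⟩
      · rw [hg] at hx; simp at hx
  have hgb : Function.Bijective g := by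
    refine ⟨fun a b hab => ?_, fun a' => ?_⟩
    · have : e (.inr a) = e (.inr b) := by rw [hg, hg, hab]
      exact Sum.inr_injective (e.injective this)
    · obtain ⟨x | x, hx⟩ := e.surjective (.inr a')
      · rw [hf] at hx; simp at hx
      · exact ⟨x, Sum.inr_injective ((hg x).symm.trans hx)⟩
  refine ⟨Equiv.ofBijective f hfb, Equiv.ofBijective g hgb, Equiv.ext ?_⟩
  rintro (x | x)
  · simp [hf]
  · simp [hg]

/-- Two permutations that preserve a predicate are disjoint unions. -/
theorem exists_sumCongr_of_invariant (p : D → Prop) (σ : Perm D)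
    (hσ : ∀ d, p (σ d) ↔ p d) (e : {d // p d} ⊕ {d // ¬ p d} ≃ D) (he : ∀ a, e (.inl a) = a)
    (he' : ∀ a, e (.inr a) = a) : ∃ (σ₁ : Perm {d // p d}) (σ₂ : Perm {d // ¬ p d}),
      ∀ d, e (Perm.sumCongr σ₁ σ₂ d) = σ (e d) := by
  refine ⟨σ.subtypePerm hσ, σ.subtypePerm (fun d => not_congr (hσ d)), ?_⟩
  rintro (d | d) <;> simp [he, he']

end Equiv.Perm

/-! ### Isomorphism classes of stubs and of their completions. -/

namespace Stub

variable {D E D' E' : Type*} [Finite D] [Finite E] [Finite D'] [Finite E']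

theorem iso_ofDartMap_iff {M : DartMap D} {N : DartMap E} :
    (ofDartMap M).Iso (ofDartMap N) ↔ M.Iso N := by
  constructor
  · rintro ⟨e, h1, h2, h3⟩
    obtain ⟨e, rfl⟩ := exists_optionCongr_eq h3
    have h4 := (conj_insertBefore_iff e).1 h1
    exact ⟨e, h4.1, (conj_optionCongr_iff e).1 h2, h4.2⟩
  · rintro ⟨e, h1, h2, h3⟩
    exact ⟨optionCongr e, (conj_insertBefore_iff e).2 ⟨h1, h3⟩, (conj_optionCongr_iff e).2 h2, rfl⟩

theorem not_iso_unit_ofDartMap (M : DartMap D) : ¬ unit.Iso (ofDartMap M) := by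
  rintro ⟨e, -, -, h⟩
  obtain ⟨x, hx⟩ := e.surjective (some M.root)
  have : e () = none := h
  rw [this] at hx
  simp at hx

/-- If `σ` fixes the tip, the tip is an orbit by itself and, by transitivity, the only dart.
Otherwise the tip is removed and its successor around the vertex becomes the root. -/
theorem exists_iso_unit_or (X : Stub D) :
    unit.Iso X ∨ ∃ M : DartMap {d // d ≠ X.tip}, (ofDartMap M).Iso X := by
  by_cases hσ : X.σ X.tip = X.tip
  · left
    have h1 : ∀ d, d = X.tip := by
      let p : Setoid D :=
        { r := fun x y => x = X.tip ↔ y = X.tip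
          iseqv := ⟨fun _ => Iff.rfl, Iff.symm, Iff.trans⟩ }
      have h2 : orbits X.σ X.α ≤ p := by
        refine orbits_le_iff.2 ⟨fun x => ?_, fun x => ?_⟩
        · change x = X.tip ↔ X.σ x = X.tip
          conv_rhs => rw [← hσ, X.σ.apply_eq_iff_eq]
        · change x = X.tip ↔ X.α x = X.tip
          conv_rhs => rw [← X.α_tip, X.α.apply_eq_iff_eq]
      rw [X.planar.orbits_eq] at h2
      intro d
      exact (h2 (x := d) (y := X.tip) trivial).2 rfl
    refine ⟨⟨fun _ => X.tip, fun _ => (), fun _ => rfl, fun d => (h1 d).symm⟩, fun d => ?_,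
      fun d => ?_, rfl⟩
    · exact hσ.symm
    · exact X.α_tip.symm
  · right
    obtain ⟨e, σ', α', x, he, h1, h2⟩ := exists_insertBefore X.σ X.α X.tip X.α_tip hσ
    have hfix : ∀ d, optionCongr α' d = d ↔ d = none := by
      intro d
      rw [← e.apply_eq_iff_eq, h2, X.α_eq_iff]
      exact ⟨fun k => e.injective (k.trans he.symm), fun k => by rw [k, he]⟩
    have hinv : ∀ d, optionCongr α' (optionCongr α' d) = d := by
      intro d
      apply e.injective
      rw [h2, h2, X.α_invol]
    refine ⟨DartMap.ofPlanar σ' α' x (fun d => ?_) (fun d h => ?_)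
      (planar_insertBefore_iff (x := x) |>.1 (X.planar.of_conj e.symm (fun d => ?_) fun d => ?_)),
      e, h1, h2, he⟩
    · simpa using hinv (some d)
    · simpa [h] using hfix (some d)
    · rw [Equiv.symm_apply_eq, h1, apply_symm_apply]
    · rw [Equiv.symm_apply_eq, h2, apply_symm_apply]

theorem bridge_α [DecidableEq (D ⊕ E)] (X : Stub D) (Y : Stub E) : (X.bridge Y).α =
    Perm.sumCongr X.α Y.α * swap (Sum.inl X.tip) (Sum.inr Y.tip) := by
  change _ * _ = _ * _
  congr!

theorem addEdge_α [DecidableEq (Option D)] (X : Stub D) {k : ℕ} (hk : k < X.tipSize) :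
    (X.addEdge hk).α = optionCongr X.α * swap (some X.tip) none := by
  change _ * _ = _ * _
  congr!

theorem bridge_cut [DecidableEq (D ⊕ E)] (X : Stub D) (Y : Stub E) :
    (X.bridge Y).α * swap (X.bridge Y).root ((X.bridge Y).α (X.bridge Y).root) =
      Perm.sumCongr X.α Y.α := by
  rw [bridge_α_root]
  have : (X.bridge Y).α * swap (Sum.inl X.tip) (Sum.inr Y.tip) = Perm.sumCongr X.α Y.α := by
    rw [bridge_α, mul_assoc, swap_mul_self, mul_one]
  exact this

theorem addEdge_cut [DecidableEq (Option D)] (X : Stub D) {k : ℕ} (hk : k < X.tipSize) :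
    (X.addEdge hk).α * swap (X.addEdge hk).root ((X.addEdge hk).α (X.addEdge hk).root) =
      optionCongr X.α := by
  rw [addEdge_α_root]
  have : (X.addEdge hk).α * swap (some X.tip) none = optionCongr X.α := by
    rw [addEdge_α, mul_assoc, swap_mul_self, mul_one]
  exact this

/-- An isomorphism respects the cut of the root edge, hence the two orbits left by the cut. The
orientation of the root tells which orbit is the first. -/
theorem iso_bridge_iff {X : Stub D} {Y : Stub E} {X' : Stub D'} {Y' : Stub E'} :
    (X.bridge Y).Iso (X'.bridge Y') ↔ X.Iso X' ∧ Y.Iso Y' := by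
  classical
  constructor
  · rintro ⟨e, h1, h2, h3⟩
    have h4 : e (Sum.inr Y.tip) = Sum.inr Y'.tip := by
      rw [← bridge_α_root X, h2, h3, bridge_α_root]
    have h5 : ∀ d, e (Perm.sumCongr X.α Y.α d) = Perm.sumCongr X'.α Y'.α (e d) := by
      intro d
      rw [← bridge_cut, ← bridge_cut, conj_mul_swap e h2, h2, h3]
    have h6 := orbits_le_comap (σ := Perm.sumCongr X.σ Y.σ) (σ' := Perm.sumCongr X'.σ Y'.σ)
      e h1 h5
    rw [orbits_sum, orbits_sum] at h6
    obtain ⟨e₁, e₂, rfl⟩ := exists_sumCongr_eq (e := e) (fun a => by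
      have h7 := h6 (x := Sum.inl a) (y := Sum.inl X.tip)
        ((Setoid.sum_inl_inl _ _ _ _).2 trivial)
      rw [Setoid.comap_rel, show e (Sum.inl X.tip) = Sum.inl X'.tip from h3] at h7
      rcases h8 : e (Sum.inl a) with x | x
      · exact ⟨x, rfl⟩
      · rw [h8] at h7; simp at h7) (fun a => by
      have h7 := h6 (x := Sum.inr a) (y := Sum.inr Y.tip)
        ((Setoid.sum_inr_inr _ _ _ _).2 trivial)
      rw [Setoid.comap_rel, h4] at h7
      rcases h8 : e (Sum.inr a) with x | x
      · rw [h8] at h7; simp at h7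
      · exact ⟨x, rfl⟩)
    refine ⟨⟨e₁, fun d => ?_, fun d => ?_, ?_⟩, ⟨e₂, fun d => ?_, fun d => ?_, ?_⟩⟩
    · exact Sum.inl_injective (h1 (Sum.inl d))
    · exact Sum.inl_injective (h5 (Sum.inl d))
    · exact Sum.inl_injective h3
    · exact Sum.inr_injective (h1 (Sum.inr d))
    · exact Sum.inr_injective (h5 (Sum.inr d))
    · exact Sum.inr_injective h4
  · rintro ⟨⟨e₁, h1, h2, h3⟩, ⟨e₂, k1, k2, k3⟩⟩
    refine ⟨Equiv.sumCongr e₁ e₂, ?_, fun d => ?_, ?_⟩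
    · rintro (d | d)
      · exact congrArg Sum.inl (h1 d)
      · exact congrArg Sum.inr (k1 d)
    · have h5 : ∀ d, Equiv.sumCongr e₁ e₂ (Perm.sumCongr X.α Y.α d) =
          Perm.sumCongr X'.α Y'.α (Equiv.sumCongr e₁ e₂ d) := by
        rintro (d | d)
        · exact congrArg Sum.inl (h2 d)
        · exact congrArg Sum.inr (k2 d)
      have := conj_mul_swap _ h5 (Sum.inl X.tip) (Sum.inr Y.tip) d
      simp only [Equiv.sumCongr_apply, Sum.map_inl, Sum.map_inr, h3, k3] at this
      exact this
    · exact congrArg Sum.inl h3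

/-- The number `k` can be read off from the degree of the face on the other side of the root edge,
and `X` is what remains when that edge is cut and its second half removed. -/
theorem iso_addEdge_iff {X : Stub D} {Y : Stub E} {k l : ℕ} {hk : k < X.tipSize}
    {hl : l < Y.tipSize} : (X.addEdge hk).Iso (Y.addEdge hl) ↔ X.Iso Y ∧ k = l := by
  classical
  constructor
  · rintro ⟨e, h1, h2, h3⟩
    have h4 : e none = none := by
      rw [← addEdge_α_root X hk, h2, h3, addEdge_α_root]
    have h5 : ∀ d, e (optionCongr X.α d) = optionCongr Y.α (e d) := by
      intro d
      rw [← addEdge_cut X hk, ← addEdge_cut Y hl, conj_mul_swap e h2, h2, h3]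
    have h6 : k = l := by
      have h7 := classSize_eq_of_conj e (DartMap.Iso.φ_conj h1 h2) none
      rw [h4] at h7
      have h8 := classSize_addEdge_α_root X hk
      have h9 := classSize_addEdge_α_root Y hl
      rw [addEdge_α_root] at h8 h9
      omega
    refine ⟨?_, h6⟩
    obtain ⟨e, rfl⟩ := exists_optionCongr_eq h4
    exact ⟨e, ((conj_insertBefore_iff e).1 h1).1, (conj_optionCongr_iff e).1 h5,
      Option.some_injective _ h3⟩
  · rintro ⟨⟨e, h1, h2, h3⟩, rfl⟩
    have hφ : ∀ d, e (X.φ d) = Y.φ (e d) := fun d => by rw [mul_apply, mul_apply, h1, h2]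
    have hpow : ∀ n : ℕ, e ((X.φ ^ n) X.tip) = (Y.φ ^ n) Y.tip := by
      intro n
      induction n with
      | zero => exact h3
      | succ n ih => rw [pow_succ', mul_apply, hφ, ih, pow_succ' Y.φ, mul_apply Y.φ]
    refine ⟨optionCongr e, (conj_insertBefore_iff e).2 ⟨h1, hpow _⟩, fun d => ?_,
      congrArg some h3⟩
    have := conj_mul_swap _ ((conj_optionCongr_iff e).2 h2) (some X.tip) none d
    simp only [optionCongr_apply, Option.map_some, Option.map_none, h3] at this
    rw [optionCongr_apply, optionCongr_apply]
    exact this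

/-- The invariant is whether the root edge has the same face on both sides. -/
theorem not_iso_bridge_addEdge (X : Stub D) (Y : Stub E) (Z : Stub D') {k : ℕ}
    (hk : k < Z.tipSize) : ¬ (X.bridge Y).Iso (Z.addEdge hk) := by
  rintro ⟨e, h1, h2, h3⟩
  have h := sameCycle_bridge_root X Y
  rw [sameCycle_iff_of_conj e (DartMap.Iso.φ_conj h1 h2), h2, h3] at h
  exact not_sameCycle_addEdge_root Z hk h

end Stub

/-! ### Deleting the root edge of a map. -/

namespace DartMap

variable {D : Type*} [Finite D]

open Classical in
theorem cyc_cut (M : DartMap D) :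
    cyc M.α + 1 = cyc (M.α * swap M.root (M.α M.root)) := by
  have hcut := mul_swap_apply_involution M.α_invol M.α_ne M.root
  have h := cyc_mul_swap (π := M.α * swap M.root (M.α M.root)) (a := M.root) (b := M.α M.root)
    fun h => M.α_ne M.root (h.eq_of_fixed ((hcut.2 _).2 (Or.inl rfl))).symm
  rwa [mul_assoc, swap_mul_self, mul_one] at h

open Classical in
theorem merge_orbits_cut (M : DartMap D) :
    (orbits M.σ (M.α * swap M.root (M.α M.root))).merge M.root (M.α M.root) = ⊤ := by
  rw [merge_orbits_mul_swap, M.planar.orbits_eq]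
  exact top_le_iff.1 (Setoid.le_merge _ _ _)

open Classical in
theorem exists_addEdge_iso (M : DartMap D)
    (h : orbits M.σ (M.α * swap M.root (M.α M.root)) = ⊤) :
    ∃ (X : Stub {d // d ≠ M.α M.root}) (k : ℕ) (hk : k < X.tipSize), (X.addEdge hk).Iso M := by
  have : Nonempty D := ⟨M.root⟩
  set r := M.root with hr
  set r' := M.α r with hr'
  set β := M.α * swap r r' with hβ
  have hcut := mul_swap_apply_involution M.α_invol M.α_ne r
  rw [← hr', ← hβ] at hcut
  have hβα : β * swap r r' = M.α := by rw [hβ, mul_assoc, swap_mul_self, mul_one]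
  have hrr : r ≠ r' := (M.α_ne r).symm
  have hβr' : β r' = r' := (hcut.2 r').2 (Or.inr rfl)
  have hle := euler_le_of_orbits_eq_top M.σ β hcut.1 h
  have hE := M.planar.euler
  have hcα : cyc M.α + 1 = cyc β := M.cyc_cut
  have hφβ : M.φ * swap r r' = M.σ * β := by rw [mul_assoc]
  -- With one face on both sides, the cut would lose no face but gain a cycle of `α`, against
  -- Euler's inequality for the connected cut map.
  have hn : ¬ SameCycle M.φ r r' := by
    intro hs
    have h1 := (cycles (M.σ * β)).card_quotient_merge_le r r'
    rw [← hφβ, merge_cycles_mul_swap, Setoid.merge_eq_self hs, hφβ] at h1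
    change cyc M.φ ≤ cyc (M.σ * β) ∧ _ at h1
    change _ + cyc M.φ = _ at hE
    omega
  have hs : SameCycle (M.σ * β) r r' := by
    rw [← hφβ]; exact SameCycle.mul_swap_of_not hn
  -- A fixed `r'` would be a face by itself after the cut, although it shares its face with `r`.
  have hσ : M.σ r' ≠ r' := by
    intro hσ
    have : (M.σ * β) r' = r' := by rw [mul_apply, hβr', hσ]
    exact hrr (hs.symm.eq_of_fixed this).symm
  obtain ⟨e, σ', α', x, he, h1, h2⟩ := exists_insertBefore M.σ β r' hβr' hσ
  have hfix : ∀ d, optionCongr α' d = d ↔ d = e.symm r ∨ d = none := by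
    intro d
    rw [← e.apply_eq_iff_eq, h2, hcut.2, Equiv.eq_symm_apply]
    exact or_congr Iff.rfl ⟨fun k => e.injective (k.trans he.symm), fun k => by rw [k, he]⟩
  have hinv : ∀ d, optionCongr α' (optionCongr α' d) = d := by
    intro d
    apply e.injective
    rw [h2, h2, hcut.1]
  obtain ⟨y, hy⟩ : ∃ y, e.symm r = some y := by
    rw [← Option.ne_none_iff_exists']
    intro k
    rw [Equiv.symm_apply_eq, he] at k
    exact hrr k
  have hey : e (some y) = r := by rw [← hy, apply_symm_apply]
  have hP : Planar (insertBefore σ' x) (optionCongr α') := by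
    have hP : Planar M.σ β := by
      refine ⟨h, ?_⟩
      have h3 := cyc_mul_swap hn
      rw [hφβ] at h3
      change _ + cyc M.φ = _ at hE
      omega
    refine hP.of_conj e.symm (fun d => ?_) fun d => ?_
    · rw [Equiv.symm_apply_eq, h1, apply_symm_apply]
    · rw [Equiv.symm_apply_eq, h2, apply_symm_apply]
  let X : Stub {d // d ≠ r'} :=
    { σ := σ'
      α := α'
      tip := y
      α_invol := fun d => by simpa using hinv (some d)
      α_eq_iff := fun d => by simpa [hy] using hfix (some d)
      planar := planar_insertBefore_iff.1 hP }
  have hx : SameCycle X.φ y x := by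
    have h3 : SameCycle (insertBefore σ' x * optionCongr α') (some y) none := by
      rw [sameCycle_iff_of_conj e (π' := M.σ * β), he, hey]
      · exact hs
      · intro d; rw [mul_apply, mul_apply, h1, h2]
    rw [insertBefore_mul_optionCongr] at h3
    rw [← sameCycle_insertBefore_some X.φ x]
    exact h3.trans (sameCycle_insertBefore_none _ _)
  -- The distance is measured to the predecessor of `x` and reduced modulo the length of the face,
  -- so that `k` lies in the range required by `addEdge`.
  obtain ⟨k, hk, hkx⟩ : ∃ k < X.tipSize, (X.φ ^ (k + 1)) y = x := by
    have h4 : SameCycle X.φ y (X.φ⁻¹ x) := by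
      refine hx.trans (SameCycle.symm ?_)
      exact ⟨1, by simp⟩
    obtain ⟨n, -, hn⟩ := h4.exists_pow_eq'
    have hpos : 0 < Function.minimalPeriod X.φ y := by
      rw [← classSize_eq_minimalPeriod]; exact Setoid.classSize_pos _ _
    refine ⟨n % Function.minimalPeriod X.φ y, ?_, ?_⟩
    · rw [Stub.tipSize, classSize_eq_minimalPeriod]
      exact Nat.mod_lt _ hpos
    · rw [pow_succ', mul_apply, ← iterate_eq_pow, Function.iterate_mod_minimalPeriod_eq,
        iterate_eq_pow, hn, ← mul_apply, mul_inv_cancel, one_apply]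
  refine ⟨X, k, hk, e, fun d => ?_, fun d => ?_, hey⟩
  · rw [← h1]
    change e (insertBefore σ' ((X.φ ^ (k + 1)) y) d) = _
    rw [hkx]
  · have := conj_mul_swap e h2 (some y) none d
    rw [hey, he, hβα] at this
    rw [X.addEdge_α hk]
    exact this

-- When the cut disconnects the map, the pieces are the orbit of `r` and that of `r'`; nothing else
-- remains, as merging these two orbits gives everything.
open Classical in
theorem exists_bridge_iso (M : DartMap D)
    (h : orbits M.σ (M.α * swap M.root (M.α M.root)) ≠ ⊤) :
    ∃ (p : D → Prop) (X : Stub {d // p d}) (Y : Stub {d // ¬ p d}), (X.bridge Y).Iso M := by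
  set r := M.root with hr
  set r' := M.α r with hr'
  set β := M.α * swap r r' with hβ
  have hcut := mul_swap_apply_involution M.α_invol M.α_ne r
  rw [← hr', ← hβ] at hcut
  have hβα : β * swap r r' = M.α := by rw [hβ, mul_assoc, swap_mul_self, mul_one]
  set s := orbits M.σ β with hs
  have hm : s.merge r r' = ⊤ := M.merge_orbits_cut
  have hn : ¬ s r r' := fun k => h (by rw [← hm, Setoid.merge_eq_self k])
  have hsl := orbits_le_iff.1 (le_refl s)
  let p : D → Prop := fun d => s d r
  have hp : ∀ d, ¬ p d → s d r' := by
    intro d hd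
    have h1 : s.merge r r' d r := by rw [hm]; trivial
    rcases h1 with h1 | ⟨h1 | h1, -⟩
    · exact absurd h1 hd
    · exact absurd h1 hd
    · exact h1
  have hpr' : ¬ p r' := fun k => hn (s.symm' k)
  have hinv : ∀ {π : Perm D}, (∀ x, s x (π x)) → ∀ d, p (π d) ↔ p d := fun {π} hπ d =>
    ⟨fun k => s.trans' (hπ d) k, fun k => s.trans' (s.symm' (hπ d)) k⟩
  let e : {d // p d} ⊕ {d // ¬ p d} ≃ D := Equiv.sumCompl p
  have he : ∀ a, e (.inl a) = a := fun a => rfl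
  have he' : ∀ a, e (.inr a) = a := fun a => rfl
  obtain ⟨σ₁, σ₂, h1⟩ := exists_sumCongr_of_invariant p M.σ (hinv hsl.1) e he he'
  obtain ⟨α₁, α₂, h2⟩ := exists_sumCongr_of_invariant p β (hinv hsl.2) e he he'
  have hle : orbits M.σ β ≤ ((orbits σ₁ α₁).sum (orbits σ₂ α₂)).comap e.symm := by
    rw [← orbits_sumCongr]
    refine orbits_le_comap e.symm (fun d => ?_) fun d => ?_
    · rw [Equiv.symm_apply_eq, h1, apply_symm_apply]
    · rw [Equiv.symm_apply_eq, h2, apply_symm_apply]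
  have hel : ∀ a, e.symm a.1 = Sum.inl a := fun a => by rw [Equiv.symm_apply_eq, he]
  have her : ∀ a, e.symm a.1 = Sum.inr a := fun a => by rw [Equiv.symm_apply_eq, he']
  let r₁ : {d // p d} := ⟨r, s.refl' r⟩
  let r₂ : {d // ¬ p d} := ⟨r', hpr'⟩
  have ho₁ : orbits σ₁ α₁ = ⊤ := by
    have h3 : ∀ a, orbits σ₁ α₁ a r₁ := fun a => by
      have := hle a.2
      rw [Setoid.comap_rel, hel, show e.symm r = Sum.inl r₁ from hel r₁] at this
      exact (Setoid.sum_inl_inl _ _ _ _).1 this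
    exact Setoid.eq_top_iff.2 fun a b => Setoid.trans' _ (h3 a) (Setoid.symm' _ (h3 b))
  have ho₂ : orbits σ₂ α₂ = ⊤ := by
    have h3 : ∀ a, orbits σ₂ α₂ a r₂ := fun a => by
      have := hle (hp a.1 a.2)
      rw [Setoid.comap_rel, her, show e.symm r' = Sum.inr r₂ from her r₂] at this
      exact (Setoid.sum_inr_inr _ _ _ _).1 this
    exact Setoid.eq_top_iff.2 fun a b => Setoid.trans' _ (h3 a) (Setoid.symm' _ (h3 b))
  have hi : ∀ d, Perm.sumCongr α₁ α₂ (Perm.sumCongr α₁ α₂ d) = d := fun d =>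
    e.injective (by rw [h2, h2, hcut.1])
  have hi₁ : ∀ d, α₁ (α₁ d) = d := fun d => Sum.inl_injective (hi (Sum.inl d))
  have hi₂ : ∀ d, α₂ (α₂ d) = d := fun d => Sum.inr_injective (hi (Sum.inr d))
  have hf₁ : ∀ d, α₁ d = d ↔ d = r₁ := fun d => by
    have h3 : e (Perm.sumCongr α₁ α₂ (Sum.inl d)) = (α₁ d : D) := rfl
    rw [h2, he] at h3
    rw [Subtype.ext_iff, ← h3, hcut.2, Subtype.ext_iff]
    exact ⟨fun k => k.resolve_right fun k => hpr' (k ▸ d.2), Or.inl⟩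
  have hf₂ : ∀ d, α₂ d = d ↔ d = r₂ := fun d => by
    have h3 : e (Perm.sumCongr α₁ α₂ (Sum.inr d)) = (α₂ d : D) := rfl
    rw [h2, he'] at h3
    rw [Subtype.ext_iff, ← h3, hcut.2, Subtype.ext_iff]
    exact ⟨fun k => k.resolve_left fun k => d.2 (k ▸ s.refl' r), Or.inr⟩
  have hE := M.planar.euler
  have hcα : cyc M.α + 1 = cyc β := M.cyc_cut
  have hcφ : cyc M.φ + 1 = cyc (M.σ * β) := by
    have h3 := cyc_mul_swap (π := M.σ * β) (a := r) (b := r')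
      fun k => hn (cycles_mul_le_orbits _ _ k)
    rwa [mul_assoc, hβα] at h3
  have hc1 := cyc_eq_of_conj e h1
  have hc2 := cyc_eq_of_conj e h2
  have hc3 := cyc_eq_of_conj (π := Perm.sumCongr σ₁ σ₂ * Perm.sumCongr α₁ α₂) (π' := M.σ * β) e
    (fun d => by rw [mul_apply, mul_apply, h1, h2])
  rw [sumCongr_mul] at hc3
  rw [cyc_sumCongr] at hc1 hc2 hc3
  have hcard := Nat.card_congr e
  rw [Nat.card_sum] at hcard
  have : Nonempty {d // p d} := ⟨r₁⟩
  have : Nonempty {d // ¬ p d} := ⟨r₂⟩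
  have hl₁ := euler_le_of_orbits_eq_top σ₁ α₁ hi₁ ho₁
  have hl₂ := euler_le_of_orbits_eq_top σ₂ α₂ hi₂ ho₂
  change _ + cyc M.φ = _ at hE
  -- Euler's inequalities `hl₁` and `hl₂` of the two pieces add up to an equality, by the relation
  -- for `M`; hence each of them is an equality.
  refine ⟨p, ⟨σ₁, α₁, r₁, hi₁, hf₁, ho₁, by omega⟩, ⟨σ₂, α₂, r₂, hi₂, hf₂, ho₂, by omega⟩, e,
    h1, fun d => ?_, rfl⟩
  have := conj_mul_swap e h2 (Sum.inl r₁) (Sum.inr r₂) d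
  rw [he, he'] at this
  change _ = (β * swap r r') (e d) at this
  rw [hβα] at this
  rw [Stub.bridge_α]
  exact this

end DartMap

/-! ### Face counts as multiplicities in multisets of cycle lengths. -/

theorem Setoid.count_classSizes {D : Type*} [Finite D] (s : Setoid D) (i : ℕ) :
    s.classSizes.count i =
      Nat.card {q : Quotient s // Nat.card {d // Quotient.mk s d = q} = i} := by
  classical
  let _ := Fintype.ofFinite (Quotient s)
  rw [classSizes, Multiset.count_map, Nat.card_eq_fintype_card, Fintype.card_subtype,
    Finset.card_def, Finset.filter_val]
  congr 1
  exact Multiset.filter_congr fun q _ => eq_comm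

theorem Setoid.pos_of_mem_classSizes {D : Type*} [Finite D] (s : Setoid D) {i : ℕ}
    (h : i ∈ s.classSizes) : 0 < i := by
  classical
  let _ := Fintype.ofFinite (Quotient s)
  obtain ⟨q, -, rfl⟩ := Multiset.mem_map.1 h
  induction q using Quotient.inductionOn with | _ a => ?_
  rw [Setoid.natCard_mk_eq]
  exact s.classSize_pos a

namespace DartMap

variable {D : Type*}

theorem outerDegree_eq_classSize (M : DartMap D) :
    M.outerDegree = (cycles M.φ).classSize M.root :=
  Setoid.natCard_mk_eq _ _

variable [Finite D]

instance (M : DartMap D) : Finite M.Face := inferInstanceAs (Finite (Quotient _))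

theorem faceCount_eq_count (M : DartMap D) (i : ℕ) :
    M.faceCount i = (cycles M.φ).classSizes.count i :=
  (Setoid.count_classSizes _ _).symm

theorem faceCount_eq_add (M : DartMap D) (i : ℕ) :
    M.faceCount i = M.finiteFaceCount i + if i = M.outerDegree then 1 else 0 := by
  classical
  let _ := Fintype.ofFinite M.Face
  rw [faceCount, finiteFaceCount, Nat.card_eq_fintype_card, Nat.card_eq_fintype_card,
    Fintype.card_subtype, Fintype.card_subtype]
  have h1 : (Finset.univ.filter fun f : M.Face => f ≠ M.rootFace ∧ M.faceDegree f = i) =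
      (Finset.univ.filter fun f : M.Face => M.faceDegree f = i).erase M.rootFace := by
    ext f; simp
  rw [h1]
  split_ifs with h
  · rw [Finset.card_erase_add_one]
    simp [h, outerDegree]
  · rw [Finset.erase_eq_of_notMem, add_zero]
    simpa [outerDegree] using fun k => h k.symm

theorem finiteFaceCount_eq_count (M : DartMap D) (i : ℕ) :
    M.finiteFaceCount i = ((cycles M.φ).otherClassSizes M.root).count i := by
  have h := M.faceCount_eq_add i
  rw [faceCount_eq_count, Setoid.classSizes_eq_cons _ M.root, Multiset.count_cons,
    ← outerDegree_eq_classSize] at h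
  omega

/-- Transport a map along a relabelling of the darts. -/
def relabel {E : Type*} [Finite E] (M : DartMap D) (e : D ≃ E) : DartMap E :=
  DartMap.ofPlanar (e.permCongr M.σ) (e.permCongr M.α) (e M.root)
    (fun d => by simp [permCongr_apply, M.α_invol])
    (fun d => by simp [permCongr_apply, ← Equiv.eq_symm_apply, M.α_ne])
    (M.planar.of_conj e (fun d => by simp [permCongr_apply]) fun d => by simp [permCongr_apply])

theorem iso_relabel {E : Type*} [Finite E] (M : DartMap D) (e : D ≃ E) : M.Iso (M.relabel e) :=
  ⟨e, fun d => by simp [relabel, ofPlanar, permCongr_apply],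
    fun d => by simp [relabel, ofPlanar, permCongr_apply], rfl⟩

end DartMap

namespace Stub

variable {D : Type*} [Finite D]

theorem ofDartMap_φ (M : DartMap D) : (ofDartMap M).φ = insertBefore M.φ M.root :=
  insertBefore_mul_optionCongr _ _ _

theorem tipSize_ofDartMap (M : DartMap D) :
    (ofDartMap M).tipSize = (cycles M.φ).classSize M.root + 1 := by
  rw [tipSize, ofDartMap_φ]
  exact classSize_insertBefore_none _ _

theorem innerSizes_ofDartMap (M : DartMap D) :
    (ofDartMap M).innerSizes = (cycles M.φ).otherClassSizes M.root := by
  have h := (ofDartMap M).classSizes_eq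
  obtain ⟨rest, h1, h2⟩ := exists_classSizes_insertBefore M.φ M.root
  rw [tipSize_ofDartMap, ofDartMap_φ, h2, Multiset.cons_inj_right] at h
  rw [Setoid.classSizes_eq_cons _ M.root, Multiset.cons_inj_right] at h1
  rw [← h, h1]

theorem tipSize_unit : unit.tipSize = 1 := by
  rw [tipSize, classSize_eq_minimalPeriod]
  exact Function.minimalPeriod_eq_one_iff_isFixedPt.2 rfl

theorem innerSizes_unit : unit.innerSizes = 0 := by
  have h1 : Multiset.card (cycles unit.φ).classSizes = 1 := by
    rw [Setoid.card_classSizes]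
    exact Nat.card_eq_one_iff_unique.2 ⟨inferInstance, ⟨Quotient.mk _ ()⟩⟩
  rw [unit.classSizes_eq, Multiset.card_cons] at h1
  exact Multiset.card_eq_zero.1 (by omega)

end Stub

/-! ### The decomposition of rooted maps up to isomorphism. -/

namespace RootedPlanarMap

/-- The darts of a representative of a rooted map, the tip included. -/
def Darts : RootedPlanarMap → Type
  | vertex => Unit
  | ofEdges n _ => Option (Fin (2 * n))

instance : ∀ M : RootedPlanarMap, Finite M.Darts
  | vertex => inferInstanceAs (Finite Unit)
  | ofEdges n _ => inferInstanceAs (Finite (Option (Fin (2 * n))))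

/-- A representative of a rooted map, with its root corner marked by a tip. -/
noncomputable def stub : (M : RootedPlanarMap) → Stub M.Darts
  | vertex => Stub.unit
  | ofEdges _ q => Stub.ofDartMap (Quotient.out q)

theorem card_darts : ∀ M : RootedPlanarMap, Nat.card M.Darts = 2 * M.edges + 1
  | vertex => by simp [Darts, edges]
  | ofEdges n q => by simp [Darts, edges]

theorem stub_iso_stub : ∀ {M N : RootedPlanarMap}, M.stub.Iso N.stub → M = N
  | vertex, vertex, _ => rfl
  | vertex, ofEdges n q, h => absurd h (Stub.not_iso_unit_ofDartMap _)
  | ofEdges n q, vertex, h => absurd h.symm (Stub.not_iso_unit_ofDartMap _)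
  | ofEdges n q, ofEdges n' q', h => by
    have hn : n = n' := by
      have h1 := h.sizes.2.2
      rw [card_darts, card_darts] at h1
      simp only [edges] at h1
      omega
    subst hn
    have h2 : (DartMap.isoSetoid n).r (Quotient.out q) (Quotient.out q') :=
      Stub.iso_ofDartMap_iff.1 h
    rw [← Quotient.out_eq q, ← Quotient.out_eq q']
    exact congrArg _ (Quotient.sound h2)

theorem exists_stub_iso {D : Type*} [Finite D] (X : Stub D) :
    ∃ M : RootedPlanarMap, M.stub.Iso X := by
  rcases X.exists_iso_unit_or with h | ⟨M, h⟩
  · exact ⟨vertex, h⟩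
  · let n := cyc M.α
    have hn : Nat.card {d // d ≠ X.tip} = 2 * n := M.card_eq
    let e := (Finite.equivFinOfCardEq hn)
    refine ⟨ofEdges n (Quotient.mk _ (M.relabel e)), Stub.Iso.trans ?_ h⟩
    refine Stub.iso_ofDartMap_iff.2 (DartMap.Iso.trans ?_ (M.iso_relabel e).symm)
    exact Quotient.mk_out (s := DartMap.isoSetoid n) (M.relabel e)

/-- The rooted map of a stub. -/
noncomputable def ofStub {D : Type*} [Finite D] (X : Stub D) : RootedPlanarMap :=
  (exists_stub_iso X).choose

theorem stub_ofStub {D : Type*} [Finite D] (X : Stub D) : (ofStub X).stub.Iso X :=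
  (exists_stub_iso X).choose_spec

theorem ofStub_eq_iff {D E : Type*} [Finite D] [Finite E] {X : Stub D} {Y : Stub E} :
    ofStub X = ofStub Y ↔ X.Iso Y := by
  constructor
  · intro h
    refine (stub_ofStub X).symm.trans ?_
    rw [h]
    exact stub_ofStub Y
  · intro h
    exact stub_iso_stub ((stub_ofStub X).trans (h.trans (stub_ofStub Y).symm))

/-- The degrees of the finite faces. -/
noncomputable def innerDegrees (M : RootedPlanarMap) : Multiset ℕ := M.stub.innerSizes

/-- The extra one is the tip, which lies in the root face. -/
theorem tipSize_stub : ∀ M : RootedPlanarMap, M.stub.tipSize = M.outerDegree + 1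
  | vertex => Stub.tipSize_unit
  | ofEdges n q => by
    refine (Stub.tipSize_ofDartMap _).trans ?_
    rw [← DartMap.outerDegree_eq_classSize]
    conv_rhs => rw [← Quotient.out_eq q]
    rfl

theorem count_innerDegrees (i : ℕ) :
    ∀ M : RootedPlanarMap, M.innerDegrees.count i = M.finiteFaceCount i
  | vertex => by
    rw [innerDegrees]
    change Stub.unit.innerSizes.count i = 0
    rw [Stub.innerSizes_unit, Multiset.count_zero]
  | ofEdges n q => by
    rw [innerDegrees]
    refine (congrArg _ (Stub.innerSizes_ofDartMap _)).trans ?_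
    rw [← DartMap.finiteFaceCount_eq_count]
    conv_rhs => rw [← Quotient.out_eq q]
    rfl

theorem faceCount_eq_add (i : ℕ) : ∀ M : RootedPlanarMap,
    M.faceCount i = M.finiteFaceCount i + if i = M.outerDegree then 1 else 0
  | vertex => by
    simp only [faceCount, finiteFaceCount, outerDegree, zero_add]
    congr
  | ofEdges n q => by
    rw [← Quotient.out_eq q]
    exact DartMap.faceCount_eq_add _ _

theorem pos_of_mem_innerDegrees (M : RootedPlanarMap) {i : ℕ} (h : i ∈ M.innerDegrees) : 0 < i :=
  Setoid.pos_of_mem_classSizes _ (Multiset.mem_of_mem_erase h)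

theorem outerDegree_eq_zero_iff : ∀ M : RootedPlanarMap, M.outerDegree = 0 ↔ M = vertex
  | vertex => by simp [outerDegree]
  | ofEdges n q => by
    simp only [reduceCtorEq, iff_false]
    rw [← Quotient.out_eq q]
    change DartMap.outerDegree _ ≠ 0
    rw [DartMap.outerDegree_eq_classSize]
    exact (Setoid.classSize_pos _ _).ne'

/-- Join two maps by a root edge that is a bridge. -/
noncomputable def bridge (M N : RootedPlanarMap) : RootedPlanarMap :=
  ofStub (Stub.ofDartMap (M.stub.bridge N.stub))

/-- Add a root edge that cuts a finite face of degree `k + 1` off the infinite face. -/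
noncomputable def addEdge (M : RootedPlanarMap) (k : Fin (M.outerDegree + 1)) :
    RootedPlanarMap :=
  ofStub (Stub.ofDartMap (M.stub.addEdge (k := k) (by rw [tipSize_stub]; exact k.2)))

theorem stats_ofStub {D : Type*} [Finite D] (X : Stub D) :
    2 * (ofStub X).edges + 1 = Nat.card D ∧ (ofStub X).outerDegree + 1 = X.tipSize ∧
      (ofStub X).innerDegrees = X.innerSizes := by
  have h := (stub_ofStub X).sizes
  rw [← card_darts, ← tipSize_stub]
  exact ⟨h.2.2, h.1, h.2.1⟩

theorem stats_bridge (M N : RootedPlanarMap) :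
    (M.bridge N).edges = M.edges + N.edges + 1 ∧
    (M.bridge N).outerDegree = M.outerDegree + N.outerDegree + 2 ∧
    (M.bridge N).innerDegrees = M.innerDegrees + N.innerDegrees := by
  have h := stats_ofStub (Stub.ofDartMap (M.stub.bridge N.stub))
  have hs := Stub.bridge_sizes M.stub N.stub
  rw [Stub.tipSize_ofDartMap, Stub.innerSizes_ofDartMap, hs.1, hs.2, tipSize_stub, tipSize_stub,
    Finite.card_option, Nat.card_sum, card_darts, card_darts] at h
  exact ⟨by unfold bridge; omega, by unfold bridge; omega, h.2.2⟩

theorem stats_addEdge (M : RootedPlanarMap) (k : Fin (M.outerDegree + 1)) :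
    (M.addEdge k).edges = M.edges + 1 ∧
    (M.addEdge k).outerDegree = M.outerDegree - k + 1 ∧
    (M.addEdge k).innerDegrees = (k + 1 : ℕ) ::ₘ M.innerDegrees := by
  have hk : k < M.stub.tipSize := by rw [tipSize_stub]; exact k.2
  have h := stats_ofStub (Stub.ofDartMap (M.stub.addEdge hk))
  have hs := Stub.addEdge_sizes M.stub hk
  rw [Stub.tipSize_ofDartMap, Stub.innerSizes_ofDartMap, hs.2, Finite.card_option,
    Finite.card_option, card_darts] at h
  rw [tipSize_stub] at hs
  have := k.2
  exact ⟨by unfold addEdge; omega, by unfold addEdge; omega, h.2.2⟩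

/-- A rooted map is a vertex, or its root edge is a bridge between two maps, or its root edge
separates a finite face from the infinite face. -/
noncomputable def compose : Option ((RootedPlanarMap × RootedPlanarMap) ⊕
    (Σ M : RootedPlanarMap, Fin (M.outerDegree + 1))) → RootedPlanarMap
  | none => vertex
  | some (.inl p) => p.1.bridge p.2
  | some (.inr p) => p.1.addEdge p.2

theorem vertex_ne_ofStub {D : Type*} [Finite D] (M : DartMap D) :
    vertex ≠ ofStub (Stub.ofDartMap M) := by
  intro h
  refine Stub.not_iso_unit_ofDartMap M ?_
  change vertex.stub.Iso _
  rw [h]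
  exact stub_ofStub _

/-- Injectivity: each construction determines its ingredients up to isomorphism, and the number of
sides of the root edge on the infinite face separates the constructions. Surjectivity: a map with a
root edge arises by `addEdge` or by `bridge`, according to whether cutting that edge leaves it
connected. -/
theorem compose_bijective : Function.Bijective compose := by
  constructor
  · rintro (_ | p | p) (_ | q | q) h
    · rfl
    · exact absurd h (vertex_ne_ofStub _)
    · exact absurd h (vertex_ne_ofStub _)
    · exact absurd h.symm (vertex_ne_ofStub _)
    · have h1 := Stub.iso_bridge_iff.1 (Stub.iso_ofDartMap_iff.1 (ofStub_eq_iff.1 h))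
      rw [Prod.ext (stub_iso_stub h1.1) (stub_iso_stub h1.2)]
    · exact absurd (Stub.iso_ofDartMap_iff.1 (ofStub_eq_iff.1 h))
        (Stub.not_iso_bridge_addEdge _ _ _ _)
    · exact absurd h.symm (vertex_ne_ofStub _)
    · exact absurd (Stub.iso_ofDartMap_iff.1 (ofStub_eq_iff.1 h)).symm
        (Stub.not_iso_bridge_addEdge _ _ _ _)
    · have h1 := Stub.iso_addEdge_iff.1 (Stub.iso_ofDartMap_iff.1 (ofStub_eq_iff.1 h))
      obtain ⟨M, k⟩ := p
      obtain ⟨N, l⟩ := q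
      obtain rfl : M = N := stub_iso_stub h1.1
      obtain rfl : k = l := Fin.ext h1.2
      rfl
  · intro M
    rcases M with _ | ⟨n, q⟩
    · exact ⟨none, rfl⟩
    · classical
      let N := Quotient.out q
      have hN : ∀ {D : Type} [Finite D] (P : DartMap D), P.Iso N →
          ofStub (Stub.ofDartMap P) = ofEdges n q := fun P hP =>
        stub_iso_stub ((stub_ofStub _).trans (Stub.iso_ofDartMap_iff.2 hP))
      by_cases h : orbits N.σ (N.α * swap N.root (N.α N.root)) = ⊤
      · obtain ⟨X, k, hk, hX⟩ := N.exists_addEdge_iso (by convert h)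
        have hs := (stats_ofStub X).2.1
        refine ⟨some (.inr ⟨ofStub X, ⟨k, by rw [hs]; exact hk⟩⟩), hN _ ?_⟩
        exact (Stub.iso_addEdge_iff.2 ⟨stub_ofStub X, rfl⟩).trans hX
      · obtain ⟨p, X, Y, hX⟩ := N.exists_bridge_iso (by convert h)
        refine ⟨some (.inl (ofStub X, ofStub Y)), hN _ ?_⟩
        exact (Stub.iso_bridge_iff.2 ⟨stub_ofStub X, stub_ofStub Y⟩).trans hX

end RootedPlanarMap

end Maps

/-! ### Adic fixed points and the divided difference in u. -/

section Series

open MvPowerSeries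

/-- The inclusion of the variables `t, z₁, …, z_m` into `t, u, z₁, …, z_m`. -/
def GVar.emb (m : ℕ) : GVar m ↪ FVar m where
  toFun
    | .t => .t
    | .z i => .z i
  inj' := by rintro (_ | i) (_ | j) h <;> simp_all

@[simp] theorem GVar.emb_t (m : ℕ) : GVar.emb m .t = .t := rfl
@[simp] theorem GVar.emb_z {m : ℕ} (i : Fin m) : GVar.emb m (.z i) = .z i := rfl

theorem FVar.mem_range_emb_iff {m : ℕ} (v : FVar m) : v ∈ Set.range (GVar.emb m) ↔ v ≠ .u := by
  constructor
  · rintro ⟨_ | i, rfl⟩ <;> simp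
  · rcases v with _ | _ | i
    · exact fun _ => ⟨.t, rfl⟩
    · exact fun h => absurd rfl h
    · exact fun _ => ⟨.z i, rfl⟩

namespace MapSeries

section adic

theorem X_ne_zero {σ R : Type*} [CommRing R] [Nontrivial R] (s : σ) :
    (X s : MvPowerSeries σ R) ≠ 0 := by
  intro h
  have := coeff_index_single_self_X (R := R) s
  rw [h] at this
  simp at this

variable {σ R : Type*} [CommRing R] {s : σ}

theorem eq_of_forall_X_pow_dvd_sub {f g : MvPowerSeries σ R} (h : ∀ n, X s ^ n ∣ f - g) :
    f = g := by
  ext e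
  have := X_pow_dvd_iff.1 (h (e s + 1)) e (by omega)
  rwa [map_sub, sub_eq_zero] at this

/-- A contraction for the `s`-adic topology has a fixed point. -/
theorem exists_fixedPoint {κ : Type*}
    (Φ : (κ → MvPowerSeries σ R) → κ → MvPowerSeries σ R)
    (hΦ : ∀ n f g, (∀ i, X s ^ n ∣ f i - g i) → ∀ i, X s ^ (n + 1) ∣ Φ f i - Φ g i) :
    ∃ f, Φ f = f := by
  let q : ℕ → κ → MvPowerSeries σ R := fun n => Φ^[n] 0
  have hq : ∀ n, q (n + 1) = Φ (q n) := fun n => Function.iterate_succ_apply' _ _ _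
  have h1 : ∀ n i, X s ^ n ∣ q (n + 1) i - q n i := by
    intro n
    induction n with
    | zero => intro i; simp
    | succ n ih =>
      intro i
      rw [hq (n + 1), hq n]
      have := hΦ n _ _ ih i
      rwa [hq n] at this
  have h2 : ∀ n k i, X s ^ n ∣ q (n + k) i - q n i := by
    intro n k i
    induction k with
    | zero => simp
    | succ k ih =>
      have h3 : X s ^ n ∣ q (n + k + 1) i - q (n + k) i :=
        (pow_dvd_pow _ (by omega)).trans (h1 (n + k) i)
      have := dvd_add h3 ih
      rwa [sub_add_sub_cancel] at this
  -- The coefficient at `e` is constant from the iterate `e s + 1` on, as later iterates differ by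
  -- multiples of a higher power of `X s`.
  let f : κ → MvPowerSeries σ R := fun i e => coeff e (q (e s + 1) i)
  have hf : ∀ n i, X s ^ n ∣ f i - q n i := by
    intro n i
    rw [X_pow_dvd_iff]
    intro e he
    obtain ⟨k, rfl⟩ := Nat.exists_eq_add_of_le (show e s + 1 ≤ n by omega)
    have := X_pow_dvd_iff.1 (h2 (e s + 1) k i) e (by omega)
    rw [map_sub, sub_eq_zero] at this
    rw [map_sub, this]
    exact sub_self _
  refine ⟨f, funext fun i => eq_of_forall_X_pow_dvd_sub (s := s) fun n => ?_⟩
  rcases n with _ | n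
  · simp
  · have h3 := hΦ n _ _ (hf n) i
    rw [← hq] at h3
    have := dvd_sub h3 (hf (n + 1) i)
    rwa [sub_sub_sub_cancel_right] at this

end adic

variable {m : ℕ}

/-- Series in `t, u, z₁, …, z_m`. -/
abbrev FSeries (m : ℕ) : Type := MvPowerSeries (FVar m) ℚ

/-- Series in `t, z₁, …, z_m`. -/
abbrev GSeries (m : ℕ) : Type := MvPowerSeries (GVar m) ℚ

instance (m : ℕ) : Filter.TendstoCofinite (GVar.emb m) :=
  ⟨(GVar.emb m).injective.tendsto_cofinite⟩

/-- Regard a series without `u` as a series in all variables. -/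
noncomputable def ι : GSeries m →ₐ[ℚ] FSeries m := rename (GVar.emb m)

/-- Set `u = 0`. -/
noncomputable def ε : FSeries m →ₐ[ℚ] GSeries m := killCompl (GVar.emb m)

/-- The divided difference `(f(u) - f(0)) / u`. -/
noncomputable def Δ : FSeries m →ₗ[ℚ] FSeries m where
  toFun f := fun e => coeff (e + Finsupp.single .u 1) f
  map_add' _ _ := rfl
  map_smul' _ _ := rfl

theorem coeff_Δ (f : FSeries m) (e : FVar m →₀ ℕ) :
    coeff e (Δ f) = coeff (e + Finsupp.single .u 1) f := rfl

@[simp] theorem ε_ι (c : GSeries m) : ε (ι c) = c := killCompl_rename_app c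

theorem ε_X_u : ε (X .u : FSeries m) = 0 :=
  killCompl_X_eq_zero fun h => (FVar.mem_range_emb_iff _).1 h rfl

theorem ι_X_t : ι (X .t : GSeries m) = X .t := rename_X (GVar.emb m) _

theorem ι_X_z (i : Fin m) : ι (X (.z i) : GSeries m) = X (.z i) := rename_X (GVar.emb m) _

theorem ε_X_t : ε (X .t : FSeries m) = X .t := by rw [← ι_X_t, ε_ι]

theorem ε_X_z (i : Fin m) : ε (X (.z i) : FSeries m) = X (.z i) := by rw [← ι_X_z, ε_ι]

theorem exists_embDomain_iff (e : FVar m →₀ ℕ) :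
    e ∈ Set.range (Finsupp.embDomain (GVar.emb m)) ↔ e .u = 0 := by
  rw [Finsupp.mem_range_embDomain_iff]
  constructor
  · intro h
    by_contra h1
    have := h (Finsupp.mem_support_iff.2 h1)
    rw [FVar.mem_range_emb_iff] at this
    exact this rfl
  · intro h v hv
    rw [FVar.mem_range_emb_iff]
    rintro rfl
    exact Finsupp.mem_support_iff.1 hv h

/-- `f = f(0) + u Δ f`. -/
theorem ι_ε_add (f : FSeries m) : ι (ε f) + X .u * Δ f = f := by
  ext e
  by_cases h : e .u = 0
  · have h1 : coeff e (X .u * Δ f) = 0 :=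
      X_dvd_iff.1 (Dvd.intro _ rfl) e h
    obtain ⟨e, rfl⟩ := (exists_embDomain_iff e).2 h
    rw [map_add, h1, ι, ε, coeff_embDomain_rename, coeff_killCompl, add_zero]
  · have h1 : coeff e (ι (ε f)) = 0 := by
      refine coeff_rename_eq_zero _ _ ?_
      rintro ⟨x, hx⟩
      rw [← Finsupp.embDomain_eq_mapDomain] at hx
      exact h ((exists_embDomain_iff e).1 ⟨x, hx⟩)
    obtain ⟨e, rfl⟩ : ∃ e', e = Finsupp.single .u 1 + e' :=
      ⟨_, (add_tsub_cancel_of_le (Finsupp.single_le_iff.2 (Nat.one_le_iff_ne_zero.2 h))).symm⟩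
    rw [map_add, h1, X_def, coeff_add_monomial_mul, one_mul, zero_add, coeff_Δ, add_comm]

theorem X_u_mul_cancel {f g : FSeries m} (h : X FVar.u * f = X FVar.u * g) : f = g := by
  have h1 : X FVar.u * (f - g) = 0 := by rw [mul_sub, h, sub_self]
  exact sub_eq_zero.1 ((mul_eq_zero.1 h1).resolve_left (X_ne_zero FVar.u))

theorem Δ_X_u_mul (f : FSeries m) : Δ (X .u * f) = f := by
  have h := ι_ε_add (X .u * f)
  rw [map_mul, ε_X_u, zero_mul, map_zero, zero_add] at h
  exact X_u_mul_cancel h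

theorem Δ_ι_mul (c : GSeries m) (f : FSeries m) : Δ (ι c * f) = ι c * Δ f := by
  have h := ι_ε_add (ι c * f)
  conv_rhs at h => rw [← ι_ε_add f]
  rw [map_mul, ε_ι, map_mul, mul_add, add_right_inj, mul_left_comm] at h
  exact X_u_mul_cancel h

theorem Δ_ι (c : GSeries m) : Δ (ι c) = 0 := by
  have h := ι_ε_add (ι c)
  rw [ε_ι, add_eq_left] at h
  exact (mul_eq_zero.1 h).resolve_left (X_ne_zero FVar.u)

theorem Δ_pow_ι_mul (k : ℕ) (c : GSeries m) (f : FSeries m) :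
    (Δ ^ k) (ι c * f) = ι c * (Δ ^ k) f := by
  induction k with
  | zero => rfl
  | succ k ih => rw [pow_succ', Module.End.mul_apply, ih, Δ_ι_mul, Module.End.mul_apply]

theorem Δ_pow_X_u_pow_mul (k : ℕ) (f : FSeries m) : (Δ ^ k) (X .u ^ k * f) = f := by
  induction k with
  | zero => simp
  | succ k ih => rw [pow_succ, pow_succ', mul_assoc, Module.End.mul_apply, Δ_X_u_mul, ih]

theorem Δ_pow_X_u_pow_mul_of_le {k n : ℕ} (h : k ≤ n) (f : FSeries m) :
    (Δ ^ k) (X .u ^ n * f) = X .u ^ (n - k) * f := by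
  obtain ⟨l, rfl⟩ := Nat.exists_eq_add_of_le h
  rw [pow_add, mul_assoc, Δ_pow_X_u_pow_mul, Nat.add_sub_cancel_left]

theorem Δ_pow_X_u_pow_mul_of_ge {k n : ℕ} (h : n ≤ k) (f : FSeries m) :
    (Δ ^ k) (X .u ^ n * f) = (Δ ^ (k - n)) f := by
  obtain ⟨l, rfl⟩ := Nat.exists_eq_add_of_le h
  rw [add_comm n l, pow_add, Module.End.mul_apply, Δ_pow_X_u_pow_mul, Nat.add_sub_cancel]

/-- Polynomials in u of degree below `k` are killed. This discards both faces longer than the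
boundary available and, later, the polynomial remainder in the parametrized equation. -/
theorem Δ_pow_X_u_pow_of_lt {k n : ℕ} (h : n < k) (c : GSeries m) :
    (Δ ^ k) (X .u ^ n * ι c) = 0 := by
  rw [Δ_pow_X_u_pow_mul_of_ge h.le]
  obtain ⟨l, hl⟩ := Nat.exists_eq_add_of_lt h
  rw [show k - n = l + 1 by omega, pow_succ, Module.End.mul_apply, Δ_ι, map_zero]

theorem dvd_Δ_pow {n : ℕ} {f : FSeries m} (h : X .t ^ n ∣ f) (k : ℕ) : X .t ^ n ∣ (Δ ^ k) f := by
  obtain ⟨g, rfl⟩ := h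
  rw [← ι_X_t, ← map_pow, Δ_pow_ι_mul]
  exact Dvd.intro _ rfl

end MapSeries

/-! ### Weights of maps and the series they sum to. -/

namespace MapSeries

variable {m : ℕ}

/-- The weight `z_{k+1}` of a face of degree `k + 1`; it is zero if the degree exceeds `m`. -/
def faceWeight {R : Type*} [Zero R] (z : Fin m → R) (k : ℕ) : R :=
  if h : k < m then z ⟨k, h⟩ else 0

-- Giving weight zero to degrees above `m` turns the restriction on the faces into the vanishing of
-- a product. Positivity of the degrees makes the shift `d - 1` harmless.
open Classical in
theorem prod_faceWeight {R : Type*} [CommSemiring R] (z : Fin m → R) (s : Multiset ℕ)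
    (hs : ∀ d ∈ s, 0 < d) :
    (s.map fun d => faceWeight z (d - 1)).prod =
      if ∀ i, m < i → s.count i = 0 then ∏ i : Fin m, z i ^ s.count (i + 1 : ℕ) else 0 := by
  induction s using Multiset.induction_on with
  | empty => simp
  | cons d s ih =>
    have hd : 0 < d := hs d (Multiset.mem_cons_self d s)
    rw [Multiset.map_cons, Multiset.prod_cons, ih fun d hd => hs d (Multiset.mem_cons_of_mem hd)]
    by_cases hdm : m < d
    · rw [faceWeight, dif_neg (by omega), zero_mul, if_neg]
      intro h
      have := h d hdm
      simp at this
    · have h1 : (∀ i, m < i → (d ::ₘ s).count i = 0) ↔ ∀ i, m < i → s.count i = 0 := by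
        refine forall₂_congr fun i hi => ?_
        rw [Multiset.count_cons_of_ne (by omega)]
      simp only [h1]
      split_ifs with h
      · rw [faceWeight, dif_pos (by omega)]
        set j : Fin m := ⟨d - 1, by omega⟩ with hj
        have h2 : ∀ i : Fin m, z i ^ (d ::ₘ s).count (i + 1 : ℕ) =
            (if i = j then z j else 1) * z i ^ s.count (i + 1 : ℕ) := by
          intro i
          rw [Multiset.count_cons]
          by_cases hi : i = j
          · rw [if_pos hi, if_pos (by rw [hi, hj]; simp; omega), pow_succ, hi, mul_comm]
          · rw [if_neg hi, if_neg, add_zero, one_mul]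
            intro k
            exact hi (Fin.ext (by rw [hj]; simp; omega))
        simp only [h2, Finset.prod_mul_distrib, Finset.prod_ite_eq', Finset.mem_univ, if_true]
      · rw [mul_zero]

/-- The face weights as series. -/
noncomputable def zF (m k : ℕ) : FSeries m := faceWeight (fun i => X (.z i)) k

/-- The face weights as series without `u`. -/
noncomputable def zG (m k : ℕ) : GSeries m := faceWeight (fun i => X (.z i)) k

theorem ι_zG (k : ℕ) : ι (zG m k) = zF m k := by
  unfold zG zF faceWeight
  split_ifs
  · exact ι_X_z _
  · exact map_zero _

/-- The contribution of the inner faces of a map. -/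
noncomputable def innerWeight (m : ℕ) (M : RootedPlanarMap) : GSeries m :=
  (M.innerDegrees.map fun d => zG m (d - 1)).prod

/-- The contribution of a map to `F`. -/
noncomputable def weightF (m : ℕ) (M : RootedPlanarMap) : FSeries m :=
  X .u ^ M.outerDegree * ι (X .t ^ M.edges * innerWeight m M)

theorem map_prod_faceWeight_eq (z : ℕ → ℕ) {s : Multiset ℕ}
    (hs : ∀ d ∈ s, 0 < d) (hz : ∀ i, s.count i = z i) {σ : Type*} (v : Fin m → σ)
    [Decidable (∀ i, m < i → z i = 0)] :
    (s.map fun d => faceWeight (fun i => (X (v i) : MvPowerSeries σ ℚ)) (d - 1)).prod =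
      if ∀ i, m < i → z i = 0 then
        monomial (∑ i : Fin m, Finsupp.single (v i) (z (i + 1 : ℕ))) 1 else 0 := by
  classical
  rw [prod_faceWeight _ _ hs]
  simp only [hz, X_pow_eq]
  rw [prod_monomial, Finset.prod_const_one]

theorem weightF_eq (M : RootedPlanarMap) [Decidable (∀ i, m < i → M.finiteFaceCount i = 0)] :
    weightF m M = if ∀ i, m < i → M.finiteFaceCount i = 0 then monomial (M.fWeight m) 1 else 0 := by
  have h1 : ι (innerWeight m M) = if ∀ i, m < i → M.finiteFaceCount i = 0 then
      monomial (∑ i : Fin m, Finsupp.single (.z i) (M.finiteFaceCount (i + 1))) 1 else 0 := by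
    rw [← map_prod_faceWeight_eq _ (fun d => M.pos_of_mem_innerDegrees)
      fun i => M.count_innerDegrees i, innerWeight, map_multiset_prod, Multiset.map_map]
    congr 1
    exact Multiset.map_congr rfl fun d _ => ι_zG _
  rw [weightF, map_mul, map_pow, ι_X_t, h1, mul_ite, mul_ite]
  simp only [X_pow_eq, monomial_mul_monomial, mul_zero, RootedPlanarMap.fWeight, mul_one]
  congr 3
  abel

/-- The contribution of a map to `G`. -/
noncomputable def weightG (m : ℕ) (M : RootedPlanarMap) : GSeries m :=
  open Classical in if ∀ i, m < i → M.faceCount i = 0 then monomial (M.gWeight m) 1 else 0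

theorem weightG_vertex : weightG m .vertex = 1 := by
  have h : ∀ i, m < i → RootedPlanarMap.vertex.faceCount i = 0 := by
    intro i hi
    simp only [RootedPlanarMap.faceCount]
    rw [if_neg (by omega)]
  rw [weightG, if_pos h, RootedPlanarMap.gWeight]
  simp [RootedPlanarMap.faceCount, RootedPlanarMap.edges]

/-- Away from the vertex map the infinite face has positive degree, so it can be weighted like a
finite one. -/
theorem weightG_of_ne {M : RootedPlanarMap} (hM : M ≠ .vertex) :
    weightG m M = zG m (M.outerDegree - 1) * (X .t ^ M.edges * innerWeight m M) := by
  classical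
  have h0 : 0 < M.outerDegree :=
    Nat.pos_of_ne_zero fun h => hM (M.outerDegree_eq_zero_iff.1 h)
  have h1 := map_prod_faceWeight_eq (m := m) M.faceCount (s := M.outerDegree ::ₘ M.innerDegrees)
    (by
      intro d hd
      rcases Multiset.mem_cons.1 hd with rfl | hd
      · exact h0
      · exact M.pos_of_mem_innerDegrees hd)
    (fun i => by rw [Multiset.count_cons, M.count_innerDegrees, M.faceCount_eq_add])
    GVar.z
  rw [Multiset.map_cons, Multiset.prod_cons] at h1
  change zG m (M.outerDegree - 1) * innerWeight m M = _ at h1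
  rw [mul_left_comm, h1, weightG, mul_ite, mul_zero, X_pow_eq, monomial_mul_monomial, one_mul]
  congr

section counting

theorem fWeight_t (M : RootedPlanarMap) : M.fWeight m .t = M.edges := by
  simp [RootedPlanarMap.fWeight]

theorem gWeight_t (M : RootedPlanarMap) : M.gWeight m .t = M.edges := by
  simp [RootedPlanarMap.gWeight]

/-- The maps with `n` edges. -/
noncomputable def mapsWithEdges (n : ℕ) : Finset RootedPlanarMap :=
  (RootedPlanarMap.finite_edges_eq n).toFinset

@[simp] theorem mem_mapsWithEdges {n : ℕ} {M : RootedPlanarMap} :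
    M ∈ mapsWithEdges n ↔ M.edges = n := by
  simp [mapsWithEdges]

/-- A series that counts maps, and the sum of the contributions of the maps with few edges. -/
theorem X_pow_dvd_count_sub {σ : Type*} (t : σ) (p : RootedPlanarMap → Prop)
    (w : RootedPlanarMap → σ →₀ ℕ) (hw : ∀ M, w M t = M.edges)
    (W : RootedPlanarMap → MvPowerSeries σ ℚ)
    (hW : ∀ M, W M = open Classical in if p M then monomial (w M) 1 else 0) (N : ℕ) :
    X t ^ N ∣ (show MvPowerSeries σ ℚ from fun e => (Nat.card {M // p M ∧ w M = e} : ℚ)) -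
      ∑ n ∈ Finset.range N, ∑ M ∈ mapsWithEdges n, W M := by
  classical
  rw [X_pow_dvd_iff]
  intro e he
  have h0 : ∀ M, coeff e (W M) = if p M ∧ w M = e then 1 else 0 := by
    intro M
    rw [hW]
    by_cases h : p M <;> simp [h, coeff_monomial, eq_comm]
  have h1 : ∀ n, coeff e (∑ M ∈ mapsWithEdges n, W M) =
      (((mapsWithEdges n).filter fun M => p M ∧ w M = e).card : ℚ) := by
    intro n
    rw [map_sum]
    simp only [h0, Finset.sum_boole]
  have h2 : ∀ n, n ≠ e t → coeff e (∑ M ∈ mapsWithEdges n, W M) = 0 := by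
    intro n hn
    rw [h1, Nat.cast_eq_zero, Finset.card_eq_zero, Finset.filter_eq_empty_iff]
    rintro M hM ⟨-, rfl⟩
    exact hn (by rw [hw, ← mem_mapsWithEdges.1 hM])
  rw [map_sub, map_sum, Finset.sum_eq_single (e t) (fun n _ hn => h2 n hn)
    (fun h => absurd (Finset.mem_range.2 he) h), h1, sub_eq_zero]
  change (Nat.card {M // p M ∧ w M = e} : ℚ) = _
  congr 1
  rw [← Nat.card_eq_finsetCard]
  refine Nat.card_congr (Equiv.subtypeEquivRight fun M => ?_)
  rw [Finset.mem_filter, mem_mapsWithEdges]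
  exact ⟨fun h => ⟨by rw [← h.2, hw], h⟩, fun h => h.2⟩

/-- The part of `F` of degree `n` in `t`. -/
noncomputable def sliceF (m n : ℕ) : FSeries m := ∑ M ∈ mapsWithEdges n, weightF m M

theorem X_pow_dvd_finiteFaceGF_sub (m N : ℕ) :
    X .t ^ N ∣ finiteFaceGF m - ∑ n ∈ Finset.range N, sliceF m n := by
  classical
  exact X_pow_dvd_count_sub FVar.t _ _ fWeight_t (weightF m) (fun M => weightF_eq M) N

theorem X_pow_dvd_allFaceGF_sub (m N : ℕ) :
    X .t ^ N ∣ allFaceGF m - ∑ n ∈ Finset.range N, ∑ M ∈ mapsWithEdges n, weightG m M :=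
  X_pow_dvd_count_sub GVar.t _ _ gWeight_t (weightG m) (fun _ => rfl) N

end counting

end MapSeries

namespace RootedPlanarMap

theorem edges_eq_zero_iff : ∀ M : RootedPlanarMap, M.edges = 0 ↔ M = vertex
  | vertex => by simp [edges]
  | ofEdges n q => by
    simp only [edges, reduceCtorEq, iff_false]
    rintro rfl
    exact (Quotient.out q).root.elim0

end RootedPlanarMap

/-! ### Tutte's equation for F, and G in terms of F. -/

namespace MapSeries

open RootedPlanarMap

variable {m : ℕ}

theorem innerDegrees_vertex : RootedPlanarMap.vertex.innerDegrees = 0 := Stub.innerSizes_unit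

theorem weightF_vertex : weightF m .vertex = 1 := by
  simp [weightF, innerWeight, innerDegrees_vertex, RootedPlanarMap.outerDegree,
    RootedPlanarMap.edges]

theorem sliceF_zero : sliceF m 0 = 1 := by
  have : mapsWithEdges 0 = {.vertex} := by
    ext M
    rw [mem_mapsWithEdges, edges_eq_zero_iff, Finset.mem_singleton]
  rw [sliceF, this, Finset.sum_singleton, weightF_vertex]

theorem weightF_bridge (M N : RootedPlanarMap) :
    weightF m (M.bridge N) = X .t * (X .u ^ 2 * (weightF m M * weightF m N)) := by
  obtain ⟨h1, h2, h3⟩ := stats_bridge M N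
  simp only [weightF, innerWeight, h1, h2, h3, Multiset.map_add, Multiset.prod_add, map_mul,
    map_pow, ι_X_t]
  ring

/-- The outer degree drops by `k`, which is the effect of `Δ ^ k` on a power of u, and then grows by
one for the new edge. -/
theorem weightF_addEdge (M : RootedPlanarMap) (k : Fin (M.outerDegree + 1)) :
    weightF m (M.addEdge k) = X .t * (X .u * (zF m k * (Δ ^ (k : ℕ)) (weightF m M))) := by
  obtain ⟨h1, h2, h3⟩ := stats_addEdge M k
  have hk : (k : ℕ) ≤ M.outerDegree := Nat.lt_succ_iff.1 k.2
  simp only [weightF, innerWeight, h1, h2, h3, Multiset.map_cons, Multiset.prod_cons, map_mul,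
    map_pow, ι_X_t, Nat.add_sub_cancel, ι_zG, Δ_pow_X_u_pow_mul_of_le hk]
  ring

/-- The range of `k` can be made independent of `M`: the weights vanish from `m` on, and `Δ ^ k`
kills the term when `k` exceeds the outer degree. -/
theorem sum_weightF_addEdge (M : RootedPlanarMap) :
    ∑ k : Fin (M.outerDegree + 1), weightF m (M.addEdge k) =
      X .t * (X .u * ∑ k ∈ Finset.range m, zF m k * (Δ ^ k) (weightF m M)) := by
  simp only [weightF_addEdge]
  rw [Fin.sum_univ_eq_sum_range
    (fun k => X FVar.t * (X FVar.u * (zF m k * (Δ ^ k) (weightF m M)))), ← Finset.mul_sum,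
    ← Finset.mul_sum]
  congr 2
  have h1 : ∀ k, m ≤ k → zF m k * (Δ ^ k) (weightF m M) = 0 := fun k hk => by
    rw [zF, faceWeight, dif_neg (by omega), zero_mul]
  have h2 : ∀ k, M.outerDegree + 1 ≤ k → zF m k * (Δ ^ k) (weightF m M) = 0 := fun k hk => by
    rw [weightF, Δ_pow_X_u_pow_of_lt (by omega), mul_zero]
  rcases le_total m (M.outerDegree + 1) with h | h
  · refine (Finset.sum_subset (Finset.range_mono h) fun k _ hk => h1 k ?_).symm
    simpa using hk
  · refine Finset.sum_subset (Finset.range_mono h) fun k _ hk => h2 k ?_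
    simpa using hk

/-- `compose_bijective`, restricted to maps with `n + 1` edges: two maps with `n` edges in total, or
one map with `n` edges and a new face. -/
theorem sliceF_succ (n : ℕ) : sliceF m (n + 1) =
    X .t * (X .u ^ 2 * ∑ p ∈ Finset.HasAntidiagonal.antidiagonal n, sliceF m p.1 * sliceF m p.2 +
      X .u * ∑ k ∈ Finset.range m, zF m k * (Δ ^ k) (sliceF m n)) := by
  classical
  let P : Finset (Σ _ : ℕ × ℕ, RootedPlanarMap × RootedPlanarMap) :=
    (Finset.HasAntidiagonal.antidiagonal n).sigma fun p => mapsWithEdges p.1 ×ˢ mapsWithEdges p.2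
  let Q : Finset (Σ M : RootedPlanarMap, Fin (M.outerDegree + 1)) :=
    (mapsWithEdges n).sigma fun _ => Finset.univ
  let i : (Σ _ : ℕ × ℕ, RootedPlanarMap × RootedPlanarMap) ⊕
      (Σ M : RootedPlanarMap, Fin (M.outerDegree + 1)) → RootedPlanarMap :=
    fun x => compose (some (x.map Sigma.snd id))
  have hP : ∀ p, p ∈ P ↔ p.1.1 + p.1.2 = n ∧ p.2.1.edges = p.1.1 ∧ p.2.2.edges = p.1.2 := by
    intro p
    simp [P]
  have hQ : ∀ q, q ∈ Q ↔ q.1.edges = n := by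
    intro q
    simp [Q]
  have h : ∑ x ∈ P.disjSum Q, weightF m (i x) = ∑ M ∈ mapsWithEdges (n + 1), weightF m M := by
    refine Finset.sum_nbij i ?_ ?_ ?_ fun _ _ => rfl
    · rintro (p | q) hx
      · rw [Finset.inl_mem_disjSum, hP] at hx
        rw [mem_mapsWithEdges]
        change (p.2.1.bridge p.2.2).edges = _
        rw [(stats_bridge _ _).1]
        omega
      · rw [Finset.inr_mem_disjSum, hQ] at hx
        rw [mem_mapsWithEdges]
        change (q.1.addEdge q.2).edges = _
        rw [(stats_addEdge _ _).1]
        omega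
    · intro x hx y hy hxy
      have h1 := Option.some.inj (compose_bijective.1 hxy)
      rcases x with p | q <;> rcases y with p' | q'
      · rw [Finset.mem_coe, Finset.inl_mem_disjSum, hP] at hx hy
        have h2 : p.2 = p'.2 := Sum.inl_injective h1
        obtain ⟨⟨a, b⟩, p⟩ := p
        obtain ⟨⟨a', b'⟩, p'⟩ := p'
        simp only at h2 hx hy
        subst h2
        rw [← hx.2.1, ← hx.2.2, ← hy.2.1, ← hy.2.2]
      · simp at h1
      · simp at h1
      · exact congrArg _ (Sum.inr_injective h1)
    · intro M hM
      rw [Finset.mem_coe, mem_mapsWithEdges] at hM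
      obtain ⟨x, hx⟩ := compose_bijective.2 M
      rcases x with _ | p | q
      · have h1 : RootedPlanarMap.vertex = M := hx
        rw [← h1] at hM
        exact absurd hM (by simp [RootedPlanarMap.edges])
      · refine ⟨.inl ⟨(p.1.edges, p.2.edges), p⟩, ?_, hx⟩
        rw [Finset.mem_coe, Finset.inl_mem_disjSum, hP]
        have h1 : p.1.bridge p.2 = M := hx
        rw [← h1, (stats_bridge _ _).1] at hM
        exact ⟨by simpa using hM, rfl, rfl⟩
      · refine ⟨.inr q, ?_, hx⟩
        rw [Finset.mem_coe, Finset.inr_mem_disjSum, hQ]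
        have h1 : q.1.addEdge q.2 = M := hx
        rw [← h1, (stats_addEdge _ _).1] at hM
        omega
  rw [sliceF, ← h, Finset.sum_disjSum, mul_add]
  congr 1
  · have h1 : ∀ p, weightF m (i (.inl p)) =
        X .t * (X .u ^ 2 * (weightF m p.2.1 * weightF m p.2.2)) := fun p => weightF_bridge _ _
    simp only [h1]
    rw [← Finset.mul_sum, ← Finset.mul_sum, Finset.sum_sigma]
    congr 2
    refine Finset.sum_congr rfl fun p _ => ?_
    rw [Finset.sum_product, sliceF, sliceF, Finset.sum_mul_sum]
  · have h1 : ∀ q, weightF m (i (.inr q)) = weightF m (q.1.addEdge q.2) := fun q => rfl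
    simp only [h1]
    rw [Finset.sum_sigma]
    simp only [sum_weightF_addEdge]
    rw [← Finset.mul_sum, ← Finset.mul_sum, Finset.sum_comm]
    congr 2
    refine Finset.sum_congr rfl fun k _ => ?_
    rw [← Finset.mul_sum, sliceF, map_sum]

/-- The right-hand side of Tutte's equation. -/
noncomputable def tutte (f : FSeries m) : FSeries m :=
  1 + X .t * (X .u ^ 2 * f ^ 2 + X .u * ∑ k ∈ Finset.range m, zF m k * (Δ ^ k) f)

theorem dvd_sum_Δ {n : ℕ} {f : FSeries m} (h : X .t ^ n ∣ f) :
    X .t ^ n ∣ ∑ k ∈ Finset.range m, zF m k * (Δ ^ k) f :=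
  Finset.dvd_sum fun k _ => (dvd_Δ_pow h k).mul_left _

/-- The prefactor t gives the gain of one power, since `Δ` is linear over series without u and so
preserves divisibility by powers of t. -/
theorem dvd_tutte_sub {n : ℕ} {f g : FSeries m} (h : X .t ^ n ∣ f - g) :
    X .t ^ (n + 1) ∣ tutte f - tutte g := by
  have h1 := dvd_sum_Δ h
  simp only [map_sub, mul_sub, Finset.sum_sub_distrib] at h1
  have h2 : X .t ^ n ∣ f ^ 2 - g ^ 2 := h.trans (sub_dvd_pow_sub_pow f g 2)
  have h3 : tutte f - tutte g = X .t * (X .u ^ 2 * (f ^ 2 - g ^ 2) +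
      X .u * (∑ k ∈ Finset.range m, zF m k * (Δ ^ k) f -
        ∑ k ∈ Finset.range m, zF m k * (Δ ^ k) g)) := by
    unfold tutte; ring
  rw [h3, pow_succ']
  exact mul_dvd_mul_left _ (dvd_add (h2.mul_left _) (h1.mul_left _))

theorem X_pow_dvd_sliceF (n : ℕ) : X .t ^ n ∣ sliceF m n := by
  refine Finset.dvd_sum fun M hM => ?_
  rw [mem_mapsWithEdges] at hM
  rw [weightF, map_mul, map_pow, ι_X_t, hM]
  exact (Dvd.intro _ rfl).mul_left _

/-- The difference consists of the products of slices of total degree at least `N` in t. -/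
theorem sum_sliceF_sq (N : ℕ) : X .t ^ N ∣ (∑ n ∈ Finset.range N, sliceF m n) ^ 2 -
    ∑ n ∈ Finset.range N, ∑ p ∈ Finset.HasAntidiagonal.antidiagonal n, sliceF m p.1 * sliceF m p.2 := by
  classical
  rw [sq, Finset.sum_mul_sum, ← Finset.sum_product', Finset.sum_sigma']
  set T : Finset (ℕ × ℕ) := Finset.range N ×ˢ Finset.range N
  have h1 : ∑ x ∈ (Finset.range N).sigma (fun n => Finset.HasAntidiagonal.antidiagonal n),
      sliceF m x.2.1 * sliceF m x.2.2 =
      ∑ p ∈ T.filter (fun p => p.1 + p.2 < N), sliceF m p.1 * sliceF m p.2 := by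
    refine Finset.sum_nbij' (fun x => x.2) (fun p => ⟨p.1 + p.2, p⟩) ?_ ?_ ?_ ?_ ?_
    · rintro ⟨n, a, b⟩ h
      simp only [Finset.mem_sigma, Finset.mem_range, Finset.HasAntidiagonal.mem_antidiagonal] at h
      simp only [T, Finset.mem_filter, Finset.mem_product, Finset.mem_range]
      omega
    · rintro ⟨a, b⟩ h
      simp only [T, Finset.mem_filter, Finset.mem_product, Finset.mem_range] at h
      simp [h.2]
    · rintro ⟨n, a, b⟩ h
      simp only [Finset.mem_sigma, Finset.mem_range, Finset.HasAntidiagonal.mem_antidiagonal] at h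
      simp [h.2]
    · rintro ⟨a, b⟩ _; rfl
    · rintro ⟨n, a, b⟩ _; rfl
  rw [h1, ← Finset.sum_filter_add_sum_filter_not T (fun p => p.1 + p.2 < N), add_sub_cancel_left]
  refine Finset.dvd_sum fun p hp => ?_
  have hp2 := (Finset.mem_filter.1 hp).2
  refine (pow_dvd_pow _ (not_lt.1 hp2)).trans ?_
  rw [pow_add]
  exact mul_dvd_mul (X_pow_dvd_sliceF _) (X_pow_dvd_sliceF _)

/-- Tutte's equation. -/
theorem tutte_finiteFaceGF (m : ℕ) : tutte (finiteFaceGF m) = finiteFaceGF m := by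
  refine eq_of_forall_X_pow_dvd_sub (s := FVar.t) fun N => ?_
  set P : FSeries m := ∑ n ∈ Finset.range N, sliceF m n with hP
  have h1 := dvd_tutte_sub (X_pow_dvd_finiteFaceGF_sub m N)
  have h2 := X_pow_dvd_finiteFaceGF_sub m (N + 1)
  -- The recursion for the slices, summed up: the partial sums satisfy Tutte's equation to the order
  -- required.
  have h3 : X .t ^ (N + 1) ∣ tutte P - ∑ n ∈ Finset.range (N + 1), sliceF m n := by
    rw [Finset.sum_range_succ', sliceF_zero]
    simp only [sliceF_succ]
    rw [← Finset.mul_sum, Finset.sum_add_distrib, ← Finset.mul_sum, ← Finset.mul_sum,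
      Finset.sum_comm]
    have h4 : ∀ k, ∑ n ∈ Finset.range N, zF m k * (Δ ^ k) (sliceF m n) =
        zF m k * (Δ ^ k) P := fun k => by rw [← Finset.mul_sum, hP, map_sum]
    simp only [h4]
    have h5 := sum_sliceF_sq (m := m) N
    rw [← hP] at h5
    obtain ⟨c, hc⟩ := h5
    refine ⟨X .u ^ 2 * c, ?_⟩
    rw [tutte, pow_succ']
    linear_combination X FVar.t * X FVar.u ^ 2 * hc
  rw [← hP] at h1
  refine (pow_dvd_pow _ (Nat.le_succ N)).trans ?_
  have := dvd_sub (dvd_add h1 h3) h2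
  convert this using 1
  ring

/-- `ε` after `Δ ^ (k + 1)` extracts the coefficient of u^{k+1}, that is, the maps of outer degree
`k + 1`, whose infinite face then receives its weight. The vertex map has outer degree 0 and is
missed by the sum. -/
theorem weightG_eq (M : RootedPlanarMap) [Decidable (M = .vertex)] : weightG m M =
    (if M = .vertex then 1 else 0) +
      ∑ k ∈ Finset.range m, zG m k * ε ((Δ ^ (k + 1)) (weightF m M)) := by
  have h1 : ∀ k, ε ((Δ ^ (k + 1)) (weightF m M)) =
      if k + 1 = M.outerDegree then X .t ^ M.edges * innerWeight m M else 0 := by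
    intro k
    rw [weightF]
    rcases lt_trichotomy (k + 1) M.outerDegree with h | h | h
    · rw [if_neg h.ne, Δ_pow_X_u_pow_mul_of_le h.le, map_mul, map_pow, ε_X_u,
        zero_pow (by omega), zero_mul]
    · rw [if_pos h, ← h, Δ_pow_X_u_pow_mul, ε_ι]
    · rw [if_neg h.ne', Δ_pow_X_u_pow_of_lt h, map_zero]
  simp only [h1, mul_ite, mul_zero]
  by_cases hM : M = .vertex
  · subst hM
    rw [weightG_vertex, if_pos rfl, Finset.sum_eq_zero, add_zero]
    intro k _
    rw [if_neg (by simp [RootedPlanarMap.outerDegree])]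
  · have h0 : 0 < M.outerDegree :=
      Nat.pos_of_ne_zero fun h => hM (M.outerDegree_eq_zero_iff.1 h)
    rw [weightG_of_ne hM, if_neg hM, zero_add]
    by_cases h2 : M.outerDegree - 1 < m
    · rw [Finset.sum_eq_single (M.outerDegree - 1), if_pos (by omega)]
      · intro k _ hk
        rw [if_neg (by omega)]
      · intro h; simp at h; omega
    · rw [zG, faceWeight, dif_neg h2, zero_mul, Finset.sum_eq_zero]
      intro k hk
      rw [Finset.mem_range] at hk
      rw [if_neg (by omega)]

theorem allFaceGF_eq (m : ℕ) : allFaceGF m =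
    1 + ∑ k ∈ Finset.range m, zG m k * ε ((Δ ^ (k + 1)) (finiteFaceGF m)) := by
  classical
  refine eq_of_forall_X_pow_dvd_sub (s := GVar.t) fun N => ?_
  refine (pow_dvd_pow _ (Nat.le_succ N)).trans ?_
  have h1 := X_pow_dvd_allFaceGF_sub m (N + 1)
  set P : FSeries m := ∑ n ∈ Finset.range (N + 1), sliceF m n with hP
  have h2 : ∑ n ∈ Finset.range (N + 1), ∑ M ∈ mapsWithEdges n, weightG m M =
      1 + ∑ k ∈ Finset.range m, zG m k * ε ((Δ ^ (k + 1)) P) := by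
    simp only [weightG_eq, Finset.sum_add_distrib]
    congr 1
    · rw [Finset.sum_eq_single 0]
      · simp [RootedPlanarMap.edges]
      · intro n _ hn
        refine Finset.sum_eq_zero fun M hM => if_neg ?_
        rintro rfl
        exact hn (mem_mapsWithEdges.1 hM).symm
      · simp
    · have h3 : ∀ n, ∑ M ∈ mapsWithEdges n, ∑ k ∈ Finset.range m,
          zG m k * ε ((Δ ^ (k + 1)) (weightF m M)) =
          ∑ k ∈ Finset.range m, zG m k * ε ((Δ ^ (k + 1)) (sliceF m n)) := by
        intro n
        rw [Finset.sum_comm]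
        refine Finset.sum_congr rfl fun k _ => ?_
        rw [← Finset.mul_sum, sliceF, map_sum, map_sum]
      simp only [h3]
      rw [Finset.sum_comm]
      refine Finset.sum_congr rfl fun k _ => ?_
      rw [← Finset.mul_sum, hP, map_sum, map_sum]
  rw [h2] at h1
  have h4 : X .t ^ (N + 1) ∣ (1 + ∑ k ∈ Finset.range m, zG m k * ε ((Δ ^ (k + 1)) P)) -
      (1 + ∑ k ∈ Finset.range m, zG m k * ε ((Δ ^ (k + 1)) (finiteFaceGF m))) := by
    rw [add_sub_add_left_eq_sub, ← Finset.sum_sub_distrib]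
    refine Finset.dvd_sum fun k _ => ?_
    rw [← mul_sub, ← map_sub, ← map_sub]
    refine Dvd.dvd.mul_left ?_ _
    obtain ⟨c, hc⟩ := dvd_Δ_pow ((dvd_sub_comm).1 (X_pow_dvd_finiteFaceGF_sub m (N + 1))) (k + 1)
    rw [hc, map_mul, map_pow, ε_X_t]
    exact Dvd.intro _ rfl
  have := dvd_add h1 h4
  rwa [sub_add_sub_cancel] at this

end MapSeries

end Series

/-! ### The parametrization by x + s + r/x. -/

section Laurent

open Polynomial

variable {A B : Type*} [CommRing A] [CommRing B] {m : ℕ}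

/-- The pair `(a, p)` such that `(x + s + y) ^ n = a + x p(x) + y p(y)` whenever `x y = r`. -/
noncomputable def laurentPow (r s : A) : ℕ → A × A[X]
  | 0 => (1, 0)
  | n + 1 => (s * (laurentPow r s n).1 + 2 * r * (laurentPow r s n).2.coeff 0,
      C (laurentPow r s n).1 + X * (laurentPow r s n).2 + C s * (laurentPow r s n).2 +
        C r * divX (laurentPow r s n).2)

/-- Naturality serves three purposes: quotient maps give congruences, subring inclusions give
membership, and `φ` allows evaluation in a larger ring. -/
theorem laurentPow_map (f : A →+* B) (r s : A) (n : ℕ) :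
    laurentPow (f r) (f s) n = (f (laurentPow r s n).1, (laurentPow r s n).2.map f) := by
  have h : ∀ p : A[X], divX (p.map f) = (divX p).map f := fun p => by ext; simp
  induction n with
  | zero => simp [laurentPow]
  | succ n ih => simp [laurentPow, ih, h, map_ofNat]

theorem eval_eq_divX (p : A[X]) (x : A) : p.eval x = (divX p).eval x * x + p.coeff 0 := by
  conv_lhs => rw [← divX_mul_X_add p]
  simp

/-- The recursion is multiplication by x + s + y. The mixed term y · x p(x) = r p(x) contributes r
p(0) and x · r (p(x) - p(0))/x, and symmetrically for y; this explains the factor 2. -/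
theorem add_add_pow_eq_laurentPow {r s x y : A} (h : x * y = r) (n : ℕ) :
    (x + s + y) ^ n = (laurentPow r s n).1 + x * (laurentPow r s n).2.eval x +
      y * (laurentPow r s n).2.eval y := by
  induction n with
  | zero => simp [laurentPow]
  | succ n ih =>
    rw [pow_succ, ih]
    simp only [laurentPow, eval_add, eval_mul, eval_C, eval_X]
    have hx := eval_eq_divX (laurentPow r s n).2 x
    have hy := eval_eq_divX (laurentPow r s n).2 y
    rw [← h] at *
    linear_combination x * y * hx + x * y * hy

theorem laurentPow_mem {S : Type*} [SetLike S A] [SubringClass S A] (C' : S) {r s : A}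
    (hr : r ∈ C') (hs : s ∈ C') (n : ℕ) :
    (laurentPow r s n).1 ∈ C' ∧ ∀ k, (laurentPow r s n).2.coeff k ∈ C' := by
  have h := laurentPow_map (SubringClass.subtype C') ⟨r, hr⟩ ⟨s, hs⟩ n
  simp only [SubringClass.subtype_apply] at h
  rw [h]
  exact ⟨Subtype.prop _, fun k => by simp⟩

/-- Writing v = x + s + y, both x and y are roots of w² - (v - s) w + r. Reduction modulo this
quadratic gives the same linear remainder for both. -/
theorem exists_reduce_eval (φ : B →+* A) {r s : B} {x y : A} (h : x * y = φ r) (p : B[X]) :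
    ∃ a b : B[X], p.eval₂ φ x = a.eval₂ φ (x + φ s + y) * x + b.eval₂ φ (x + φ s + y) ∧
      p.eval₂ φ y = a.eval₂ φ (x + φ s + y) * y + b.eval₂ φ (x + φ s + y) := by
  induction p using Polynomial.induction_on' with
  | add p q hp hq =>
    obtain ⟨a, b, h1, h2⟩ := hp
    obtain ⟨a', b', h3, h4⟩ := hq
    refine ⟨a + a', b + b', ?_, ?_⟩ <;> simp only [eval₂_add, h1, h2, h3, h4] <;> ring
  | monomial n c =>
    induction n with
    | zero => exact ⟨0, C c, by simp, by simp⟩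
    | succ n ih =>
      obtain ⟨a, b, h1, h2⟩ := ih
      refine ⟨a * (X - C s) + b, - (a * C r), ?_, ?_⟩
      · rw [← monomial_mul_X, eval₂_mul_X, h1]
        simp only [eval₂_add, eval₂_mul, eval₂_sub, eval₂_neg, eval₂_X, eval₂_C, ← h]
        ring
      · rw [← monomial_mul_X, eval₂_mul_X, h2]
        simp only [eval₂_add, eval₂_mul, eval₂_sub, eval₂_neg, eval₂_X, eval₂_C, ← h]
        ring

/-- The product is the norm of the linear remainder, hence symmetric in the two roots. -/
theorem exists_eval_mul_eval (φ : B →+* A) {r : B} (s : B) {x y : A} (h : x * y = φ r)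
    (p : B[X]) : ∃ q : B[X], p.eval₂ φ x * p.eval₂ φ y = q.eval₂ φ (x + φ s + y) := by
  obtain ⟨a, b, h1, h2⟩ := exists_reduce_eval φ (s := s) h p
  refine ⟨a ^ 2 * C r + a * b * (X - C s) + b ^ 2, ?_⟩
  rw [h1, h2]
  simp only [eval₂_add, eval₂_mul, eval₂_sub, eval₂_pow, eval₂_X, eval₂_C, ← h]
  ring

/-- The constant part of `∑ z_{k+1} (x + s + y) ^ k`. -/
noncomputable def laurentConst (m : ℕ) (z : ℕ → A) (r s : A) : A :=
  ∑ k ∈ Finset.range m, z k * (laurentPow r s k).1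

/-- The positive part of `∑ z_{k+1} (x + s + y) ^ k`, divided by `x`. -/
noncomputable def laurentPos (m : ℕ) (z : ℕ → A) (r s : A) :
    A[X] :=
  ∑ k ∈ Finset.range m, C (z k) * (laurentPow r s k).2

theorem laurentConst_map (f : A →+* B) (z : ℕ → A)
    (r s : A) : laurentConst m (f ∘ z) (f r) (f s) = f (laurentConst m z r s) := by
  simp [laurentConst, laurentPow_map]

theorem laurentPos_map (f : A →+* B) (z : ℕ → A)
    (r s : A) : laurentPos m (f ∘ z) (f r) (f s) = (laurentPos m z r s).map f := by
  simp [laurentPos, laurentPow_map, Polynomial.map_sum]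

/-- The pairs agree modulo `d`, and the construction commutes with the passage to the quotient. -/
theorem dvd_laurent_sub (z : ℕ → A) {d r s r' s' : A}
    (hr : d ∣ r - r') (hs : d ∣ s - s') :
    d ∣ laurentConst m z r s - laurentConst m z r' s' ∧
      d ∣ (laurentPos m z r s).coeff 0 - (laurentPos m z r' s').coeff 0 := by
  simp only [← Ideal.mem_span_singleton, ← Ideal.Quotient.eq] at hr hs ⊢
  rw [← laurentConst_map, ← laurentConst_map, ← Polynomial.coeff_map, ← Polynomial.coeff_map,
    ← laurentPos_map, ← laurentPos_map, hr, hs]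
  exact ⟨rfl, rfl⟩

/-- The factor by which `z` splits off `x - t ∑ z_{k+1} x ^ k` in the parametrization
`x = z + s + r / z`. -/
noncomputable def laurentFactor (m : ℕ) (t : A) (z : ℕ → A) (r s : A) : A[X] :=
  1 - C t * laurentPos m z r s

/-- The condition on `s` cancels the constant part; the remaining parts are attached to `x` and to
`y` alone. -/
theorem sub_sum_eq_laurentFactor (φ : B →+* A) {t r s : B} {z : ℕ → B}
    (hs : s = t * laurentConst m z r s) {x y : A} (h : x * y = φ r) :
    x + φ s + y - φ t * ∑ k ∈ Finset.range m, φ (z k) * (x + φ s + y) ^ k =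
      x * (laurentFactor m t z r s).eval₂ φ x + y * (laurentFactor m t z r s).eval₂ φ y := by
  have h1 : ∀ w, (laurentFactor m t z r s).eval₂ φ w =
      1 - φ t * ∑ k ∈ Finset.range m, φ (z k) * (laurentPow r s k).2.eval₂ φ w := fun w => by
    simp [laurentFactor, laurentPos, eval₂_finsetSum]
  have h2 : φ s = φ t * ∑ k ∈ Finset.range m, φ (z k) * φ (laurentPow r s k).1 := by
    conv_lhs => rw [hs]
    simp [laurentConst]
  have h3 : ∑ k ∈ Finset.range m, φ (z k) * (x + φ s + y) ^ k =
      ∑ k ∈ Finset.range m, φ (z k) * φ (laurentPow r s k).1 +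
      x * ∑ k ∈ Finset.range m, φ (z k) * (laurentPow r s k).2.eval₂ φ x +
      y * ∑ k ∈ Finset.range m, φ (z k) * (laurentPow r s k).2.eval₂ φ y := by
    rw [Finset.mul_sum, Finset.mul_sum, ← Finset.sum_add_distrib, ← Finset.sum_add_distrib]
    refine Finset.sum_congr rfl fun k _ => ?_
    rw [add_add_pow_eq_laurentPow h, laurentPow_map, eval_map, eval_map]
    ring
  rw [h1, h1, h3]
  linear_combination h2

/-- The candidate for the solution of Tutte's equation, in terms of the parametrization. -/
noncomputable def parametrized (φ : B →+* A) (m : ℕ) (t : B) (z : ℕ → B) (r s : B) (y : A) : A :=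
  φ r * (1 + φ s * y + φ r * y ^ 2) * (laurentFactor m t z r s).eval₂ φ (φ r * y)

/-- Take 1/y and r y as the pair with product r and sum 1/u - s. The summand at r y is u times the
candidate, so the other summand is the remaining factor divided by u. The product of the two is r
times a symmetric expression, thus a polynomial in 1/u. -/
theorem exists_parametrized_eq {K : Type*} [Field K] (φ : B →+* K) {t r s : B} {z : ℕ → B}
    (hs : s = t * laurentConst m z r s) {u y : K} (hu : u ≠ 0)
    (hy : y = u * (1 + φ s * y + φ r * y ^ 2)) : ∃ q : B[X],
      parametrized φ m t z r s y * (1 - φ t * u * ∑ k ∈ Finset.range m, φ (z k) * u⁻¹ ^ k -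
        u ^ 2 * parametrized φ m t z r s y) = q.eval₂ φ u⁻¹ := by
  have hy0 : y ≠ 0 := by
    rintro rfl
    exact hu (by simpa using hy.symm)
  have h : y⁻¹ * (φ r * y) = φ r := by field_simp
  have hx : y⁻¹ + φ s + φ r * y = u⁻¹ := by
    field_simp
    linear_combination -hy
  obtain ⟨q, hq⟩ := exists_eval_mul_eval φ s h (laurentFactor m t z r s)
  have h1 := sub_sum_eq_laurentFactor φ hs h
  rw [hx] at hq h1
  refine ⟨C r * q, ?_⟩
  rw [eval₂_mul, eval₂_C, ← hq]
  have h2 : u * parametrized φ m t z r s y =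
      φ r * y * (laurentFactor m t z r s).eval₂ φ (φ r * y) := by
    rw [parametrized]
    linear_combination -(φ r * (laurentFactor m t z r s).eval₂ φ (φ r * y)) * hy
  have h3 : u⁻¹ * u = 1 := inv_mul_cancel₀ hu
  generalize parametrized φ m t z r s y = p at *
  generalize (laurentFactor m t z r s).eval₂ φ (φ r * y) = a at *
  generalize (laurentFactor m t z r s).eval₂ φ y⁻¹ = b at *
  generalize ∑ k ∈ Finset.range m, φ (z k) * u⁻¹ ^ k = c at *
  have h4 : u * p * (u⁻¹ - φ t * c - u * p) = φ r * (b * a) := by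
    rw [h2, h1]
    linear_combination a * b * h
  rw [← h4]
  linear_combination -p * h3

theorem exists_parametrized_eq_of_isDomain [IsDomain A] (φ : B →+* A) {t r s : B} {z : ℕ → B}
    (hs : s = t * laurentConst m z r s) {u y : A} (hu : u ≠ 0)
    (hy : y = u * (1 + φ s * y + φ r * y ^ 2)) : ∃ N, ∃ c : ℕ → B, m ≤ N ∧
      u ^ N * parametrized φ m t z r s y =
        φ t * ∑ k ∈ Finset.range m, φ (z k) * (u ^ (N + 1 - k) * parametrized φ m t z r s y) +
        u ^ (N + 2) * parametrized φ m t z r s y ^ 2 +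
        ∑ k ∈ Finset.range (N + 1), u ^ (N - k) * φ (c k) := by
  set K := FractionRing A
  set j := algebraMap A K
  have hj : Function.Injective j := IsFractionRing.injective A K
  have hu' : j u ≠ 0 := fun h => hu (hj (by rw [h, map_zero]))
  obtain ⟨q, hq⟩ := exists_parametrized_eq (m := m) (j.comp φ) (u := j u) (y := j y) hs hu' (by
    conv_lhs => rw [hy]
    simp)
  have hp : parametrized (j.comp φ) m t z r s (j y) = j (parametrized φ m t z r s y) := by
    simp [parametrized, hom_eval₂]
  rw [hp] at hq
  -- Multiplying by u^N with `N` at least `m` and the degree of `q` clears all negative powers of u.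
  refine ⟨max m q.natDegree, q.coeff, le_max_left _ _, hj ?_⟩
  have hm : m ≤ max m q.natDegree := le_max_left _ _
  have hd : q.natDegree < max m q.natDegree + 1 := Nat.lt_succ_of_le (le_max_right _ _)
  generalize max m q.natDegree = N at hm hd
  rw [eval₂_eq_sum_range' _ hd] at hq
  have h1 : ∀ k ≤ N, j u ^ (N - k) = j u ^ N * (j u)⁻¹ ^ k := fun k hk => by
    rw [inv_pow, pow_sub₀ _ hu' hk]
  have h2 : ∑ k ∈ Finset.range m, j (φ (z k)) * (j u ^ (N + 1 - k) *
      j (parametrized φ m t z r s y)) = j u ^ (N + 1) *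
      j (parametrized φ m t z r s y) * ∑ k ∈ Finset.range m, j (φ (z k)) * (j u)⁻¹ ^ k := by
    rw [Finset.mul_sum]
    refine Finset.sum_congr rfl fun k hk => ?_
    have := Finset.mem_range.1 hk
    rw [inv_pow, pow_sub₀ _ hu' (by omega)]
    ring
  have h3 : ∑ k ∈ Finset.range (N + 1), j u ^ (N - k) * j (φ (q.coeff k)) =
      j u ^ N * ∑ k ∈ Finset.range (N + 1), j (φ (q.coeff k)) * (j u)⁻¹ ^ k := by
    rw [Finset.mul_sum]
    refine Finset.sum_congr rfl fun k hk => ?_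
    rw [h1 k (Nat.lt_succ_iff.1 (Finset.mem_range.1 hk))]
    ring
  simp only [map_add, map_mul, map_sum, map_pow, h2, h3]
  simp only [RingHom.comp_apply] at hq
  rw [← hq]
  ring

end Laurent

/-! ### The explicit solution of Tutte's equation. -/

section Series

open MvPowerSeries

namespace MapSeries

variable {m : ℕ}

/-- Every occurrence of the unknowns carries a factor t, so the system is a t-adic contraction;
`true` indexes `R` and `false` indexes `S`. -/
theorem exists_RS (m : ℕ) : ∃ R S : GSeries m,
    R = X .t + X .t * R * (laurentPos m (zG m) R S).coeff 0 ∧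
      S = X .t * laurentConst m (zG m) R S := by
  obtain ⟨f, hf⟩ := exists_fixedPoint (s := GVar.t) (κ := Bool) (R := ℚ)
    (fun f : Bool → GSeries m => fun b => bif b then
      X .t + X .t * f true * (laurentPos m (zG m) (f true) (f false)).coeff 0
      else X .t * laurentConst m (zG m) (f true) (f false)) (by
    intro n f g h b
    obtain ⟨h1, h2⟩ := dvd_laurent_sub (m := m) (zG m) (h true) (h false)
    rw [pow_succ']
    cases b
    · simp only [cond_false, ← mul_sub]
      exact mul_dvd_mul_left _ h1
    · simp only [cond_true, add_sub_add_left_eq_sub, mul_assoc, ← mul_sub]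
      refine mul_dvd_mul_left _ ?_
      have := dvd_add (h2.mul_left (f true))
        ((h true).mul_right ((laurentPos m (zG m) (g true) (g false)).coeff 0))
      convert this using 1
      ring)
  exact ⟨f true, f false, (congrFun hf true).symm, (congrFun hf false).symm⟩

theorem exists_y (R S : GSeries m) : ∃ y : FSeries m, y = X .u * (1 + ι S * y + ι R * y ^ 2) := by
  obtain ⟨f, hf⟩ := exists_fixedPoint (s := FVar.u) (κ := Unit) (R := ℚ)
    (fun f : Unit → FSeries m => fun b => X .u * (1 + ι S * f b + ι R * f b ^ 2)) (by
    intro n f g h b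
    obtain ⟨c, hc⟩ := h b
    refine ⟨(ι S + ι R * (f b + g b)) * c, ?_⟩
    rw [pow_succ']
    linear_combination X FVar.u * (ι S + ι R * (f b + g b)) * hc)
  exact ⟨f (), (congrFun hf ()).symm⟩

end MapSeries

namespace MapSeries

variable {m : ℕ}

theorem ε_eval₂_ι (p : Polynomial (GSeries m)) {f : FSeries m} (hf : ε f = 0) :
    ε (p.eval₂ ι.toRingHom f) = p.coeff 0 := by
  change ε.toRingHom (p.eval₂ ι.toRingHom f) = _
  rw [Polynomial.hom_eval₂]
  have h1 : (ε : FSeries m →ₐ[ℚ] GSeries m).toRingHom.comp ι.toRingHom = RingHom.id _ :=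
    RingHom.ext ε_ι
  have h2 : (ε : FSeries m →ₐ[ℚ] GSeries m).toRingHom f = 0 := hf
  rw [h1, h2, Polynomial.eval₂_id, Polynomial.coeff_zero_eq_eval_zero]

theorem eq_of_tutte_eq {f g : FSeries m} (hf : tutte f = f) (hg : tutte g = g) : f = g := by
  refine eq_of_forall_X_pow_dvd_sub (s := FVar.t) fun n => ?_
  induction n with
  | zero => simp
  | succ n ih =>
    have := dvd_tutte_sub ih
    rwa [hf, hg] at this

theorem Δ_pow_sum (N : ℕ) (p : FSeries m) (hN : m ≤ N) :
    (Δ ^ (N + 1)) (∑ k ∈ Finset.range m, ι (zG m k) * (X .u ^ (N + 1 - k) * p)) =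
      ∑ k ∈ Finset.range m, zF m k * (Δ ^ k) p := by
  rw [map_sum]
  refine Finset.sum_congr rfl fun k hk => ?_
  have := Finset.mem_range.1 hk
  rw [Δ_pow_ι_mul, Δ_pow_X_u_pow_mul_of_ge (by omega), ι_zG,
    show N + 1 - (N + 1 - k) = k by omega]

/-- By uniqueness it suffices that the candidate, divided by t, solves Tutte's equation. The
equation for `R` supplies the value t at u = 0; the polynomial identity supplies the divided
difference. -/
theorem parametrized_eq {R S : GSeries m}
    (hR : R = X .t + X .t * R * (laurentPos m (zG m) R S).coeff 0)
    (hS : S = X .t * laurentConst m (zG m) R S) {y : FSeries m}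
    (hy : y = X .u * (1 + ι S * y + ι R * y ^ 2)) :
    parametrized ι.toRingHom m (X .t) (zG m) R S y = X .t * finiteFaceGF m := by
  have hιr : ∀ c : GSeries m, ι.toRingHom c = ι c := fun _ => rfl
  have : IsDomain (FSeries m) := NoZeroDivisors.to_isDomain _
  obtain ⟨N, c, hN, h⟩ := exists_parametrized_eq_of_isDomain (m := m) (z := zG m)
    (ι (m := m)).toRingHom hS (X_ne_zero FVar.u) hy
  have hεy : ε y = 0 := by
    rw [hy, map_mul, ε_X_u, zero_mul]
  have hε : ε (parametrized ι.toRingHom m (X .t) (zG m) R S y) = X .t := by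
    have h1 := ε_eval₂_ι (laurentFactor m (X .t) (zG m) R S) (f := ι R * y)
      (by rw [map_mul, hεy, mul_zero])
    have h2 : (laurentFactor m (X .t) (zG m) R S).coeff 0 =
        1 - X .t * (laurentPos m (zG m) R S).coeff 0 := by simp [laurentFactor]
    have h3 : ε (parametrized ι.toRingHom m (X .t) (zG m) R S y) =
        R * ε ((laurentFactor m (X .t) (zG m) R S).eval₂ ι.toRingHom (ι R * y)) := by
      unfold parametrized
      simp only [hιr]
      rw [map_mul, map_mul, ε_ι, map_add, map_add, map_mul, map_mul, map_pow, hεy, map_one]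
      simp only [mul_zero, ne_eq, OfNat.ofNat_ne_zero, not_false_eq_true, zero_pow, add_zero,
        mul_one]
    rw [h3, h1, h2]
    linear_combination hR
  have hdvd : X .t ∣ parametrized ι.toRingHom m (X .t) (zG m) R S y := by
    unfold parametrized
    refine Dvd.dvd.mul_right (Dvd.dvd.mul_right ?_ _) _
    rw [hιr, ← ι_X_t]
    refine map_dvd ι ⟨1 + R * (laurentPos m (zG m) R S).coeff 0, ?_⟩
    linear_combination hR
  generalize parametrized ι.toRingHom m (X .t) (zG m) R S y = p at h hε hdvd ⊢
  simp only [hιr] at h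
  -- `N + 1` divided differences remove the remainder, which has degree at most `N` in u, and lower
  -- the power of u in each other term.
  have hΔ : Δ p = X .t * ∑ k ∈ Finset.range m, zF m k * (Δ ^ k) p + X .u * p ^ 2 := by
    have h1 := congrArg (Δ ^ (N + 1)) h
    rw [map_add, map_add, Δ_pow_ι_mul, Δ_pow_sum N p hN, Δ_pow_X_u_pow_mul_of_ge N.le_succ,
      Δ_pow_X_u_pow_mul_of_le (by omega), map_sum, ι_X_t,
      show N + 1 - N = 1 by omega, show N + 2 - (N + 1) = 1 by omega, pow_one, pow_one,
      Finset.sum_eq_zero (s := Finset.range (N + 1)), add_zero] at h1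
    · exact h1
    · intro k _
      exact Δ_pow_X_u_pow_of_lt (by omega) _
  have hp := ι_ε_add p
  rw [hε, hΔ, ι_X_t] at hp
  obtain ⟨g, rfl⟩ := hdvd
  rw [eq_of_tutte_eq (tutte_finiteFaceGF m) (g := g)]
  have h1 : ∑ k ∈ Finset.range m, zF m k * (Δ ^ k) (X .t * g) =
      X .t * ∑ k ∈ Finset.range m, zF m k * (Δ ^ k) g := by
    rw [Finset.mul_sum]
    refine Finset.sum_congr rfl fun k _ => ?_
    rw [← ι_X_t, Δ_pow_ι_mul]
    ring
  rw [h1] at hp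
  have h2 : X FVar.t * (tutte g - g) = 0 := by
    unfold tutte
    linear_combination hp
  exact sub_eq_zero.1 ((mul_eq_zero.1 h2).resolve_left (X_ne_zero FVar.t))

end MapSeries

end Series

/-! ### Algebraicity from vanishing differentials. -/

section Unramified

open KaehlerDifferential

/-- If a finitely generated domain over a domain `A` is generated by elements divisible by a
non-unit `t ∈ A`, then it is algebraic: its differentials are annihilated by some `1 + c t`. -/
theorem Algebra.isAlgebraic_of_adjoin_eq_top_of_dvd {A C : Type*} [CommRing A] [IsDomain A]
    [CommRing C] [IsDomain C] [Algebra A C] [FaithfulSMul A C] {t : A}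
    (ht : ¬ IsUnit (algebraMap A C t)) {s : Set C} (hs : s.Finite)
    (hgen : Algebra.adjoin A s = ⊤) (hdvd : ∀ x ∈ s, algebraMap A C t ∣ x) :
    Algebra.IsAlgebraic A C := by
  have hfin : Algebra.FiniteType A C := ⟨⟨hs.toFinset, by simpa using hgen⟩⟩
  set I : Ideal C := Ideal.span {algebraMap A C t} with hI
  obtain ⟨r, hr1, hr⟩ : ∃ r, r - 1 ∈ I ∧ ∀ n ∈ (⊤ : Submodule C (Ω[C⁄A])), r • n = 0 := by
    refine Submodule.exists_sub_one_mem_and_smul_eq_zero_of_fg_of_le_smul I ⊤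
      Module.Finite.fg_top ?_
    rw [← KaehlerDifferential.span_range_derivation, Submodule.span_le,
      KaehlerDifferential.span_range_derivation]
    -- The hypothesis of Nakayama's lemma: each generator is t c, and d(t c) = t dc because t comes
    -- from `A`.
    have h0 : (I • (⊤ : Submodule C (Ω[C⁄A]))).mkQ.compDer (D A C) = 0 := by
      refine Derivation.ext_of_adjoin_eq_top s hgen fun x hx => ?_
      obtain ⟨c, rfl⟩ := hdvd x hx
      change (I • (⊤ : Submodule C (Ω[C⁄A]))).mkQ (D A C (algebraMap A C t * c)) = 0
      rw [Derivation.leibniz, Derivation.map_algebraMap, smul_zero, add_zero,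
        Submodule.mkQ_apply, Submodule.Quotient.mk_eq_zero]
      exact Submodule.smul_mem_smul (Ideal.mem_span_singleton_self _) trivial
    rintro _ ⟨x, rfl⟩
    have := congrArg (fun d => d x) h0
    simpa using this
  -- The annihilator is 1 modulo the non-unit t. It becomes invertible in the fraction field, where
  -- all differentials therefore vanish.
  have hr0 : r ≠ 0 := by
    rintro rfl
    rw [zero_sub, neg_mem_iff, hI, Ideal.mem_span_singleton] at hr1
    exact ht (isUnit_of_dvd_one hr1)
  set L := FractionRing C
  have hC : ∀ x : C, D A L (algebraMap C L x) = 0 := by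
    intro x
    have h1 : ((D A L).compAlgebraMap C) x = D A L (algebraMap C L x) := rfl
    have h2 : algebraMap C L r • D A L (algebraMap C L x) = 0 := by
      rw [algebraMap_smul, ← h1, ← Derivation.liftKaehlerDifferential_comp_D, ← map_smul,
        hr _ trivial, map_zero]
    exact (smul_eq_zero.1 h2).resolve_left
      fun h => hr0 (IsFractionRing.injective C L (by rw [h, map_zero]))
  have hD : ∀ x : L, D A L x = 0 := by
    intro x
    obtain ⟨a, b, _, rfl⟩ := IsFractionRing.div_surjective (A := C) x
    rw [Derivation.leibniz_div, hC, hC]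
    simp
  have : Algebra.FormallyUnramified A L := by
    refine ⟨⟨fun x y => ?_⟩⟩
    have h1 : (⊤ : Submodule L (Ω[L⁄A])) = ⊥ := by
      rw [← KaehlerDifferential.span_range_derivation, Submodule.span_eq_bot]
      rintro _ ⟨x, rfl⟩
      exact hD x
    have h2 : ∀ x : Ω[L⁄A], x = 0 := fun x => by
      have : x ∈ (⊤ : Submodule L (Ω[L⁄A])) := trivial
      rwa [h1, Submodule.mem_bot] at this
    rw [h2 x, h2 y]
  set K := FractionRing A
  -- An essentially finite, unramified extension of the field `K` is separable, in particular
  -- algebraic.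
  let _ : Algebra K L := FractionRing.liftAlgebra A L
  have := Algebra.EssFiniteType.comp A C L
  have := Algebra.EssFiniteType.of_comp A K L
  have := Algebra.FormallyUnramified.of_restrictScalars A K L
  have := Algebra.FormallyUnramified.isSeparable K L
  have : Algebra.IsAlgebraic A L := IsFractionRing.comap_isAlgebraic_iff.2
    (inferInstance : Algebra.IsAlgebraic K L)
  exact Algebra.IsAlgebraic.of_injective (IsScalarTower.toAlgHom A C L)
    (IsFractionRing.injective C L)

end Unramified

/-! ### Algebraicity of R, S, y, F and G. -/

section Series

open MvPowerSeries

namespace MapSeries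

section scalars

variable {σ : Type*}

theorem algebraMap_eq_coe (c : MvPolynomial σ ℚ) :
    algebraMap (MvPolynomial σ ℚ) (MvPowerSeries σ ℚ) c = c := by
  rw [algebraMap_apply']
  ext
  simp

theorem algebraMap_X (s : σ) :
    algebraMap (MvPolynomial σ ℚ) (MvPowerSeries σ ℚ) (MvPolynomial.X s) = X s := by
  rw [algebraMap_eq_coe, MvPolynomial.coe_X]

theorem algebraMap_injective :
    Function.Injective (algebraMap (MvPolynomial σ ℚ) (MvPowerSeries σ ℚ)) := by
  intro a b h
  rw [algebraMap_eq_coe, algebraMap_eq_coe] at h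
  exact MvPolynomial.coe_injective σ ℚ h

theorem isAlgebraic_X (s : σ) : IsAlgebraic (MvPolynomial σ ℚ) (X s : MvPowerSeries σ ℚ) := by
  rw [← algebraMap_X]
  exact isAlgebraic_algebraMap _

end scalars

variable {m : ℕ}

theorem zG_mem (C : Subalgebra (MvPolynomial (GVar m) ℚ) (GSeries m)) (k : ℕ) : zG m k ∈ C := by
  unfold zG faceWeight
  split
  · beta_reduce
    rw [← algebraMap_X]
    exact C.algebraMap_mem _
  · exact C.zero_mem

theorem laurent_mem {R S : GSeries m} (C : Subalgebra (MvPolynomial (GVar m) ℚ) (GSeries m))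
    (hR : R ∈ C) (hS : S ∈ C) :
    laurentConst m (zG m) R S ∈ C ∧ ∀ k, (laurentPos m (zG m) R S).coeff k ∈ C := by
  refine ⟨sum_mem fun k _ => mul_mem (zG_mem C k) (laurentPow_mem C hR hS k).1, fun k => ?_⟩
  rw [laurentPos, Polynomial.finsetSum_coeff]
  refine sum_mem fun l _ => ?_
  rw [Polynomial.coeff_C_mul]
  exact mul_mem (zG_mem C l) ((laurentPow_mem C hR hS l).2 k)

/-- The defining system exhibits both series as t times elements of the algebra they generate. There
t is not a unit, as its constant coefficient is zero. -/
theorem isAlgebraic_RS {R S : GSeries m}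
    (hR : R = X .t + X .t * R * (laurentPos m (zG m) R S).coeff 0)
    (hS : S = X .t * laurentConst m (zG m) R S) :
    IsAlgebraic (MvPolynomial (GVar m) ℚ) R ∧ IsAlgebraic (MvPolynomial (GVar m) ℚ) S := by
  have : IsDomain (GSeries m) := NoZeroDivisors.to_isDomain _
  set C := Algebra.adjoin (MvPolynomial (GVar m) ℚ) {R, S} with hC
  have hRC : R ∈ C := Algebra.subset_adjoin (by simp)
  have hSC : S ∈ C := Algebra.subset_adjoin (by simp)
  obtain ⟨h1, h2⟩ := laurent_mem C hRC hSC
  have hf : FaithfulSMul (MvPolynomial (GVar m) ℚ) C := by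
    rw [faithfulSMul_iff_algebraMap_injective]
    intro a b h
    exact algebraMap_injective (congrArg Subtype.val h)
  have hval : ((algebraMap (MvPolynomial (GVar m) ℚ) C (MvPolynomial.X .t) : C) : GSeries m) =
      X .t := algebraMap_X _
  have halg : Algebra.IsAlgebraic (MvPolynomial (GVar m) ℚ) C := by
    refine Algebra.isAlgebraic_of_adjoin_eq_top_of_dvd (t := MvPolynomial.X .t)
      (s := {⟨R, hRC⟩, ⟨S, hSC⟩}) ?_ (Set.toFinite _) ?_ ?_
    · intro h
      have h3 : IsUnit (X .t : GSeries m) := by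
        rw [← hval]
        exact h.map C.val
      have h4 := h3.map (constantCoeff (σ := GVar m) (R := ℚ))
      simp at h4
    · refine Subalgebra.map_injective (f := C.val) Subtype.val_injective ?_
      rw [AlgHom.map_adjoin, Algebra.map_top, Subalgebra.range_val, Set.image_pair]
      rfl
    · rintro x (rfl | rfl)
      · refine ⟨1 + ⟨R, hRC⟩ * ⟨_, h2 0⟩, Subtype.ext ?_⟩
        rw [MulMemClass.coe_mul, hval]
        change R = X .t * (1 + R * (laurentPos m (zG m) R S).coeff 0)
        linear_combination hR
      · refine ⟨⟨_, h1⟩, Subtype.ext ?_⟩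
        rw [MulMemClass.coe_mul, hval]
        exact hS
  exact ⟨(halg.isAlgebraic ⟨R, hRC⟩).algHom C.val, (halg.isAlgebraic ⟨S, hSC⟩).algHom C.val⟩

theorem isAlgebraic_ι {f : GSeries m} (hf : IsAlgebraic (MvPolynomial (GVar m) ℚ) f) :
    IsAlgebraic (MvPolynomial (FVar m) ℚ) (ι f) := by
  refine hf.ringHom_of_comp_eq (MvPolynomial.rename (R := ℚ) (GVar.emb m)) ι
    (MvPolynomial.rename_injective _ (GVar.emb m).injective) (RingHom.ext fun c => ?_)
  change algebraMap _ _ (MvPolynomial.rename (GVar.emb m) c) = ι (algebraMap _ _ c)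
  rw [algebraMap_eq_coe, algebraMap_eq_coe, ι, rename_coe]

/-- Set `u = 0` in a polynomial. -/
noncomputable def killU : MvPolynomial (FVar m) ℚ →ₐ[ℚ] MvPolynomial (GVar m) ℚ :=
  MvPolynomial.aeval fun
    | .t => MvPolynomial.X .t
    | .u => 0
    | .z i => MvPolynomial.X (.z i)

theorem ε_algebraMap (c : MvPolynomial (FVar m) ℚ) :
    ε (algebraMap _ (FSeries m) c) = algebraMap _ (GSeries m) (killU c) := by
  simp only [algebraMap_eq_coe]
  induction c using MvPolynomial.induction_on with
  | C a =>
    rw [MvPolynomial.coe_C, ε, killCompl_C, killU, MvPolynomial.aeval_C,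
      MvPolynomial.algebraMap_eq, MvPolynomial.coe_C]
  | add p q hp hq => rw [MvPolynomial.coe_add, map_add, map_add, MvPolynomial.coe_add, hp, hq]
  | mul_X p s hp =>
    rw [MvPolynomial.coe_mul, map_mul, map_mul, MvPolynomial.coe_mul, hp, MvPolynomial.coe_X]
    congr 1
    rcases s with _ | _ | i
    · simp [killU, ε_X_t]
    · simp [killU, ε_X_u]
    · simp [killU, ε_X_z]

/-- Needed for the kernel of `killU`: a polynomial that vanishes at u = 0 is divisible by u. -/
theorem exists_eq_rename_killU_add (c : MvPolynomial (FVar m) ℚ) :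
    ∃ d, c = MvPolynomial.rename (GVar.emb m) (killU c) + MvPolynomial.X .u * d := by
  induction c using MvPolynomial.induction_on with
  | C a => exact ⟨0, by simp [killU]⟩
  | add p q hp hq =>
    obtain ⟨d, hd⟩ := hp
    obtain ⟨e, he⟩ := hq
    refine ⟨d + e, ?_⟩
    rw [map_add, map_add]
    linear_combination hd + he
  | mul_X p s hp =>
    obtain ⟨d, hd⟩ := hp
    rcases s with _ | _ | i
    · refine ⟨d * MvPolynomial.X .t, ?_⟩
      have : killU (MvPolynomial.X .t : MvPolynomial (FVar m) ℚ) = MvPolynomial.X .t := by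
        simp [killU]
      rw [map_mul, map_mul, this, MvPolynomial.rename_X, GVar.emb_t]
      linear_combination MvPolynomial.X FVar.t * hd
    · refine ⟨p, ?_⟩
      have : killU (MvPolynomial.X .u : MvPolynomial (FVar m) ℚ) = 0 := by simp [killU]
      rw [map_mul, this, mul_zero, map_zero]
      ring
    · refine ⟨d * MvPolynomial.X (.z i), ?_⟩
      have : killU (MvPolynomial.X (.z i) : MvPolynomial (FVar m) ℚ) = MvPolynomial.X (.z i) := by
        simp [killU]
      rw [map_mul, map_mul, this, MvPolynomial.rename_X, GVar.emb_z]
      linear_combination MvPolynomial.X (FVar.z i) * hd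

/-- Setting u = 0 might annihilate the polynomial equation of `f`. Dividing that equation by the
highest power of u in it prevents this and keeps `f` a root, as the series form a domain. -/
theorem isAlgebraic_ε {f : FSeries m} (hf : IsAlgebraic (MvPolynomial (FVar m) ℚ) f) :
    IsAlgebraic (MvPolynomial (GVar m) ℚ) (ε f) := by
  obtain ⟨p, hp, hpf⟩ := hf
  set c : Polynomial (MvPolynomial (FVar m) ℚ) := Polynomial.C (MvPolynomial.X .u) with hc
  have hcu : ¬ IsUnit c := by
    rw [hc, Polynomial.isUnit_C]
    intro h
    have := h.map (MvPolynomial.constantCoeff (σ := FVar m) (R := ℚ))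
    simp at this
  obtain ⟨q, hq, hcq⟩ :=
    (FiniteMultiplicity.of_not_isUnit hcu hp).exists_eq_pow_mul_and_not_dvd
  have hqf : Polynomial.aeval f q = 0 := by
    rw [hq, map_mul, map_pow, hc, Polynomial.aeval_C, algebraMap_X] at hpf
    exact (mul_eq_zero.1 hpf).resolve_left (pow_ne_zero _ (X_ne_zero _))
  refine ⟨q.map killU.toRingHom, fun h => hcq ?_, ?_⟩
  · rw [hc, Polynomial.C_dvd_iff_dvd_coeff]
    intro i
    have h1 : killU (q.coeff i) = 0 := by
      have := congrArg (fun p => Polynomial.coeff p i) h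
      simpa using this
    obtain ⟨d, hd⟩ := exists_eq_rename_killU_add (q.coeff i)
    rw [h1, map_zero, zero_add] at hd
    exact ⟨d, hd⟩
  · have h1 : ε.toRingHom (Polynomial.aeval f q) = 0 := by rw [hqf, map_zero]
    rw [Polynomial.aeval_def, Polynomial.hom_eval₂] at h1
    rw [Polynomial.aeval_def, Polynomial.eval₂_map, ← h1]
    congr 1
    exact RingHom.ext fun c => (ε_algebraMap c).symm

theorem isAlgebraic_of_X_mul {s : FVar m} {f : FSeries m}
    (hf : IsAlgebraic (MvPolynomial (FVar m) ℚ) (X s * f)) :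
    IsAlgebraic (MvPolynomial (FVar m) ℚ) f :=
  IsAlgebraic.of_mul (mem_nonZeroDivisors_of_ne_zero (X_ne_zero s)) (isAlgebraic_X s) hf

/-- By u Δ f = f - f(0), each step only needs the case u = 0 and a division by u. -/
theorem isAlgebraic_Δ_pow {f : FSeries m} (hf : IsAlgebraic (MvPolynomial (FVar m) ℚ) f) (k : ℕ) :
    IsAlgebraic (MvPolynomial (FVar m) ℚ) ((Δ ^ k) f) := by
  induction k with
  | zero => exact hf
  | succ k ih =>
    rw [pow_succ', Module.End.mul_apply]
    refine isAlgebraic_of_X_mul (s := .u) ?_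
    rw [eq_sub_of_add_eq' (ι_ε_add ((Δ ^ k) f))]
    exact ih.sub (isAlgebraic_ι (isAlgebraic_ε ih))

theorem isAlgebraic_y {R S : GSeries m} (hR : IsAlgebraic (MvPolynomial (GVar m) ℚ) R)
    (hS : IsAlgebraic (MvPolynomial (GVar m) ℚ) S) {y : FSeries m}
    (hy : y = X .u * (1 + ι S * y + ι R * y ^ 2)) : IsAlgebraic (MvPolynomial (FVar m) ℚ) y := by
  set E := Subalgebra.algebraicClosure (MvPolynomial (FVar m) ℚ) (FSeries m)
  let r : E := ⟨ι R, isAlgebraic_ι hR⟩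
  let s : E := ⟨ι S, isAlgebraic_ι hS⟩
  let u : E := ⟨X .u, isAlgebraic_X _⟩
  -- The quadratic equation of `y` has coefficients in the algebra `E` of algebraic series. It is
  -- nontrivial because its constant term is u.
  refine IsAlgebraic.restrictScalars (MvPolynomial (FVar m) ℚ) (S := E) ?_
  refine ⟨Polynomial.C u + Polynomial.C (u * s - 1) * Polynomial.X +
    Polynomial.C (u * r) * Polynomial.X ^ 2, fun h => ?_, ?_⟩
  · have h1 := congrArg (fun p => Polynomial.coeff p 0) h
    have h2 : u = 0 := by simpa using h1
    exact X_ne_zero FVar.u (congrArg Subtype.val h2)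
  · simp only [map_add, map_mul, map_pow, Polynomial.aeval_C, Polynomial.aeval_X]
    change X .u + (X .u * ι S - 1) * y + X .u * ι R * y ^ 2 = 0
    linear_combination -hy

theorem isAlgebraic_finiteFaceGF (m : ℕ) :
    IsAlgebraic (MvPolynomial (FVar m) ℚ) (finiteFaceGF m) := by
  obtain ⟨R, S, hR, hS⟩ := exists_RS m
  obtain ⟨hRa, hSa⟩ := isAlgebraic_RS hR hS
  obtain ⟨y, hy⟩ := exists_y R S
  have hya := isAlgebraic_y hRa hSa hy
  refine isAlgebraic_of_X_mul (s := .t) ?_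
  rw [← parametrized_eq hR hS hy]
  set B := Subalgebra.algebraicClosure (MvPolynomial (GVar m) ℚ) (GSeries m)
  set E := Subalgebra.algebraicClosure (MvPolynomial (FVar m) ℚ) (FSeries m)
  have hR' : ι R ∈ E := isAlgebraic_ι hRa
  have hS' : ι S ∈ E := isAlgebraic_ι hSa
  have hy' : y ∈ E := hya
  have hq : ∀ k, (laurentFactor m (X .t) (zG m) R S).coeff k ∈ B := by
    intro k
    rw [laurentFactor, Polynomial.coeff_sub, Polynomial.coeff_C_mul, Polynomial.coeff_one]
    refine sub_mem ?_ (mul_mem (isAlgebraic_X _) ((laurent_mem B hRa hSa).2 k))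
    split
    · exact B.one_mem
    · exact B.zero_mem
  change _ ∈ E
  unfold parametrized
  refine mul_mem (mul_mem hR' (add_mem (add_mem E.one_mem (mul_mem hS' hy'))
    (mul_mem hR' (pow_mem hy' 2)))) ?_
  rw [Polynomial.eval₂_eq_sum_range]
  exact sum_mem fun k _ => mul_mem (isAlgebraic_ι (hq k)) (pow_mem (mul_mem hR' hy') k)

theorem isAlgebraic_allFaceGF (m : ℕ) :
    IsAlgebraic (MvPolynomial (GVar m) ℚ) (allFaceGF m) := by
  rw [allFaceGF_eq]
  change _ ∈ Subalgebra.algebraicClosure (MvPolynomial (GVar m) ℚ) (GSeries m)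
  refine add_mem (one_mem _) (sum_mem fun k _ => mul_mem (zG_mem _ k) ?_)
  exact isAlgebraic_ε (isAlgebraic_Δ_pow (isAlgebraic_finiteFaceGF m) _)

end MapSeries

end Series

theorem mainTheorem5 (m : ℕ) (hm : 1 ≤ m) :
    IsAlgebraic (MvPolynomial (FVar m) ℚ) (finiteFaceGF m) ∧
      IsAlgebraic (MvPolynomial (GVar m) ℚ) (allFaceGF m) := by
  exact ⟨MapSeries.isAlgebraic_finiteFaceGF m, MapSeries.isAlgebraic_allFaceGF m⟩
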